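/- Notation: for real $R\ge 1$ and an integer $n$ put $$\Lambda_R(n) := \sum_{d\ge 1,\ d\mid n,\ d\le R} \mu(d)\log(R/d),$$ where $\mu$ is the Möbius function; $\phi$ is Euler's totient function. Fix a real number $c>0$ and put $R = R(N) := N^{c}$ for positive integers $N$. For a function $w:\mathbb N\to\mathbb R$ with $w(N)\to\infty$ put $W = W(N) := \prod_{p\le w(N)} p$, the product of the primes up to $w(N)$. Proposition (Goldston–Yıldırım). If $w$ tends to infinity sufficiently slowly, then the following holds. (That is: there is a function $g$ with $g(N)\to\infty$, depending only on $c$, such that the following holds for every $w$ with $w(N)\to\infty$ and $w(N)\le g(N)$ for all large $N$.) Let $m,t$ be positive integers. For $1\le i\le m$ let $$\psi_i(\mathbf x) := \sum_{j=1}^t L_{ij}x_j + b_i$$ be affine-linear forms with integer coefficients $L_{ij}$ and integers $b_i$, such that $|L_{ij}|\le \sqrt{w(N)}/2$ for all $i,j$. Assume that none of the $t$-tuples $(L_{ij})_{j=1}^t$ is identically zero and that no two of them (for distinct indices $i$) are rational multiples of each other. Write $\theta_i := W\psi_i+1$. Let $B=\prod_{j=1}^t I_j\subset\mathbb R^t$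 be a product of $t$ bounded intervals, each of length at least $R^{10m}$. Then, as $N\to\infty$, $$\mathbb E\big(\Lambda_R(\theta_1(\mathbf x))^2\cdots\Lambda_R(\theta_m(\mathbf x))^2 \,\big|\, \mathbf x\in B\cap\mathbb Z^t\big) = (1+o_{m,t}(1))\left(\frac{W\log R}{\phi(W)}\right)^m,$$ where $\mathbb E(\,\cdot\mid \mathbf x\in B\cap\mathbb Z^t)$ is the average over the integer points of $B$. For fixed $c$ and $w$ the rate of decay of the $o_{m,t}(1)$ term depends only on $m$ and $t$: it is uniform in the forms $\psi_i$ (in particular in the $b_i$) and in the box $B$. -/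

import Mathlib

open Filter

namespace GoldstonYildirim

/-- The truncated divisor sum: the sum of `μ(d) log (R / d)` over the positive integers `d ≤ R`
which divide `n`. The argument `n` is an arbitrary integer. -/
noncomputable def truncatedDivisorSum (R : ℝ) (n : ℤ) : ℝ :=
  ∑ d ∈ (Finset.Icc 1 ⌊R⌋₊).filter (fun d : ℕ => (d : ℤ) ∣ n),
    (ArithmeticFunction.moebius d : ℝ) * Real.log (R / (d : ℝ))

/-- The affine-linear form `x ↦ ∑ j, L j * x j + b` in `t` integer variables. -/
def affineForm {t : ℕ} (L : Fin t → ℤ) (b : ℤ) (x : Fin t → ℤ) : ℤ :=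
  ∑ j, L j * x j + b

/-- `I` is a bounded interval (open, closed or half-open) with end points `lo` and `hi`;
if `lo ≤ hi` then its length is `hi - lo`. -/
def IsIntervalWithEndpoints (I : Set ℝ) (lo hi : ℝ) : Prop :=
  Set.Ioo lo hi ⊆ I ∧ I ⊆ Set.Icc lo hi

/-- The integer points of the box `∏ j, I j` in `ℝ ^ t`. -/
def boxPoints {t : ℕ} (I : Fin t → Set ℝ) : Set (Fin t → ℤ) :=
  {x | ∀ j, (x j : ℝ) ∈ I j}

/-- The average of `f` over a set `S`, used below for finite non-empty `S`. -/
noncomputable def average {α : Type*} (S : Set α) (f : α → ℝ) : ℝ :=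
  (∑ᶠ x ∈ S, f x) / (S.ncard : ℝ)

end GoldstonYildirim

/-!
The truncated divisor sum `Λ_R(θ)` depends only on the set `D` of those primes `p ∈ (w, R]` which
divide `θ`: it equals `∏ p ∈ D, (1 - T p)` applied to the truncated logarithm `log⁺` at `R`, where
`T p f = f (· / p)` (`truncatedDivisorSum_eq_diffOp`). So the average in question is the mean of a
function of the random sets `D 1, …, D m` of primes dividing the `m` forms at a random point of the
box, and the proof compares it with a model in which everything is independent.

*From the box to a model.* Expanding the squares gives conditions on `x` modulo integers of size at
most `R ^ (2 * m)`, which is tiny compared with the sides of the box. By the Chinese remainder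
theorem the average may be computed as if the residues of `x` modulo the primes in `(w, R]` were
uniform and independent (`abs_box_mean_sub_modelMean_le`).

*From the model to independent forms.* For each prime `p > w` the coefficients of a form and the
minors of a pair of forms are smaller than `p`, so modulo `p` the forms are non-constant and
pairwise independent. Hence a form is divisible by `p` with probability `1 / p`, two of them with
probability `1 / p ^ 2`, and the joint law differs from the independent one by `O(1 / p ^ 2)`
(`abs_localLaw_sub_bernoulliLaw_le`). As `∑ p > w, 1 / p ^ 2` is small, replacing all the laws costs
a factor `1 + o(1)` (`abs_modelMean_sub_pow_le`): the terms of the expansion are dominated by mean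
squares for one form at levels `y ≤ R`. What is left is the `m`-th power of the mean square
`sieveEnergy` of a single form, in which every prime `p ∈ (w, R]` divides with probability `1 / p`.

*One form.* The mean square is asymptotically `(W / φ(W)) log R`, up to a factor tending
to `1` as `w` tends to infinity. The lower bound is Selberg's, `sq_le_dilSum_mul_sieveEnergy`, a
Cauchy-Schwarz inequality proved one prime at a time. For the upper bound the mean square is at most
`∑ n ≤ R, (n, W) = 1, G (R / n) ^ 2 / n`, where `G` is obtained from `log⁺` by applying
`∏ (1 - T p / p)` (`sieveEnergy_le_factoredSum`). Here `G y` is bounded and tends to `W / φ(W)`; for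
`W = 1` this says that `∑ n ≤ y, μ(n) / n * log (y / n)` tends to `1` (`tendsto_moebiusLogSum`),
which follows from the non-vanishing of zeta on `Re s = 1` by a Wiener-Ikehara type theorem
(`tendsto_zero_of_laplace_continuous`).

All of this is for fixed `w` and large `R` (`eventually_uniformAsymptotic`); a diagonal argument
(`exists_slow_growth`) yields a sufficiently slowly growing `w`.
-/

namespace GoldstonYildirim

/-! ### A Tauberian theorem -/

section Tauberian

open MeasureTheory Set
open scoped FourierTransform SchwartzMap Topology ContDiff

/-- Parseval's identity for the Laplace transform of `g` on the line `Re s = σ`, tested against a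
Schwartz function `φ`. -/
lemma integral_mul_fourier_eq_integral_laplace {g : ℝ → ℝ} {B : ℝ} {κ : ℂ → ℂ}
    (hmeas : Measurable g) (hB : ∀ v, |g v| ≤ B)
    (hL : ∀ s : ℂ, 0 < s.re → ∫ v in Ioi (0 : ℝ), (g v : ℂ) * Complex.exp (-(s * v)) = κ s)
    (φ : 𝓢(ℝ, ℂ)) (u : ℝ) {σ : ℝ} (hσ : 0 < σ) :
    ∫ v in Ioi (0 : ℝ), ((g v : ℂ) * Complex.exp (-(σ * v : ℝ))) * 𝓕 (φ : ℝ → ℂ) (v - u) =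
      ∫ t : ℝ, (φ t * κ (σ + 2 * Real.pi * t * Complex.I)) *
        Complex.exp ((2 * Real.pi * t * u : ℝ) * Complex.I) := by
  have h1 : ∀ v : ℝ, 𝓕 (φ : ℝ → ℂ) (v - u) =
      ∫ t : ℝ, Complex.exp ((-2 * Real.pi * t * (v - u) : ℝ) * Complex.I) * φ t := fun v => by
    rw [Real.fourier_real_eq_integral_exp_smul]; rfl
  simp_rw [h1, ← integral_const_mul]
  rw [integral_integral_swap]
  · congr 1
    ext t
    rw [← hL _ (by simp [hσ]), ← integral_const_mul, ← integral_mul_const]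
    congr 1
    ext v
    calc _ = φ t * g v * (Complex.exp (-(σ * v : ℝ)) *
          Complex.exp ((-2 * Real.pi * t * (v - u) : ℝ) * Complex.I)) := by ring
      _ = φ t * g v * (Complex.exp (-((σ + 2 * Real.pi * t * Complex.I) * v)) *
          Complex.exp ((2 * Real.pi * t * u : ℝ) * Complex.I)) := by
        rw [← Complex.exp_add, ← Complex.exp_add]
        congr 2
        push_cast
        ring
      _ = _ := by ring
  · have h2 : Integrable (fun v : ℝ => (g v : ℂ) * Complex.exp (-(σ * v : ℝ)))
        (volume.restrict (Ioi 0)) := by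
      have h3 : Integrable (fun v : ℝ => Complex.exp (-(σ * v : ℝ)))
          (volume.restrict (Ioi 0)) := by
        have := (integrableOn_exp_mul_Ioi (a := -σ) (by linarith) 0).ofReal (𝕜 := ℂ)
        refine this.congr (Eventually.of_forall fun v => ?_)
        simp
      refine h3.bdd_mul (c := B) (by fun_prop) (Eventually.of_forall fun v => ?_)
      simpa using hB v
    have h4 := h2.mul_prod (φ.integrable (μ := volume))
    have h5 : Integrable (fun z : ℝ × ℝ =>
        Complex.exp ((-2 * Real.pi * z.2 * (z.1 - u) : ℝ) * Complex.I) *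
        (((g z.1 : ℂ) * Complex.exp (-(σ * z.1 : ℝ))) * φ z.2))
        ((volume.restrict (Ioi 0)).prod volume) := by
      refine h4.bdd_mul (c := 1) ?_ (Eventually.of_forall fun v => ?_)
      · exact (by fun_prop : Continuous _).aestronglyMeasurable
      · rw [Complex.norm_exp_ofReal_mul_I]
    refine h5.congr (Eventually.of_forall fun z => ?_)
    simp only [Function.uncurry]
    ring

/-- Letting `σ → 0` in Parseval's identity and applying the Riemann-Lebesgue lemma: the mean of `g`
around `u`, with weight the Fourier transform of a compactly supported `φ`, tends to zero. -/
lemma tendsto_integral_mul_fourier_zero {g : ℝ → ℝ} {B : ℝ} {κ : ℂ → ℂ}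
    (hmeas : Measurable g) (hB : ∀ v, |g v| ≤ B) (hneg : ∀ v < 0, g v = 0)
    (hκ : ContinuousOn κ {s | 0 ≤ s.re})
    (hL : ∀ s : ℂ, 0 < s.re → ∫ v in Ioi (0 : ℝ), (g v : ℂ) * Complex.exp (-(s * v)) = κ s)
    (φ : 𝓢(ℝ, ℂ)) (hφ : HasCompactSupport (φ : ℝ → ℂ)) :
    Tendsto (fun u : ℝ => ∫ v : ℝ, (g (u + v) : ℂ) * 𝓕 (φ : ℝ → ℂ) v) atTop (𝓝 0) := by
  have hK : Integrable (𝓕 (φ : ℝ → ℂ)) := by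
    rw [← SchwartzMap.fourier_coe]; exact (𝓕 φ).integrable
  have key : ∀ u : ℝ, ∫ v : ℝ, (g (u + v) : ℂ) * 𝓕 (φ : ℝ → ℂ) v =
      ∫ t : ℝ, (φ t * κ (2 * Real.pi * t * Complex.I)) *
        Complex.exp ((2 * Real.pi * t * u : ℝ) * Complex.I) := by
    intro u
    have e1 : ∫ v : ℝ, (g (u + v) : ℂ) * 𝓕 (φ : ℝ → ℂ) v =
        ∫ v in Ioi (0 : ℝ), (g v : ℂ) * 𝓕 (φ : ℝ → ℂ) (v - u) := by
      have : ∫ v : ℝ, (g (u + v) : ℂ) * 𝓕 (φ : ℝ → ℂ) v =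
          ∫ v : ℝ, (g v : ℂ) * 𝓕 (φ : ℝ → ℂ) (v - u) := by
        rw [← integral_sub_right_eq_self _ u]
        congr 1; ext v; simp
      rw [this, ← integral_Ici_eq_integral_Ioi, setIntegral_eq_integral_of_forall_compl_eq_zero]
      intro v hv
      rw [hneg v (by simpa using hv)]; simp
    rw [e1]
    have l1 : Tendsto (fun σ : ℝ => ∫ v in Ioi (0 : ℝ),
        ((g v : ℂ) * Complex.exp (-(σ * v : ℝ))) * 𝓕 (φ : ℝ → ℂ) (v - u)) (𝓝[>] 0)
        (𝓝 (∫ v in Ioi (0 : ℝ), (g v : ℂ) * 𝓕 (φ : ℝ → ℂ) (v - u))) := by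
      refine tendsto_integral_filter_of_dominated_convergence
        (fun v => B * ‖𝓕 (φ : ℝ → ℂ) (v - u)‖) ?_ ?_ ?_ ?_
      · refine Eventually.of_forall fun σ => ?_
        refine AEStronglyMeasurable.mul ?_ (hK.comp_sub_right u).aestronglyMeasurable.restrict
        exact AEStronglyMeasurable.mul (by fun_prop)
          (by fun_prop : Continuous _).aestronglyMeasurable
      · filter_upwards [self_mem_nhdsWithin] with σ hσ
        refine (ae_restrict_iff' measurableSet_Ioi).2 (Eventually.of_forall fun v hv => ?_)
        rw [norm_mul, norm_mul]
        gcongr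
        rw [← Complex.ofReal_neg, ← Complex.ofReal_exp, Complex.norm_real, Complex.norm_real,
          Real.norm_eq_abs, Real.norm_of_nonneg (Real.exp_pos _).le]
        have h0 : Real.exp (-(σ * v)) ≤ 1 := by
          rw [Real.exp_le_one_iff]
          have := mul_pos (show 0 < σ from hσ) (show 0 < v from hv)
          linarith
        calc _ ≤ |g v| * 1 := by gcongr
          _ ≤ B := by simpa using hB v
      · exact ((hK.comp_sub_right u).norm.const_mul B).restrict
      · refine Eventually.of_forall fun v => ?_
        have : Continuous fun σ : ℝ =>
          ((g v : ℂ) * Complex.exp (-(σ * v : ℝ))) * 𝓕 (φ : ℝ → ℂ) (v - u) := by fun_prop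
        have h := (this.tendsto 0).mono_left (nhdsWithin_le_nhds (s := Ioi 0))
        simpa using h
    have l2 : Tendsto (fun σ : ℝ => ∫ t : ℝ, (φ t * κ (σ + 2 * Real.pi * t * Complex.I)) *
        Complex.exp ((2 * Real.pi * t * u : ℝ) * Complex.I)) (𝓝[>] 0)
        (𝓝 (∫ t : ℝ, (φ t * κ (2 * Real.pi * t * Complex.I)) *
        Complex.exp ((2 * Real.pi * t * u : ℝ) * Complex.I))) := by
      obtain ⟨C, hC⟩ : ∃ C, ∀ z ∈ (Icc (0 : ℝ) 1) ×ˢ tsupport (φ : ℝ → ℂ),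
          ‖κ ((z.1 : ℂ) + 2 * Real.pi * z.2 * Complex.I)‖ ≤ C := by
        refine (isCompact_Icc.prod hφ.isCompact).exists_bound_of_continuousOn ?_
        refine hκ.comp (by fun_prop) ?_
        rintro ⟨a, b⟩ ⟨ha, hb⟩
        simpa using ha.1
      have hcont : ∀ σ : ℝ, 0 ≤ σ → Continuous fun t : ℝ =>
          κ (σ + 2 * Real.pi * t * Complex.I) := fun σ hσ =>
        hκ.comp_continuous (by fun_prop) (fun t => by simpa using hσ)
      refine tendsto_integral_filter_of_dominated_convergence (fun t => ‖φ t‖ * C) ?_ ?_ ?_ ?_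
      · filter_upwards [self_mem_nhdsWithin] with σ hσ
        have := hcont σ (le_of_lt hσ)
        exact ((φ.continuous.mul this).mul (by fun_prop)).aestronglyMeasurable
      · filter_upwards [Ioo_mem_nhdsGT (zero_lt_one' ℝ)] with σ hσ
        refine Eventually.of_forall fun t => ?_
        rw [norm_mul, Complex.norm_exp_ofReal_mul_I, mul_one, norm_mul]
        by_cases ht : t ∈ tsupport (φ : ℝ → ℂ)
        · gcongr
          exact hC (σ, t) ⟨⟨hσ.1.le, hσ.2.le⟩, ht⟩
        · simp [image_eq_zero_of_notMem_tsupport ht]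
      · exact φ.integrable.norm.mul_const C
      · refine Eventually.of_forall fun t => ?_
        refine Tendsto.mul_const _ (Tendsto.const_mul _ ?_)
        have h0 : ContinuousWithinAt (fun σ : ℝ => κ (σ + 2 * Real.pi * t * Complex.I))
            (Ici 0) 0 := by
          refine ContinuousOn.continuousWithinAt ?_ (mem_Ici.2 le_rfl)
          exact hκ.comp (by fun_prop) (fun σ hσ => by simpa using hσ)
        have := h0.tendsto.mono_left (nhdsWithin_mono _ Ioi_subset_Ici_self)
        simpa using this
    refine tendsto_nhds_unique l1 (l2.congr' ?_)
    filter_upwards [self_mem_nhdsWithin] with σ hσ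
    exact (integral_mul_fourier_eq_integral_laplace hmeas hB hL φ u hσ).symm
  simp_rw [key]
  have := Real.tendsto_integral_exp_smul_cocompact
    (fun t : ℝ => φ t * κ (2 * Real.pi * t * Complex.I))
  have h2 := this.comp ((tendsto_neg_atTop_atBot).mono_right atBot_le_cocompact)
  refine h2.congr fun u => ?_
  simp only [Function.comp]
  congr 1
  ext t
  rw [Circle.smul_def, Real.fourierChar_apply, smul_eq_mul, mul_comm]
  congr 3
  push_cast; ring

/-- A Tauberian theorem of Wiener-Ikehara type: a bounded, slowly oscillating function on the half
line tends to zero if its Laplace transform extends continuously to the closed half plane. -/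
theorem tendsto_zero_of_laplace_continuous {g : ℝ → ℝ} {B C : ℝ} {κ : ℂ → ℂ}
    (hmeas : Measurable g) (hB : ∀ v, |g v| ≤ B) (hneg : ∀ v < 0, g v = 0)
    (hosc : ∀ u v, 1 ≤ u → |g u - g (u + v)| ≤ C * (|v| * (1 + |v|)))
    (hκ : ContinuousOn κ {s | 0 ≤ s.re})
    (hL : ∀ s : ℂ, 0 < s.re → ∫ v in Ioi (0 : ℝ), (g v : ℂ) * Complex.exp (-(s * v)) = κ s) :
    Tendsto g atTop (𝓝 0) := by
  let b : ContDiffBump (0 : ℝ) := ⟨1, 2, zero_lt_one, one_lt_two⟩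
  have hbs : HasCompactSupport (fun t : ℝ => (b t : ℂ)) :=
    b.hasCompactSupport.comp_left (g := fun x : ℝ => (x : ℂ)) (by simp)
  have hbd : ContDiff ℝ ∞ (fun t : ℝ => (b t : ℂ)) := Complex.ofRealCLM.contDiff.comp b.contDiff
  let φ : 𝓢(ℝ, ℂ) := hbs.toSchwartzMap hbd
  have hφs : HasCompactSupport (φ : ℝ → ℂ) := hbs
  set K : ℝ → ℂ := 𝓕 (φ : ℝ → ℂ) with hKdef
  have hKS : K = (𝓕 φ : 𝓢(ℝ, ℂ)) := (SchwartzMap.fourier_coe φ).symm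
  have hKi : Integrable K := by rw [hKS]; exact (𝓕 φ).integrable
  have hK1 : ∫ v, K v = 1 := by
    have h1 : (𝓕⁻ (𝓕 φ) : 𝓢(ℝ, ℂ)) 0 = φ 0 := by rw [FourierTransform.fourierInv_fourier_eq]
    have h2 : φ 0 = 1 := by
      change ((b 0 : ℝ) : ℂ) = 1
      rw [b.one_of_mem_closedBall (by simp [b.rIn_pos.le])]; simp
    rw [SchwartzMap.fourierInv_coe, Real.fourierInv_eq', h2] at h1
    rw [hKS, ← h1]
    simp
  set D : ℝ := ∫ v, |v| * (1 + |v|) * ‖K v‖ with hD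
  have hDi : Integrable (fun v => |v| * (1 + |v|) * ‖K v‖) := by
    have h1 := (𝓕 φ).integrable_pow_mul volume 1
    have h2 := (𝓕 φ).integrable_pow_mul volume 2
    rw [← hKS] at h1 h2
    refine (h1.add h2).congr (Eventually.of_forall fun v => ?_)
    simp only [Pi.add_apply, Real.norm_eq_abs]; ring
  have hD0 : 0 ≤ D := integral_nonneg fun v => by positivity
  have hC0 : 0 ≤ C := by
    have := (abs_nonneg _).trans (hosc 1 1 le_rfl)
    norm_num at this; linarith
  -- dilating `g` by `a` divides its oscillation by `a`
  have main : ∀ a : ℝ, 1 ≤ a → ∀ᶠ u in atTop, |g (u / a)| ≤ (C * D + 1) / a := by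
    intro a ha
    have ha0 : 0 < a := by linarith
    have hL' : ∀ s : ℂ, 0 < s.re →
        ∫ v in Ioi (0 : ℝ), ((fun v => g (v / a)) v : ℂ) * Complex.exp (-(s * v)) =
          (fun s => (a : ℂ) * κ (a * s)) s := by
      intro s hs
      have h1 := integral_comp_mul_left_Ioi
        (fun v : ℝ => (g v : ℂ) * Complex.exp (-((a * s) * v))) 0 (b := a⁻¹) (by positivity)
      rw [mul_zero, hL (a * s) (by simp [ha0, hs]), inv_inv, Complex.real_smul] at h1
      refine Eq.trans ?_ h1
      congr 1
      ext v
      have ha' : (a : ℂ) ≠ 0 := by exact_mod_cast ha0.ne'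
      congr 2
      · beta_reduce; rw [div_eq_inv_mul]
      · push_cast; field_simp
    have hκ' : ContinuousOn (fun s => (a : ℂ) * κ (a * s)) {s | 0 ≤ s.re} := by
      refine continuousOn_const.mul (hκ.comp (by fun_prop) ?_)
      intro s hs
      simpa using mul_nonneg ha0.le hs
    have ht := tendsto_integral_mul_fourier_zero (g := fun v => g (v / a)) (B := B)
      (hmeas.comp (measurable_id.div_const a)) (fun v => hB _)
      (fun v hv => hneg _ (div_neg_of_neg_of_pos hv ha0)) hκ' hL' φ hφs
    have ht2 := (Metric.tendsto_nhds.1 ht) (1 / a) (by positivity)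
    filter_upwards [ht2, eventually_ge_atTop a] with u hu hua
    rw [dist_zero_right] at hu
    have hgi : ∀ w : ℝ, Integrable (fun v => (g ((w + v) / a) : ℂ) * K v) := fun w => by
      refine hKi.bdd_mul (c := B) ?_ (Eventually.of_forall fun v => by simpa using hB _)
      exact (by fun_prop : Measurable fun v : ℝ => (g ((w + v) / a) : ℂ)).aestronglyMeasurable
    have hdiff : (g (u / a) : ℂ) - ∫ v, (g ((u + v) / a) : ℂ) * K v =
        ∫ v, ((g (u / a) : ℂ) - g ((u + v) / a)) * K v := by
      simp_rw [sub_mul]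
      rw [integral_sub (hKi.const_mul _) (hgi u), integral_const_mul, hK1, mul_one]
    have hle : ‖∫ v, ((g (u / a) : ℂ) - g ((u + v) / a)) * K v‖ ≤ C * D / a := by
      have : C * D / a = ∫ v, C / a * (|v| * (1 + |v|) * ‖K v‖) := by
        rw [integral_const_mul, hD]; ring
      rw [this]
      refine norm_integral_le_of_norm_le (hDi.const_mul _) (Eventually.of_forall fun v => ?_)
      rw [norm_mul, ← Complex.ofReal_sub, Complex.norm_real, Real.norm_eq_abs, ← mul_assoc]
      refine mul_le_mul_of_nonneg_right ?_ (norm_nonneg _)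
      have h1 := hosc (u / a) (v / a) (by rw [le_div_iff₀ ha0]; linarith)
      rw [← add_div] at h1
      refine h1.trans ?_
      rw [abs_div, abs_of_pos ha0]
      calc C * (|v| / a * (1 + |v| / a)) = C / a * (|v| * (1 + |v| / a)) := by ring
        _ ≤ C / a * (|v| * (1 + |v|)) := by
          gcongr
          exact div_le_self (abs_nonneg v) ha
    have hfin : ‖(g (u / a) : ℂ)‖ ≤ C * D / a + 1 / a := by
      calc ‖(g (u / a) : ℂ)‖ = ‖((g (u / a) : ℂ) - ∫ v, (g ((u + v) / a) : ℂ) * K v) +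
            ∫ v, (g ((u + v) / a) : ℂ) * K v‖ := by rw [sub_add_cancel]
        _ ≤ _ := (norm_add_le _ _).trans (add_le_add (by rw [hdiff]; exact hle) hu.le)
    rw [Complex.norm_real, Real.norm_eq_abs] at hfin
    rw [add_div]; exact hfin
  rw [Metric.tendsto_atTop]
  intro ε hε
  set a : ℝ := max 1 (2 * (C * D + 1) / ε) with ha
  have ha1 : 1 ≤ a := le_max_left _ _
  obtain ⟨N, hN⟩ := eventually_atTop.1 (main a ha1)
  refine ⟨N / a, fun u hu => ?_⟩
  have h1 := hN (u * a) (by rwa [ge_iff_le, div_le_iff₀ (by linarith)] at hu)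
  rw [mul_div_cancel_right₀ _ (by linarith : a ≠ 0)] at h1
  rw [dist_zero_right, Real.norm_eq_abs]
  refine h1.trans_lt ?_
  rw [div_lt_iff₀ (by linarith)]
  have h2 : 2 * (C * D + 1) / ε ≤ a := le_max_right _ _
  rw [div_le_iff₀ hε] at h2
  have : 0 ≤ C * D := by positivity
  nlinarith

end Tauberian

/-! ### A weighted sum of the Möbius function -/

section MobiusSums

open MeasureTheory Set
open scoped ArithmeticFunction.Moebius ArithmeticFunction.zeta Topology

/-- The sum of `μ(n) / n * log (y / n)` over `n ≤ y`. -/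
noncomputable def moebiusLogSum (y : ℝ) : ℝ :=
  ∑ n ∈ Finset.Ioc 0 ⌊y⌋₊, (μ n : ℝ) / n * Real.log (y / n)

lemma abs_moebius_le_one_real (n : ℕ) : |(μ n : ℝ)| ≤ 1 := by
  exact_mod_cast ArithmeticFunction.abs_moebius_le_one (n := n)

/-- The classical bound, from `∑ n ≤ N, μ(n) ⌊N / n⌋ = 1`. -/
lemma abs_sum_moebius_div_le_one (N : ℕ) : |∑ n ∈ Finset.Ioc 0 N, (μ n : ℝ) / n| ≤ 1 := by
  rcases Nat.eq_zero_or_pos N with rfl | hN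
  · simp
  have h1 : ∑ n ∈ Finset.Ioc 0 N, (μ n : ℝ) * ((N / n : ℕ) : ℝ) = 1 := by
    have h := ArithmeticFunction.sum_Ioc_mul_zeta_eq_sum μ N
    rw [ArithmeticFunction.moebius_mul_coe_zeta, Finset.sum_eq_single 1] at h
    · simp only [ArithmeticFunction.one_one] at h
      have h' := congrArg (Int.cast : ℤ → ℝ) h.symm
      push_cast at h'
      exact h'
    · intro b _ hb; simp [hb]
    · intro h; simp at h; omega
  have h2 : N * ∑ n ∈ Finset.Ioc 0 N, (μ n : ℝ) / n - 1 =
      ∑ n ∈ Finset.Ioc 0 N, (μ n : ℝ) * ((N : ℝ) / n - (N / n : ℕ)) := by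
    simp_rw [mul_sub]
    rw [Finset.sum_sub_distrib, h1, Finset.mul_sum]
    congr 1
    exact Finset.sum_congr rfl fun n _ => by ring
  have h3 : |∑ n ∈ Finset.Ioc 0 N, (μ n : ℝ) * ((N : ℝ) / n - (N / n : ℕ))| ≤ N - 1 := by
    refine (Finset.abs_sum_le_sum_abs _ _).trans ?_
    -- the term `n = 1` vanishes
    calc _ ≤ ∑ n ∈ Finset.Ioc 0 N, (if n = 1 then (0 : ℝ) else 1) := by
          refine Finset.sum_le_sum fun n hn => ?_
          have hn0 : 0 < n := (Finset.mem_Ioc.1 hn).1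
          split_ifs with h
          · simp [h]
          · rw [abs_mul]
            have a1 : ((N / n : ℕ) : ℝ) ≤ (N : ℝ) / n := Nat.cast_div_le
            have a2 : (N : ℝ) / n ≤ (N / n : ℕ) + 1 := by
              have := Nat.lt_floor_add_one ((N : ℝ) / n)
              rw [Nat.floor_div_natCast, Nat.floor_natCast] at this
              exact this.le
            have a3 : |(N : ℝ) / n - (N / n : ℕ)| ≤ 1 := by
              rw [abs_le]; constructor <;> linarith
            exact mul_le_one₀ (abs_moebius_le_one_real n) (abs_nonneg _) a3
      _ = N - 1 := by
          have : ∀ n : ℕ, (if n = 1 then (0 : ℝ) else 1) = 1 - if n = 1 then 1 else 0 := by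
            intro n; split_ifs <;> simp
          simp_rw [this]
          rw [Finset.sum_sub_distrib, Finset.sum_ite_eq' , if_pos (by simp; omega)]
          simp
  rw [← h2] at h3
  have hN' : (1 : ℝ) ≤ N := by exact_mod_cast hN
  rw [abs_le] at h3 ⊢
  constructor
  · by_contra! h
    nlinarith
  · by_contra! h
    nlinarith

/-- Summation of the Dirichlet convolution of `μ(n) / n` and `1 / n`, which is supported at `1`. -/
lemma sum_moebius_div_mul_harmonic {N : ℕ} (hN : 0 < N) :
    ∑ n ∈ Finset.Ioc 0 N, (μ n : ℝ) / n * (harmonic (N / n) : ℝ) = 1 := by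
  let f : ArithmeticFunction ℝ := ⟨fun n => (μ n : ℝ) / n, by simp⟩
  let g : ArithmeticFunction ℝ := ⟨fun n => (n : ℝ)⁻¹, by simp⟩
  have hf : ∀ n, f n = (μ n : ℝ) / n := fun _ => rfl
  have hg : ∀ n, g n = (n : ℝ)⁻¹ := fun _ => rfl
  have h := ArithmeticFunction.sum_Ioc_mul_eq_sum_sum f g N
  have hfg : ∀ n ∈ Finset.Ioc 0 N, (f * g) n = if n = 1 then 1 else 0 := by
    intro n hn
    have hn0 : n ≠ 0 := by have := (Finset.mem_Ioc.1 hn).1; omega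
    have h1 : ∑ x ∈ n.divisorsAntidiagonal, (μ x.1 : ℝ) = if n = 1 then 1 else 0 := by
      have h2 : (μ * ζ) n = (1 : ArithmeticFunction ℤ) n := by
        rw [ArithmeticFunction.moebius_mul_coe_zeta]
      rw [ArithmeticFunction.mul_apply, ArithmeticFunction.one_apply] at h2
      have h3 : ∑ x ∈ n.divisorsAntidiagonal, μ x.1 = if n = 1 then 1 else 0 := by
        rw [← h2]
        refine Finset.sum_congr rfl fun x hx => ?_
        have := Nat.mem_divisorsAntidiagonal.1 hx
        have hx2 : x.2 ≠ 0 := by rintro h0; simp [h0] at this; omega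
        simp [ArithmeticFunction.natCoe_apply, hx2]
      have h' := congrArg (Int.cast : ℤ → ℝ) h3
      push_cast at h'
      exact h'
    rw [ArithmeticFunction.mul_apply]
    calc _ = ∑ x ∈ n.divisorsAntidiagonal, (n : ℝ)⁻¹ * (μ x.1 : ℝ) := by
          refine Finset.sum_congr rfl fun x hx => ?_
          rw [hf, hg, ← (Nat.mem_divisorsAntidiagonal.1 hx).1]
          push_cast
          rw [mul_inv]; ring
      _ = if n = 1 then 1 else 0 := by
          rw [← Finset.mul_sum, h1]
          split_ifs with h0 <;> simp [h0]
  rw [Finset.sum_congr rfl hfg, Finset.sum_ite_eq', if_pos (by simp; omega)] at h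
  rw [h]
  refine Finset.sum_congr rfl fun n _ => ?_
  rw [hf, harmonic_eq_sum_Icc]
  push_cast
  rfl

lemma abs_harmonic_sub_log_sub_euler_le {x : ℝ} (hx : 1 ≤ x) :
    |(harmonic ⌊x⌋₊ : ℝ) - Real.eulerMascheroniConstant - Real.log x| ≤ 2 / x := by
  set k := ⌊x⌋₊ with hk
  have hk1 : 1 ≤ k := Nat.one_le_floor_iff _ |>.2 hx
  have hk1' : (1 : ℝ) ≤ k := by exact_mod_cast hk1
  have h1 : (k : ℝ) ≤ x := Nat.floor_le (by linarith)
  have h2 : x < k + 1 := Nat.lt_floor_add_one x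
  have h3 := Real.eulerMascheroniConstant_lt_eulerMascheroniSeq' k
  have h4 := Real.eulerMascheroniSeq_lt_eulerMascheroniConstant k
  rw [Real.eulerMascheroniSeq', if_neg (by omega)] at h3
  rw [Real.eulerMascheroniSeq] at h4
  have h5 : Real.log k ≤ Real.log x := Real.log_le_log (by linarith) h1
  have h6 : Real.log x ≤ Real.log (k + 1) := Real.log_le_log (by linarith) h2.le
  have h7 : Real.log (k + 1) - Real.log k ≤ 1 / k := by
    rw [← Real.log_div (by positivity) (by positivity)]
    refine (Real.log_le_sub_one_of_pos (by positivity)).trans (le_of_eq ?_)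
    field_simp; ring
  have h8 : 1 / (k : ℝ) ≤ 2 / x := by
    rw [div_le_div_iff₀ (by positivity) (by positivity)]; linarith
  rw [abs_le]; constructor <;> linarith

/-- Chebyshev-type bound: the logarithm is replaced by a harmonic number minus Euler's constant, for
which the sum can be evaluated. -/
lemma abs_moebiusLogSum_le {y : ℝ} (hy : 1 ≤ y) : |moebiusLogSum y| ≤ 4 := by
  set N := ⌊y⌋₊ with hN
  have hN0 : 0 < N := Nat.one_le_floor_iff _ |>.2 hy
  have h1 := sum_moebius_div_mul_harmonic hN0
  have h2 := abs_sum_moebius_div_le_one N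
  have h3 : |∑ n ∈ Finset.Ioc 0 N, (μ n : ℝ) / n *
      ((harmonic (N / n) : ℝ) - Real.eulerMascheroniConstant - Real.log (y / n))| ≤ 2 := by
    refine (Finset.abs_sum_le_sum_abs _ _).trans ?_
    calc _ ≤ ∑ n ∈ Finset.Ioc 0 N, 2 / y := by
          refine Finset.sum_le_sum fun n hn => ?_
          rw [Finset.mem_Ioc] at hn
          have hn0 : (0 : ℝ) < n := by exact_mod_cast hn.1
          have hny : (n : ℝ) ≤ y := (Nat.le_floor_iff (by linarith)).1 hn.2
          have := abs_harmonic_sub_log_sub_euler_le (x := y / n) (by rwa [one_le_div hn0])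
          rw [Nat.floor_div_natCast] at this
          rw [abs_mul, abs_div, Nat.abs_cast]
          calc _ ≤ 1 / n * (2 / (y / n)) := by
                gcongr
                exact abs_moebius_le_one_real n
            _ = 2 / y := by field_simp
      _ = N * (2 / y) := by simp
      _ ≤ y * (2 / y) := by
          gcongr
          exact Nat.floor_le (by linarith)
      _ = 2 := by field_simp
  have h4 : moebiusLogSum y = 1 - Real.eulerMascheroniConstant * ∑ n ∈ Finset.Ioc 0 N, (μ n : ℝ) / n
      - ∑ n ∈ Finset.Ioc 0 N, (μ n : ℝ) / n *
      ((harmonic (N / n) : ℝ) - Real.eulerMascheroniConstant - Real.log (y / n)) := by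
    rw [← h1, Finset.mul_sum, ← Finset.sum_sub_distrib, ← Finset.sum_sub_distrib, moebiusLogSum]
    exact Finset.sum_congr rfl fun n _ => by ring
  have g1 := Real.one_half_lt_eulerMascheroniConstant
  have g2 := Real.eulerMascheroniConstant_lt_two_thirds
  rw [h4]
  rw [abs_le] at *
  constructor <;> nlinarith

/-- Slow oscillation of `moebiusLogSum` on the logarithmic scale, required by the Tauberian
theorem. -/
lemma moebiusLogSum_exp_sub_le {a b : ℝ} (ha : 0 ≤ a) (hab : a ≤ b) :
    |moebiusLogSum (Real.exp b) - moebiusLogSum (Real.exp a)| ≤ (b - a) * (2 + (b - a)) := by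
  set A := ⌊Real.exp a⌋₊ with hA
  set M := ⌊Real.exp b⌋₊ with hM
  have hA1 : 1 ≤ A := Nat.one_le_floor_iff _ |>.2 (Real.one_le_exp ha)
  have hAM : A ≤ M := Nat.floor_le_floor (Real.exp_le_exp.2 hab)
  have hA1' : (1 : ℝ) ≤ A := by exact_mod_cast hA1
  have hAM' : (A : ℝ) ≤ M := by exact_mod_cast hAM
  have e1 : ∀ c : ℝ, ∀ n ∈ Finset.Ioc 0 ⌊Real.exp c⌋₊, (μ n : ℝ) / n * Real.log (Real.exp c / n) =
      (μ n : ℝ) / n * (c - Real.log n) := by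
    intro c n hn
    rw [Finset.mem_Ioc] at hn
    rw [Real.log_div (Real.exp_ne_zero _) (by have := hn.1; positivity), Real.log_exp]
  have e2 : moebiusLogSum (Real.exp b) - moebiusLogSum (Real.exp a) =
      (b - a) * ∑ n ∈ Finset.Ioc 0 A, (μ n : ℝ) / n +
      ∑ n ∈ Finset.Ioc A M, (μ n : ℝ) / n * (b - Real.log n) := by
    rw [moebiusLogSum, moebiusLogSum, Finset.sum_congr rfl (e1 b), Finset.sum_congr rfl (e1 a),
      ← hA, ← hM, ← Finset.sum_Ioc_consecutive _ (Nat.zero_le A) hAM, Finset.mul_sum,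
      add_sub_right_comm, ← Finset.sum_sub_distrib]
    congr 1
    exact Finset.sum_congr rfl fun n _ => by ring
  have e3 : |∑ n ∈ Finset.Ioc A M, (μ n : ℝ) / n * (b - Real.log n)| ≤
      (b - a) * ∑ n ∈ Finset.Ioc A M, (n : ℝ)⁻¹ := by
    refine (Finset.abs_sum_le_sum_abs _ _).trans ?_
    rw [Finset.mul_sum]
    refine Finset.sum_le_sum fun n hn => ?_
    rw [Finset.mem_Ioc] at hn
    have hn0 : (0 : ℝ) < n := by exact_mod_cast (by omega : 0 < n)
    have l1 : Real.log n ≤ b := by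
      rw [Real.log_le_iff_le_exp hn0]
      exact (Nat.le_floor_iff (Real.exp_pos _).le).1 hn.2
    have l2 : a ≤ Real.log n := by
      rw [Real.le_log_iff_exp_le hn0]
      exact ((Nat.floor_lt (Real.exp_pos _).le).1 hn.1).le
    rw [abs_mul, abs_div, Nat.abs_cast, abs_of_nonneg (by linarith : 0 ≤ b - Real.log n), mul_comm]
    have := abs_moebius_le_one_real n
    rw [div_eq_mul_inv]
    refine mul_le_mul (by linarith) ?_ (by positivity) (by linarith)
    exact mul_le_of_le_one_left (by positivity) this
  have e4 : ∑ n ∈ Finset.Ioc A M, (n : ℝ)⁻¹ ≤ (b - a) + 1 := by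
    have h1 : ∀ k : ℕ, (harmonic k : ℝ) = ∑ n ∈ Finset.Ioc 0 k, (n : ℝ)⁻¹ := fun k => by
      rw [harmonic_eq_sum_Icc]; push_cast; rfl
    have h2 : ∑ n ∈ Finset.Ioc A M, (n : ℝ)⁻¹ = harmonic M - harmonic A := by
      rw [h1, h1, ← Finset.sum_Ioc_consecutive _ (Nat.zero_le A) hAM]; ring
    have h3 := Real.strictAnti_eulerMascheroniSeq'.antitone hAM
    rw [Real.eulerMascheroniSeq', Real.eulerMascheroniSeq', if_neg (by omega),
      if_neg (by omega)] at h3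
    have h4 : Real.log M ≤ b := by
      rw [Real.log_le_iff_le_exp (by linarith)]
      exact Nat.floor_le (Real.exp_pos _).le
    have h5 : a ≤ Real.log A + 1 := by
      have h6 : Real.exp a ≤ A + 1 := (Nat.lt_floor_add_one _).le
      have h7 : a ≤ Real.log (A + 1) := (Real.le_log_iff_exp_le (by linarith)).2 h6
      have h8 : Real.log (A + 1) ≤ Real.log A + 1 := by
        rw [← sub_le_iff_le_add', ← Real.log_div (by positivity) (by positivity)]
        refine (Real.log_le_sub_one_of_pos (by positivity)).trans ?_
        rw [sub_le_iff_le_add, div_le_iff₀ (by positivity)]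
        linarith
      linarith
    linarith
  have e5 := abs_sum_moebius_div_le_one A
  have hba : 0 ≤ b - a := by linarith
  rw [e2]
  calc _ ≤ |(b - a) * ∑ n ∈ Finset.Ioc 0 A, (μ n : ℝ) / n| +
        |∑ n ∈ Finset.Ioc A M, (μ n : ℝ) / n * (b - Real.log n)| := abs_add_le _ _
    _ ≤ (b - a) * 1 + (b - a) * ((b - a) + 1) := by
        rw [abs_mul, abs_of_nonneg hba]
        refine add_le_add (by gcongr) (e3.trans (by gcongr))
    _ = _ := by ring

lemma measurable_moebiusLogSum : Measurable moebiusLogSum := by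
  have h : Measurable fun z : ℕ × ℝ =>
      ∑ n ∈ Finset.Ioc 0 z.1, (μ n : ℝ) / n * Real.log (z.2 / n) :=
    measurable_from_prod_countable_right fun k => by
      simp only
      fun_prop
  exact h.comp (Nat.measurable_floor.prodMk measurable_id)

/-- The summand of `moebiusLogSum (exp v)`, extended by zero to `v < log n`. -/
noncomputable def moebiusLogTerm (n : ℕ) (v : ℝ) : ℝ := (μ n : ℝ) / n * max (v - Real.log n) 0

lemma hasSum_moebiusLogTerm (v : ℝ) :
    HasSum (fun n => moebiusLogTerm n v) (moebiusLogSum (Real.exp v)) := by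
  have h : moebiusLogSum (Real.exp v) =
      ∑ n ∈ Finset.Ioc 0 ⌊Real.exp v⌋₊, moebiusLogTerm n v := by
    refine Finset.sum_congr rfl fun n hn => ?_
    rw [Finset.mem_Ioc] at hn
    have hn0 : (0 : ℝ) < n := by exact_mod_cast hn.1
    have : Real.log n ≤ v := by
      rw [Real.log_le_iff_le_exp hn0]
      exact (Nat.le_floor_iff (Real.exp_pos _).le).1 hn.2
    rw [moebiusLogTerm, Real.log_div (Real.exp_ne_zero _) hn0.ne', Real.log_exp,
      max_eq_left (by linarith)]
  rw [h]
  refine hasSum_sum_of_ne_finset_zero fun n hn => ?_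
  rcases Nat.eq_zero_or_pos n with rfl | hn0
  · simp [moebiusLogTerm]
  · rw [Finset.mem_Ioc, not_and_or, not_le] at hn
    have h1 : v < Real.log n := by
      rw [Real.lt_log_iff_exp_lt (by exact_mod_cast hn0)]
      exact (Nat.floor_lt (Real.exp_pos _).le).1 (hn.resolve_left (by omega))
    rw [moebiusLogTerm, max_eq_right (by linarith), mul_zero]

lemma integrableOn_max_sub_mul_exp (a : ℝ) {s : ℂ} (hs : 0 < s.re) :
    IntegrableOn (fun v : ℝ => ((max (v - a) 0 : ℝ) : ℂ) * Complex.exp (-(s * v))) (Ioi 0) := by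
  have h1 : IntegrableOn (fun v : ℝ => (v + |a|) * Real.exp (-(s.re * v))) (Ioi 0) := by
    have h2 := integrableOn_rpow_mul_exp_neg_mul_rpow (p := 1) (s := 1) (b := s.re)
      (by norm_num) (by norm_num) hs
    have h3 := (integrableOn_exp_mul_Ioi (a := -s.re) (by linarith) 0).const_mul |a|
    refine (h2.add h3).congr (Eventually.of_forall fun v => ?_)
    simp only [Pi.add_apply, Real.rpow_one, neg_mul]
    ring
  refine h1.mono' (by fun_prop) ?_
  refine (ae_restrict_iff' measurableSet_Ioi).2 (Eventually.of_forall fun v hv => ?_)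
  have hv0 : (0 : ℝ) < v := hv
  rw [norm_mul, Complex.norm_real, Complex.norm_exp, Real.norm_of_nonneg (le_max_right _ _)]
  simp only [Complex.neg_re, Complex.mul_re, Complex.ofReal_re, Complex.ofReal_im, mul_zero,
    sub_zero]
  gcongr
  refine max_le ?_ (by positivity)
  have := neg_abs_le a
  linarith

lemma integral_max_sub_mul_exp {a : ℝ} (ha : 0 ≤ a) {s : ℂ} (hs : 0 < s.re) :
    ∫ v in Ioi (0 : ℝ), ((max (v - a) 0 : ℝ) : ℂ) * Complex.exp (-(s * v)) =
      Complex.exp (-(s * a)) / s ^ 2 := by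
  have hs0 : s ≠ 0 := by rintro rfl; simp at hs
  have h1 : ∫ v in Ioi (0 : ℝ), ((max (v - a) 0 : ℝ) : ℂ) * Complex.exp (-(s * v)) =
      ∫ v in Ioi a, ((v - a : ℝ) : ℂ) * Complex.exp (-(s * v)) := by
    have h2 : ∫ v in Ioi (0 : ℝ), ((max (v - a) 0 : ℝ) : ℂ) * Complex.exp (-(s * v)) =
        ∫ v in Ioi a, ((max (v - a) 0 : ℝ) : ℂ) * Complex.exp (-(s * v)) := by
      refine setIntegral_eq_of_subset_of_forall_sdiff_eq_zero measurableSet_Ioi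
        (Ioi_subset_Ioi ha) fun v hv => ?_
      have : v ≤ a := by simpa using hv.2
      rw [max_eq_right (by linarith)]; simp
    rw [h2]
    refine setIntegral_congr_fun measurableSet_Ioi fun v hv => ?_
    have : a < v := hv
    rw [max_eq_left (by linarith)]
  have hint : IntegrableOn (fun v : ℝ => ((v - a : ℝ) : ℂ) * Complex.exp (-(s * v))) (Ioi a) := by
    refine ((integrableOn_max_sub_mul_exp a hs).mono_set (Ioi_subset_Ioi ha)).congr_fun
      (fun v hv => ?_) measurableSet_Ioi
    have : a < v := hv
    simp only
    rw [max_eq_left (by linarith)]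
  rw [h1, integral_Ioi_of_hasDerivAt_of_tendsto' (m := 0)
    (f := fun v : ℝ => -((((v : ℂ) - a) / s + 1 / s ^ 2) * Complex.exp (-(s * v)))) ?_ hint ?_]
  · simp; ring
  · intro v _
    have d1 : HasDerivAt (fun v : ℝ => (v : ℂ)) 1 v := Complex.ofRealCLM.hasDerivAt
    have d2 := ((d1.sub_const (a : ℂ)).div_const s).add_const (1 / s ^ 2)
    have d3 : HasDerivAt (fun v : ℝ => Complex.exp (-(s * v)))
        (Complex.exp (-(s * v)) * (-(s * 1))) v := ((d1.const_mul s).neg).cexp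
    refine (d2.mul d3).neg.congr_deriv ?_
    push_cast
    field_simp
    ring
  · rw [tendsto_zero_iff_norm_tendsto_zero]
    have t1 : Tendsto (fun v : ℝ => v * Real.exp (-(s.re * v))) atTop (𝓝 0) := by
      have := (Real.tendsto_pow_mul_exp_neg_atTop_nhds_zero 1).comp
        (tendsto_id.const_mul_atTop hs)
      have h2 := this.const_mul (s.re)⁻¹
      rw [mul_zero] at h2
      refine h2.congr fun v => ?_
      simp only [Function.comp, id, pow_one]
      field_simp
    have t2 : Tendsto (fun v : ℝ => Real.exp (-(s.re * v))) atTop (𝓝 0) :=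
      Real.tendsto_exp_neg_atTop_nhds_zero.comp (tendsto_id.const_mul_atTop hs)
    have t3 := (t1.const_mul ‖s‖⁻¹).add (t2.const_mul (‖(a : ℂ)‖ * ‖s‖⁻¹ + ‖1 / s ^ 2‖))
    simp only [mul_zero, add_zero] at t3
    refine squeeze_zero' (Eventually.of_forall fun v => norm_nonneg _) ?_ t3
    filter_upwards [eventually_ge_atTop 0] with v hv
    rw [norm_neg, norm_mul, Complex.norm_exp]
    simp only [Complex.neg_re, Complex.mul_re, Complex.ofReal_re, Complex.ofReal_im, mul_zero,
      sub_zero]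
    calc _ ≤ ((‖(v : ℂ)‖ + ‖(a : ℂ)‖) * ‖s‖⁻¹ + ‖1 / s ^ 2‖) * Real.exp (-(s.re * v)) := by
          gcongr
          refine (norm_add_le _ _).trans ?_
          gcongr
          rw [norm_div, div_eq_mul_inv]
          gcongr
          exact norm_sub_le _ _
      _ = _ := by
          rw [Complex.norm_real, Real.norm_of_nonneg hv]; ring

lemma exp_neg_mul_log_div {n : ℕ} (hn : n ≠ 0) (s : ℂ) :
    (1 / n : ℂ) * Complex.exp (-(s * Real.log n)) = 1 / (n : ℂ) ^ (1 + s) := by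
  have hn' : (n : ℂ) ≠ 0 := by exact_mod_cast hn
  rw [Complex.cpow_add _ _ hn', Complex.cpow_one, Complex.cpow_def_of_ne_zero hn',
    ← Complex.natCast_log, Complex.exp_neg, mul_comm s]
  field_simp

/-- The Laplace transform of `moebiusLogSum ∘ exp`. It has a simple pole at `s = 0` with residue `1`
and no other singularity on the line `Re s = 0`. -/
lemma integral_moebiusLogSum_exp {s : ℂ} (hs : 0 < s.re) :
    ∫ v in Ioi (0 : ℝ), (moebiusLogSum (Real.exp v) : ℂ) * Complex.exp (-(s * v)) =
      1 / (s ^ 2 * riemannZeta (1 + s)) := by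
  have hs0 : s ≠ 0 := by rintro rfl; simp at hs
  set F : ℕ → ℝ → ℂ := fun n v => (moebiusLogTerm n v : ℂ) * Complex.exp (-(s * v)) with hF
  have hFe : ∀ n v, F n v = ((μ n : ℂ) / n) *
      (((max (v - Real.log n) 0 : ℝ) : ℂ) * Complex.exp (-(s * v))) := fun n v => by
    rw [hF]; simp only [moebiusLogTerm]; push_cast; ring
  have hFi : ∀ n, IntegrableOn (F n) (Ioi 0) := fun n => by
    refine ((integrableOn_max_sub_mul_exp (Real.log n) hs).const_mul ((μ n : ℂ) / n)).congr
      (Eventually.of_forall fun v => ?_)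
    rw [hFe]
  have hFint : ∀ n, ∫ v in Ioi (0 : ℝ), F n v =
      LSeries.term (fun n => (μ n : ℂ)) (1 + s) n * (1 / s ^ 2) := fun n => by
    rcases Nat.eq_zero_or_pos n with rfl | hn
    · simp [hFe]
    simp_rw [hFe]
    rw [integral_const_mul, integral_max_sub_mul_exp (Real.log_natCast_nonneg n) hs,
      LSeries.term_of_ne_zero hn.ne']
    calc _ = (μ n : ℂ) * ((1 / n : ℂ) * Complex.exp (-(s * Real.log n))) / s ^ 2 := by ring
      _ = _ := by rw [exp_neg_mul_log_div hn.ne']; ring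
  have hsum : Summable fun n => ∫ v in Ioi (0 : ℝ), ‖F n v‖ := by
    have h1 : ∀ n, ∫ v in Ioi (0 : ℝ), ‖F n v‖ =
        |(μ n : ℝ)| * (1 / (n : ℝ) ^ (1 + s.re)) * (1 / s.re ^ 2) := fun n => by
      rcases Nat.eq_zero_or_pos n with rfl | hn
      · simp [hFe]
      have h2 : ∀ v : ℝ, ((‖F n v‖ : ℝ) : ℂ) = ((|(μ n : ℝ)| / n : ℝ) : ℂ) *
          (((max (v - Real.log n) 0 : ℝ) : ℂ) * Complex.exp (-((s.re : ℂ) * v))) := fun v => by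
        rw [hFe, norm_mul, norm_mul, Complex.norm_real, Complex.norm_exp,
          Real.norm_of_nonneg (le_max_right _ _), norm_div, Complex.norm_intCast,
          Complex.norm_natCast]
        simp
      apply Complex.ofReal_injective
      rw [← integral_complex_ofReal]
      simp_rw [h2]
      rw [integral_const_mul, integral_max_sub_mul_exp (Real.log_natCast_nonneg n) (by simpa)]
      have h3 := exp_neg_mul_log_div hn.ne' (s.re : ℂ)
      calc _ = ((|(μ n : ℝ)| : ℝ) : ℂ) * ((1 / n : ℂ) * Complex.exp (-((s.re : ℂ) * Real.log n))) /
            (s.re : ℂ) ^ 2 := by push_cast; ring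
        _ = _ := by
          rw [h3]
          push_cast
          rw [Complex.ofReal_cpow (Nat.cast_nonneg n)]
          push_cast
          ring
    simp_rw [h1]
    refine Summable.mul_right _ ?_
    refine Summable.of_nonneg_of_le (fun n => by positivity) (fun n => ?_)
      (Real.summable_one_div_nat_rpow.2 (by linarith : 1 < 1 + s.re))
    exact mul_le_of_le_one_left (by positivity) (abs_moebius_le_one_real n)
  have h := hasSum_integral_of_summable_integral_norm hFi hsum
  have hts : ∀ v, ∑' n, F n v = (moebiusLogSum (Real.exp v) : ℂ) * Complex.exp (-(s * v)) :=
    fun v => ((Complex.hasSum_ofReal.2 (hasSum_moebiusLogTerm v)).mul_right _).tsum_eq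
  simp_rw [hts, hFint] at h
  have hre : 1 < (1 + s).re := by simp [hs]
  have hL := LSeries_one_mul_Lseries_moebius hre
  rw [LSeries_one_eq_riemannZeta hre] at hL
  have hz : riemannZeta (1 + s) ≠ 0 := riemannZeta_ne_zero_of_one_lt_re hre
  have h2 := (ArithmeticFunction.LSeriesSummable_moebius_iff.2 hre).hasSum.mul_right (1 / s ^ 2)
  rw [h.unique h2]
  change LSeries _ _ * _ = _
  rw [eq_div_iff (mul_ne_zero (pow_ne_zero 2 hs0) hz)]
  field_simp
  rw [mul_comm, hL]

/-- A form of the prime number theorem. It rests on the absence of zeros of the zeta function on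
the line `Re s = 1`. -/
theorem tendsto_moebiusLogSum : Tendsto moebiusLogSum atTop (𝓝 1) := by
  set f : ℂ → ℂ := fun s => 1 / riemannZeta₁ (1 + s) with hf
  have hne : ∀ s : ℂ, 0 ≤ s.re → riemannZeta₁ (1 + s) ≠ 0 := by
    intro s hs h0
    rcases eq_or_ne s 0 with rfl | hs0
    · simp at h0
    · refine riemannZeta_ne_zero_of_one_le_re (s := 1 + s) (by simpa using hs) ?_
      rw [riemannZeta_eq_inv_sub_mul (by simpa using hs0), h0, mul_zero]
  have hκ : ContinuousOn (dslope f 0) {s : ℂ | 0 ≤ s.re} := by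
    have hopen : IsOpen {s : ℂ | riemannZeta₁ (1 + s) ≠ 0} :=
      isOpen_ne.preimage (differentiable_riemannZeta₁.continuous.comp (by fun_prop))
    have hd : DifferentiableOn ℂ f {s : ℂ | riemannZeta₁ (1 + s) ≠ 0} := by
      intro s hs
      refine DifferentiableAt.differentiableWithinAt ?_
      exact (differentiableAt_const _).div
        (differentiable_riemannZeta₁.differentiableAt.comp s (by fun_prop)) hs
    have h0 : {s : ℂ | riemannZeta₁ (1 + s) ≠ 0} ∈ 𝓝 (0 : ℂ) :=
      hopen.mem_nhds (hne 0 (by simp))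
    exact ((continuousOn_dslope h0).2 ⟨hd.continuousOn, hd.differentiableAt h0⟩).mono hne
  set g : ℝ → ℝ := fun v => if v < 0 then 0 else moebiusLogSum (Real.exp v) - 1 with hg
  have hg0 : ∀ v, 0 ≤ v → g v = moebiusLogSum (Real.exp v) - 1 := fun v hv => by
    rw [hg]; simp [not_lt.2 hv]
  have hneg : ∀ v < 0, g v = 0 := fun v hv => by rw [hg]; simp [hv]
  have hB : ∀ v, |g v| ≤ 5 := by
    intro v
    rcases lt_or_ge v 0 with hv | hv
    · rw [hneg v hv]; norm_num
    · rw [hg0 v hv]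
      have := abs_moebiusLogSum_le (Real.one_le_exp hv)
      rw [abs_le] at *
      constructor <;> linarith
  have hmeas : Measurable g := by
    refine Measurable.ite measurableSet_Iio measurable_const ?_
    exact (measurable_moebiusLogSum.comp Real.measurable_exp).sub_const 1
  have hosc : ∀ u v, 1 ≤ u → |g u - g (u + v)| ≤ 10 * (|v| * (1 + |v|)) := by
    intro u v hu
    rcases lt_or_ge (u + v) 0 with huv | huv
    · rw [hneg _ huv, sub_zero]
      have hv : 1 ≤ |v| := by rw [abs_of_neg (by linarith)]; linarith
      have := hB u
      nlinarith
    · rw [hg0 u (by linarith), hg0 _ huv, sub_sub_sub_cancel_right]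
      rcases le_total v 0 with hv | hv
      · have := moebiusLogSum_exp_sub_le huv (by linarith : u + v ≤ u)
        rw [abs_of_nonpos hv]
        nlinarith
      · have := moebiusLogSum_exp_sub_le (by linarith : 0 ≤ u) (by linarith : u ≤ u + v)
        rw [abs_sub_comm, abs_of_nonneg hv]
        nlinarith
  have hL : ∀ s : ℂ, 0 < s.re →
      ∫ v in Ioi (0 : ℝ), (g v : ℂ) * Complex.exp (-(s * v)) = dslope f 0 s := by
    intro s hs
    have hs0 : s ≠ 0 := by rintro rfl; simp at hs
    have h1 : ∫ v in Ioi (0 : ℝ), (g v : ℂ) * Complex.exp (-(s * v)) =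
        ∫ v in Ioi (0 : ℝ), ((moebiusLogSum (Real.exp v) : ℂ) * Complex.exp (-(s * v)) -
          Complex.exp (-s * v)) := by
      refine setIntegral_congr_fun measurableSet_Ioi fun v hv => ?_
      rw [hg0 v (le_of_lt hv)]
      push_cast; ring_nf
    have hi2 : IntegrableOn (fun v : ℝ => Complex.exp (-s * v)) (Ioi 0) :=
      integrableOn_exp_mul_complex_Ioi (by simpa using hs) 0
    have hi1 : IntegrableOn (fun v : ℝ => (moebiusLogSum (Real.exp v) : ℂ) *
        Complex.exp (-(s * v))) (Ioi 0) := by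
      simp_rw [← neg_mul]
      refine hi2.bdd_mul (c := 4) ?_ ?_
      · exact (Complex.measurable_ofReal.comp
          (measurable_moebiusLogSum.comp Real.measurable_exp)).aestronglyMeasurable
      · refine (ae_restrict_iff' measurableSet_Ioi).2 (Eventually.of_forall fun v hv => ?_)
        rw [Complex.norm_real]
        exact abs_moebiusLogSum_le (Real.one_le_exp (le_of_lt hv))
    rw [h1, integral_sub hi1 hi2, integral_moebiusLogSum_exp hs,
      integral_exp_mul_complex_Ioi (by simpa using hs), dslope_of_ne _ hs0, slope_def_field, hf]
    have hz := hne s hs.le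
    rw [riemannZeta_eq_inv_sub_mul (by simpa using hs0)]
    simp only [add_sub_cancel_left, add_zero, riemannZeta₁_one, Complex.ofReal_zero, mul_zero,
      Complex.exp_zero, sub_zero]
    field_simp
  have h := tendsto_zero_of_laplace_continuous hmeas hB hneg hosc hκ hL
  have h2 := (h.comp Real.tendsto_log_atTop).add_const 1
  rw [zero_add] at h2
  refine h2.congr' ?_
  filter_upwards [eventually_ge_atTop 1] with y hy
  simp only [Function.comp]
  rw [hg0 _ (Real.log_nonneg hy), Real.exp_log (by linarith)]
  ring

end MobiusSums

/-! ### Dilation operators and mean squares over random sets of primes -/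

section Dilations

/-- The operator `∏ p ∈ P, (1 + c p * T p)` applied to `f`, where `T p` is the dilation
`f ↦ f (· / p)`. -/
noncomputable def dilSum (c : ℕ → ℝ) (P : Finset ℕ) (f : ℝ → ℝ) (x : ℝ) : ℝ :=
  ∑ U ∈ P.powerset, (∏ p ∈ U, c p) * f (x / ∏ p ∈ U, (p : ℝ))

variable {c : ℕ → ℝ} {P : Finset ℕ} {f : ℝ → ℝ} {x : ℝ} {p : ℕ}

@[simp] lemma dilSum_empty : dilSum c ∅ f x = f x := by simp [dilSum]

lemma dilSum_insert (hp : p ∉ P) :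
    dilSum c (insert p P) f x = dilSum c P f x + c p * dilSum c P f (x / p) := by
  rw [dilSum, Finset.sum_powerset_insert hp, dilSum, dilSum, Finset.mul_sum]
  congr 1
  refine Finset.sum_congr rfl fun U hU => ?_
  have hpU : p ∉ U := fun h => hp (Finset.mem_powerset.1 hU h)
  rw [Finset.prod_insert hpU, Finset.prod_insert hpU, div_div, mul_assoc]

lemma dilSum_add_mul_dilation (a : ℝ) (q : ℝ) :
    dilSum c P (fun y => f y + a * f (y / q)) x =
      dilSum c P f x + a * dilSum c P f (x / q) := by
  rw [dilSum, dilSum, dilSum, Finset.mul_sum, ← Finset.sum_add_distrib]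
  refine Finset.sum_congr rfl fun U _ => ?_
  rw [div_right_comm]; ring

lemma one_le_prod_of_pos {U : Finset ℕ} (hU : ∀ p ∈ U, 0 < p) : (1 : ℝ) ≤ ∏ p ∈ U, (p : ℝ) := by
  rw [← Nat.cast_prod]
  exact_mod_cast Nat.one_le_iff_ne_zero.2 (Finset.prod_pos hU).ne'

lemma le_prod_of_mem {U : Finset ℕ} (hU : ∀ p ∈ U, 0 < p) (hp : p ∈ U) :
    (p : ℝ) ≤ ∏ p ∈ U, (p : ℝ) := by
  have := Nat.le_of_dvd (Finset.prod_pos hU) (Finset.dvd_prod_of_mem (fun p => p) hp)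
  rw [← Nat.cast_prod]
  exact_mod_cast this

/-- Primes exceeding `x` may be dropped if `f` is supported on `[1, ∞)`. -/
lemma dilSum_eq_of_subset (hf : ∀ y < 1, f y = 0) {P' : Finset ℕ} (hPP : P' ⊆ P)
    (hP : ∀ p ∈ P, 0 < p) (hx : ∀ p ∈ P, p ∉ P' → x < p) :
    dilSum c P f x = dilSum c P' f x := by
  symm
  refine Finset.sum_subset (Finset.powerset_mono.2 hPP) fun U hU hU' => ?_
  rw [Finset.mem_powerset] at hU hU'
  obtain ⟨p, hpU, hpP'⟩ := Finset.not_subset.1 hU'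
  have hpos : ∀ q ∈ U, 0 < q := fun q hq => hP q (hU hq)
  have h1 := le_prod_of_mem hpos hpU
  have h2 := hx p (hU hpU) hpP'
  rw [hf, mul_zero]
  rw [div_lt_one (lt_of_lt_of_le one_pos (one_le_prod_of_pos hpos))]
  linarith

lemma dilSum_eq_zero (hf : ∀ y < 1, f y = 0) (hP : ∀ p ∈ P, 0 < p) (hx : x < 1) :
    dilSum c P f x = 0 := by
  rw [dilSum_eq_of_subset hf (Finset.empty_subset P) hP fun p hp _ => ?_, dilSum_empty, hf x hx]
  exact lt_of_lt_of_le hx (by exact_mod_cast hP p hp)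

lemma dilSum_nonneg (hc : ∀ p ∈ P, 0 ≤ c p) (hf : ∀ y, 0 ≤ f y) : 0 ≤ dilSum c P f x :=
  Finset.sum_nonneg fun _ hU => mul_nonneg
    (Finset.prod_nonneg fun p hp => hc p (Finset.mem_powerset.1 hU hp)) (hf _)

/-- The operator `∏ p ∈ D, (1 - T p)`. For `f = log` cut off at `1` this gives the truncated divisor
sum of an integer whose set of relevant prime factors is `D`. -/
noncomputable def diffOp (D : Finset ℕ) (f : ℝ → ℝ) (x : ℝ) : ℝ := dilSum (fun _ => -1) D f x

lemma diffOp_insert (hp : p ∉ P) :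
    diffOp (insert p P) f x = diffOp P f x - diffOp P f (x / p) := by
  rw [diffOp, dilSum_insert hp, diffOp, diffOp]; ring

/-- The weight of `D ⊆ P` when each `p ∈ P` independently contributes `α p` if it lies in `D` and
`β p` otherwise. -/
noncomputable def subsetWeight (α β : ℕ → ℝ) (P D : Finset ℕ) : ℝ :=
  ∏ p ∈ P, if p ∈ D then α p else β p

/-- The weighted mean square of `diffOp D f x` over the subsets `D` of `P`. -/
noncomputable def diffEnergy (α β : ℕ → ℝ) (P : Finset ℕ) (f : ℝ → ℝ) (x : ℝ) : ℝ :=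
  ∑ D ∈ P.powerset, subsetWeight α β P D * diffOp D f x ^ 2

/-- The mean square when every `p ∈ P` lies in the random set `D` with probability `1 / p`. -/
noncomputable def sieveEnergy (P : Finset ℕ) (f : ℝ → ℝ) (x : ℝ) : ℝ :=
  diffEnergy (fun p => 1 / p) (fun p => 1 - 1 / p) P f x

variable {α β : ℕ → ℝ}

lemma subsetWeight_nonneg (hα : ∀ p ∈ P, 0 ≤ α p) (hβ : ∀ p ∈ P, 0 ≤ β p) (D : Finset ℕ) :
    0 ≤ subsetWeight α β P D :=
  Finset.prod_nonneg fun p hp => by split_ifs <;> [exact hα p hp; exact hβ p hp]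

lemma subsetWeight_congr {α' β' : ℕ → ℝ} (hα : ∀ p ∈ P, α p = α' p) (hβ : ∀ p ∈ P, β p = β' p)
    (D : Finset ℕ) : subsetWeight α β P D = subsetWeight α' β' P D :=
  Finset.prod_congr rfl fun p hp => by rw [hα p hp, hβ p hp]

lemma diffEnergy_insert (hp : p ∉ P) :
    diffEnergy α β (insert p P) f x = ∑ D ∈ P.powerset, subsetWeight α β P D *
      (β p * diffOp D f x ^ 2 + α p * (diffOp D f x - diffOp D f (x / p)) ^ 2) := by
  rw [diffEnergy, Finset.sum_powerset_insert hp, ← Finset.sum_add_distrib]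
  refine Finset.sum_congr rfl fun D hD => ?_
  have hpD : p ∉ D := fun h => hp (Finset.mem_powerset.1 hD h)
  have h1 : subsetWeight α β (insert p P) D = β p * subsetWeight α β P D := by
    rw [subsetWeight, Finset.prod_insert hp, if_neg hpD, subsetWeight]
  have h2 : subsetWeight α β (insert p P) (insert p D) = α p * subsetWeight α β P D := by
    rw [subsetWeight, Finset.prod_insert hp, if_pos (Finset.mem_insert_self p D), subsetWeight]
    congr 1
    refine Finset.prod_congr rfl fun q hq => ?_
    have hqp : q ≠ p := fun h => hp (h ▸ hq)
    simp [Finset.mem_insert, hqp]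
  rw [h1, h2, diffOp_insert hpD]
  ring

lemma one_sub_one_div_nonneg (p : ℕ) : (0 : ℝ) ≤ 1 - 1 / p := by
  rcases Nat.eq_zero_or_pos p with rfl | hp
  · simp
  · have : (1 : ℝ) ≤ p := by exact_mod_cast hp
    rw [sub_nonneg, div_le_one (by linarith)]; exact this

lemma sieveWeight_nonneg (P D : Finset ℕ) :
    0 ≤ subsetWeight (fun p : ℕ => (1 : ℝ) / p) (fun p => 1 - 1 / p) P D :=
  subsetWeight_nonneg (fun p _ => by positivity) (fun p _ => one_sub_one_div_nonneg p) D

lemma sieveEnergy_nonneg : 0 ≤ sieveEnergy P f x :=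
  Finset.sum_nonneg fun _ _ => mul_nonneg (sieveWeight_nonneg _ _) (sq_nonneg _)

lemma sieveEnergy_eq_zero (hf : ∀ y < 1, f y = 0) (hP : ∀ p ∈ P, 0 < p) (hx : x < 1) :
    sieveEnergy P f x = 0 := by
  refine Finset.sum_eq_zero fun D hD => ?_
  rw [diffOp, dilSum_eq_zero hf (fun p hp => hP p (Finset.mem_powerset.1 hD hp)) hx]
  simp

/-- Orthogonal decomposition of the mean square with respect to the event `p ∈ D`. -/
lemma sieveEnergy_insert (hp : p ∉ P) (hp0 : 0 < p) :
    sieveEnergy (insert p P) f x = sieveEnergy P (fun y => f y + -(1 / (p : ℝ)) * f (y / p)) x +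
      ((p : ℝ) - 1) / (p : ℝ) ^ 2 * sieveEnergy P f (x / p) := by
  have hp' : (p : ℝ) ≠ 0 := by exact_mod_cast hp0.ne'
  rw [sieveEnergy, diffEnergy_insert hp, sieveEnergy, sieveEnergy, diffEnergy, diffEnergy,
    Finset.mul_sum, ← Finset.sum_add_distrib]
  refine Finset.sum_congr rfl fun D _ => ?_
  have : diffOp D (fun y => f y + -(1 / (p : ℝ)) * f (y / p)) x =
      diffOp D f x + -(1 / (p : ℝ)) * diffOp D f (x / p) := dilSum_add_mul_dilation _ _
  rw [this]
  field_simp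
  ring

/-- The sum of `F (x / n) / n` over the `n ≤ x` all of whose prime factors lie in `P`. -/
noncomputable def factoredSum (P : Finset ℕ) (F : ℝ → ℝ) (x : ℝ) : ℝ :=
  ∑ n ∈ (Finset.Ioc 0 ⌊x⌋₊).filter (fun n => n.primeFactors ⊆ P), 1 / (n : ℝ) * F (x / n)

lemma factoredSum_eq_zero {F : ℝ → ℝ} (hx : x < 1) : factoredSum P F x = 0 := by
  rw [factoredSum, Nat.floor_eq_zero.2 hx]; simp

/-- The `n` divisible by `p` are `p` times the summation variables at level `x / p`. -/
lemma factoredSum_insert {F : ℝ → ℝ} (hp : p.Prime) (hpP : p ∉ P) :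
    factoredSum (insert p P) F x =
      factoredSum P F x + 1 / (p : ℝ) * factoredSum (insert p P) F (x / p) := by
  have hp' : (p : ℝ) ≠ 0 := by exact_mod_cast hp.ne_zero
  rw [factoredSum, ← Finset.sum_filter_add_sum_filter_not _ (fun n => ¬ p ∣ n)]
  congr 1
  · rw [factoredSum, Finset.filter_filter]
    refine Finset.sum_congr ?_ fun _ _ => rfl
    refine Finset.filter_congr fun n hn => ?_
    have hn0 : n ≠ 0 := by have := (Finset.mem_Ioc.1 hn).1; omega
    constructor
    · rintro ⟨h1, h2⟩ q hq
      rcases Finset.mem_insert.1 (h1 hq) with h | h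
      · exact absurd (h ▸ Nat.dvd_of_mem_primeFactors hq) h2
      · exact h
    · intro h
      refine ⟨h.trans (Finset.subset_insert _ _), fun hpn => hpP (h ?_)⟩
      exact Nat.mem_primeFactors.2 ⟨hp, hpn, hn0⟩
  · rw [factoredSum, Finset.mul_sum, Nat.floor_div_natCast]
    symm
    refine Finset.sum_bij' (fun n _ => p * n) (fun n _ => n / p) ?_ ?_ ?_ ?_ ?_
    · intro n hn
      simp only [Finset.mem_filter, Finset.mem_Ioc, not_not] at hn ⊢
      refine ⟨⟨⟨Nat.mul_pos hp.pos hn.1.1, ?_⟩, ?_⟩, dvd_mul_right _ _⟩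
      · rw [mul_comm]; exact (Nat.le_div_iff_mul_le hp.pos).1 hn.1.2
      · rw [Nat.primeFactors_mul hp.ne_zero (by omega), hp.primeFactors]
        exact Finset.union_subset (by simp) hn.2
    · intro n hn
      simp only [Finset.mem_filter, Finset.mem_Ioc, not_not] at hn ⊢
      have hd := hn.2
      refine ⟨⟨Nat.div_pos (Nat.le_of_dvd hn.1.1.1 hd) hp.pos, Nat.div_le_div_right hn.1.1.2⟩, ?_⟩
      exact (Nat.primeFactors_mono (Nat.div_dvd_of_dvd hd) (by omega)).trans hn.1.2
    · intro n _
      exact Nat.mul_div_cancel_left n hp.pos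
    · intro n hn
      simp only [Finset.mem_filter, Finset.mem_Ioc, not_not] at hn
      exact Nat.mul_div_cancel' hn.2
    · intro n _
      push_cast
      rw [div_div]; field_simp

/-- Upper bound for the mean square through the averaged operator `∏ p ∈ P, (1 - T p / p)`. In
contrast to the exact diagonalization no coprimality condition couples the two variables. -/
theorem sieveEnergy_le_factoredSum {P : Finset ℕ} (hP : ∀ p ∈ P, p.Prime) :
    ∀ {f : ℝ → ℝ}, (∀ y < 1, f y = 0) → ∀ x : ℝ,
      sieveEnergy P f x ≤
        factoredSum P (fun y => dilSum (fun p => -(1 / (p : ℝ))) P f y ^ 2) x := by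
  induction P using Finset.induction_on with
  | empty =>
    intro f hf x
    rcases lt_or_ge x 1 with hx | hx
    · rw [sieveEnergy_eq_zero hf (by simp) hx, factoredSum_eq_zero hx]
    · have h1 : (Finset.Ioc 0 ⌊x⌋₊).filter (fun n => n.primeFactors ⊆ ∅) = {1} := by
        ext n
        simp only [Finset.mem_filter, Finset.mem_Ioc, Finset.subset_empty,
          Nat.primeFactors_eq_empty, Finset.mem_singleton]
        have : 1 ≤ ⌊x⌋₊ := Nat.one_le_floor_iff _ |>.2 hx
        omega
      rw [factoredSum, h1]
      simp [sieveEnergy, diffEnergy, subsetWeight, diffOp]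
  | insert p P hpP ih =>
    intro f hf x
    have hp : p.Prime := hP p (Finset.mem_insert_self _ _)
    have hP' : ∀ q ∈ P, q.Prime := fun q hq => hP q (Finset.mem_insert_of_mem hq)
    have hp1 : (1 : ℝ) < p := by exact_mod_cast hp.one_lt
    have hp2 : (2 : ℝ) ≤ p := by exact_mod_cast hp.two_le
    set F : ℝ → ℝ := fun y => dilSum (fun p => -(1 / (p : ℝ))) (insert p P) f y ^ 2 with hF
    have hM : ∀ y < 1, f y + -(1 / (p : ℝ)) * f (y / p) = 0 := by
      intro y hy
      have : y / p < 1 := by rw [div_lt_one (by linarith)]; linarith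
      rw [hf y hy, hf _ this]; simp
    have hih : ∀ x, sieveEnergy P (fun y => f y + -(1 / (p : ℝ)) * f (y / p)) x ≤
        factoredSum P F x := by
      intro x
      refine (ih hP' hM x).trans (le_of_eq ?_)
      rw [factoredSum, factoredSum]
      refine Finset.sum_congr rfl fun n _ => ?_
      rw [hF]
      simp only
      rw [dilSum_add_mul_dilation, dilSum_insert hpP]
    have hconv : ∀ x, (1 - 1 / (p : ℝ)) * sieveEnergy P f x ≤
        sieveEnergy P (fun y => f y + -(1 / (p : ℝ)) * f (y / p)) x +
          1 / (p : ℝ) * ((1 - 1 / (p : ℝ)) * sieveEnergy P f (x / p)) := by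
      intro x
      rw [sieveEnergy, sieveEnergy, sieveEnergy, diffEnergy, diffEnergy, diffEnergy,
        Finset.mul_sum, Finset.mul_sum, Finset.mul_sum, ← Finset.sum_add_distrib]
      refine Finset.sum_le_sum fun D _ => ?_
      have h1 : diffOp D (fun y => f y + -(1 / (p : ℝ)) * f (y / p)) x =
        diffOp D f x + -(1 / (p : ℝ)) * diffOp D f (x / p) := dilSum_add_mul_dilation _ _
      rw [h1]
      have h2 := sieveWeight_nonneg P D
      set w := subsetWeight (fun p : ℕ => (1 : ℝ) / p) (fun p => 1 - 1 / p) P D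
      have h3 : 0 ≤ w * (1 / (p : ℝ) * (diffOp D f x - diffOp D f (x / p)) ^ 2) := by positivity
      linarith
    have hscale : ∀ k : ℕ, ∀ x : ℝ, x < 2 ^ k →
        (1 - 1 / (p : ℝ)) * sieveEnergy P f x ≤ factoredSum (insert p P) F x := by
      intro k
      induction k with
      | zero =>
        intro x hx
        rw [pow_zero] at hx
        rw [sieveEnergy_eq_zero hf (fun q hq => (hP' q hq).pos) hx, factoredSum_eq_zero hx,
          mul_zero]
      | succ k ihk =>
        intro x hx
        rcases lt_or_ge x 1 with hx1 | hx1
        · rw [sieveEnergy_eq_zero hf (fun q hq => (hP' q hq).pos) hx1, factoredSum_eq_zero hx1,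
            mul_zero]
        have hxp : x / p < 2 ^ k := by
          rw [div_lt_iff₀ (by linarith)]
          rw [pow_succ] at hx
          have : (0 : ℝ) < 2 ^ k := by positivity
          nlinarith
        rw [factoredSum_insert hp hpP]
        refine (hconv x).trans ?_
        gcongr
        · exact hih x
        · exact ihk _ hxp
    obtain ⟨k, hk⟩ := pow_unbounded_of_one_lt (x / p) (one_lt_two (α := ℝ))
    rw [sieveEnergy_insert hpP hp.pos, factoredSum_insert hp hpP]
    have h1 := hscale k _ hk
    have h2 : ((p : ℝ) - 1) / (p : ℝ) ^ 2 * sieveEnergy P f (x / p) =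
        1 / (p : ℝ) * ((1 - 1 / (p : ℝ)) * sieveEnergy P f (x / p)) := by
      field_simp
    rw [h2]
    gcongr
    exact hih x

/-- A two-term form of the Cauchy-Schwarz inequality. -/
lemma add_sq_le_add_mul_add {a b u v u' v' : ℝ} (hu : 0 ≤ u) (hv : 0 ≤ v) (hu' : 0 ≤ u')
    (hv' : 0 ≤ v') (h : a ^ 2 ≤ u * v) (h' : b ^ 2 ≤ u' * v') :
    (a + b) ^ 2 ≤ (u + u') * (v + v') := by
  have h1 : (2 * a * b) ^ 2 ≤ (u * v' + u' * v) ^ 2 := by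
    have h2 : a ^ 2 * b ^ 2 ≤ (u * v) * (u' * v') := mul_le_mul h h' (sq_nonneg _) (by positivity)
    nlinarith [sq_nonneg (u * v' - u' * v)]
  have h3 := abs_le_of_sq_le_sq' h1 (by positivity)
  nlinarith [h3.2]

/-- The indicator function of `[1, ∞)`. -/
noncomputable def cutoff (y : ℝ) : ℝ := if y < 1 then 0 else 1

lemma cutoff_nonneg (y : ℝ) : 0 ≤ cutoff y := by rw [cutoff]; split_ifs <;> norm_num

lemma cutoff_mono : Monotone cutoff := by
  intro a b hab
  rw [cutoff, cutoff]
  split_ifs <;> linarith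

/-- Selberg's lower bound for the mean square, proved by adding one prime at a time. -/
theorem sq_le_dilSum_mul_sieveEnergy {P : Finset ℕ} (hP : ∀ p ∈ P, p.Prime) :
    ∀ {f : ℝ → ℝ}, (∀ y < 1, f y = 0) → ∀ x : ℝ,
      f x ^ 2 ≤ dilSum (fun p => 1 / ((p : ℝ) - 1)) P cutoff x * sieveEnergy P f x := by
  induction P using Finset.induction_on with
  | empty =>
    intro f hf x
    rcases lt_or_ge x 1 with hx | hx
    · simp [hf x hx, cutoff, hx]
    · simp [cutoff, not_lt.2 hx, sieveEnergy, diffEnergy, subsetWeight, diffOp]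
  | insert p P hpP ih =>
    intro f hf x
    have hp : p.Prime := hP p (Finset.mem_insert_self _ _)
    have hP' : ∀ q ∈ P, q.Prime := fun q hq => hP q (Finset.mem_insert_of_mem hq)
    have hp1 : (1 : ℝ) < p := by exact_mod_cast hp.one_lt
    have hM : ∀ y < 1, f y + -(1 / (p : ℝ)) * f (y / p) = 0 := by
      intro y hy
      have : y / p < 1 := by rw [div_lt_one (by linarith)]; linarith
      rw [hf y hy, hf _ this]; simp
    have hVnn : ∀ y, 0 ≤ dilSum (fun p : ℕ => 1 / ((p : ℝ) - 1)) P cutoff y := fun y =>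
      dilSum_nonneg (fun q hq => by
        have : (1 : ℝ) < q := by exact_mod_cast (hP' q hq).one_lt
        exact div_nonneg zero_le_one (by linarith)) cutoff_nonneg
    have h1 := ih hP' hM x
    have h2 := ih hP' hf (x / p)
    have hp0 : (0 : ℝ) < (p : ℝ) - 1 := by linarith
    rw [sieveEnergy_insert hpP hp.pos, dilSum_insert hpP]
    have h3 : (f (x / p) / p) ^ 2 ≤ (1 / ((p : ℝ) - 1) *
        dilSum (fun p => 1 / ((p : ℝ) - 1)) P cutoff (x / p)) *
        (((p : ℝ) - 1) / (p : ℝ) ^ 2 * sieveEnergy P f (x / p)) := by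
      rw [div_pow, div_le_iff₀ (by positivity)]
      refine h2.trans (le_of_eq ?_)
      field_simp
    have h4 := add_sq_le_add_mul_add (hVnn x) sieveEnergy_nonneg
      (mul_nonneg (by positivity) (hVnn _)) (mul_nonneg (by positivity) sieveEnergy_nonneg) h1 h3
    refine le_trans (le_of_eq ?_) h4
    congr 1
    ring

/-- Passing from the weights `1 / (p - 1)` to `1 / p` costs only a convergent product. -/
lemma dilSum_totient_le {P : Finset ℕ} (hP : ∀ p ∈ P, p.Prime) :
    ∀ x : ℝ, 0 ≤ x → dilSum (fun p => 1 / ((p : ℝ) - 1)) P cutoff x ≤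
      (∏ p ∈ P, (1 + 2 / (p : ℝ) ^ 2)) * dilSum (fun p => 1 / (p : ℝ)) P cutoff x := by
  induction P using Finset.induction_on with
  | empty => intro x _; simp
  | insert p P hpP ih =>
    intro x hx
    have hp : p.Prime := hP p (Finset.mem_insert_self _ _)
    have hP' : ∀ q ∈ P, q.Prime := fun q hq => hP q (Finset.mem_insert_of_mem hq)
    have hp2 : (2 : ℝ) ≤ p := by exact_mod_cast hp.two_le
    have hnn : ∀ y, 0 ≤ dilSum (fun p : ℕ => 1 / (p : ℝ)) P cutoff y := fun y =>
      dilSum_nonneg (fun q _ => by positivity) cutoff_nonneg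
    rw [dilSum_insert hpP, dilSum_insert hpP, Finset.prod_insert hpP]
    set V := ∏ p ∈ P, (1 + 2 / (p : ℝ) ^ 2) with hV
    have hV0 : 0 ≤ V := Finset.prod_nonneg fun q _ => by positivity
    have h1 : 1 / ((p : ℝ) - 1) ≤ 1 / (p : ℝ) + 2 / (p : ℝ) ^ 2 := by
      have h0 : (0 : ℝ) < (p : ℝ) - 1 := by linarith
      have : 1 / (p : ℝ) + 2 / (p : ℝ) ^ 2 = (p + 2) / (p : ℝ) ^ 2 := by field_simp
      rw [this, div_le_div_iff₀ h0 (by positivity)]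
      nlinarith
    have hxp0 : 0 ≤ x / p := by positivity
    have hmono : dilSum (fun p => 1 / (p : ℝ)) P cutoff (x / p) ≤
        dilSum (fun p => 1 / (p : ℝ)) P cutoff x := by
      refine Finset.sum_le_sum fun U _ => ?_
      refine mul_le_mul_of_nonneg_left (cutoff_mono ?_)
        (Finset.prod_nonneg fun q _ => by positivity)
      gcongr
      exact div_le_self hx (by linarith)
    have hq0 : 0 ≤ 2 / (p : ℝ) ^ 2 := by positivity
    calc _ ≤ V * dilSum (fun p => 1 / (p : ℝ)) P cutoff x + (1 / (p : ℝ) + 2 / (p : ℝ) ^ 2) *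
            (V * dilSum (fun p => 1 / (p : ℝ)) P cutoff (x / p)) :=
          add_le_add (ih hP' x hx) (mul_le_mul h1 (ih hP' _ hxp0)
            (dilSum_nonneg (fun q hq => by
              have : (1 : ℝ) < q := by exact_mod_cast (hP' q hq).one_lt
              exact div_nonneg zero_le_one (by linarith)) cutoff_nonneg) (by positivity))
      _ = V * (dilSum (fun p => 1 / (p : ℝ)) P cutoff x +
            1 / (p : ℝ) * dilSum (fun p => 1 / (p : ℝ)) P cutoff (x / p) +
            2 / (p : ℝ) ^ 2 * dilSum (fun p => 1 / (p : ℝ)) P cutoff (x / p)) := by ring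
      _ ≤ V * (dilSum (fun p => 1 / (p : ℝ)) P cutoff x +
            1 / (p : ℝ) * dilSum (fun p => 1 / (p : ℝ)) P cutoff (x / p) +
            (2 / (p : ℝ) ^ 2 * dilSum (fun p => 1 / (p : ℝ)) P cutoff x +
            2 / (p : ℝ) ^ 2 *
              (1 / (p : ℝ) * dilSum (fun p => 1 / (p : ℝ)) P cutoff (x / p)))) := by
          refine mul_le_mul_of_nonneg_left (add_le_add le_rfl ?_) hV0
          have j1 := mul_le_mul_of_nonneg_left hmono hq0
          have j2 : 0 ≤ 2 / (p : ℝ) ^ 2 *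
              (1 / (p : ℝ) * dilSum (fun p => 1 / (p : ℝ)) P cutoff (x / p)) :=
            mul_nonneg hq0 (mul_nonneg (by positivity) (hnn _))
          linarith
      _ = _ := by ring

/-- Replacing the weights at the primes of `E` by `1` increases the mean square at most by a bounded
factor for each prime of `E`, if it is bounded at all lower levels. -/
lemma diffEnergy_one_on_le {P E : Finset ℕ} (hP : ∀ p ∈ P, p.Prime) (hE : E ⊆ P) {f : ℝ → ℝ}
    {B : ℝ} :
    ∀ x : ℝ, 0 ≤ x → (∀ y, 0 ≤ y → y ≤ x → sieveEnergy P f y ≤ B) →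
      diffEnergy (fun p => if p ∈ E then 1 else 1 / (p : ℝ))
        (fun p => if p ∈ E then 1 else 1 - 1 / (p : ℝ)) P f x ≤ 10 ^ E.card * B := by
  induction E using Finset.induction_on with
  | empty => intro x hx h; simpa [sieveEnergy] using h x hx le_rfl
  | insert p E hpE ih =>
    intro x hx h
    have ih := ih ((Finset.subset_insert p E).trans hE)
    have hpP : p ∈ P := hE (Finset.mem_insert_self _ _)
    have hp := hP p hpP
    have hp2 : (2 : ℝ) ≤ p := by exact_mod_cast hp.two_le
    obtain ⟨P0, hpP0, rfl⟩ : ∃ P0, p ∉ P0 ∧ P = insert p P0 :=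
      ⟨P.erase p, Finset.notMem_erase _ _, (Finset.insert_erase hpP).symm⟩
    set α : ℕ → ℝ := fun p => if p ∈ E then 1 else 1 / (p : ℝ) with hα
    set β : ℕ → ℝ := fun p => if p ∈ E then 1 else 1 - 1 / (p : ℝ) with hβ
    have hw : ∀ D, 0 ≤ subsetWeight α β P0 D := fun D =>
      subsetWeight_nonneg (fun q _ => by rw [hα]; simp only; split_ifs <;> positivity)
        (fun q _ => by
          rw [hβ]; simp only; split_ifs
          · norm_num
          · exact one_sub_one_div_nonneg q) D
    have hlow : ∀ y, ∑ D ∈ P0.powerset, subsetWeight α β P0 D * diffOp D f y ^ 2 ≤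
        2 * diffEnergy α β (insert p P0) f y := by
      intro y
      rw [diffEnergy_insert hpP0, Finset.mul_sum]
      refine Finset.sum_le_sum fun D _ => ?_
      have e1 : β p = 1 - 1 / (p : ℝ) := by rw [hβ]; simp [hpE]
      have e2 : α p = 1 / (p : ℝ) := by rw [hα]; simp [hpE]
      rw [e1, e2]
      have h5 : 1 / (p : ℝ) ≤ 1 / 2 := by gcongr
      have h6 : 0 ≤ 1 / (p : ℝ) := by positivity
      have h7 := hw D
      rw [mul_left_comm]
      refine mul_le_mul_of_nonneg_left ?_ h7
      nlinarith [sq_nonneg (diffOp D f y), sq_nonneg (diffOp D f y - diffOp D f (y / p)),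
        mul_nonneg h6 (sq_nonneg (diffOp D f y - diffOp D f (y / p)))]
    have e3 : diffEnergy (fun q => if q ∈ insert p E then 1 else 1 / (q : ℝ))
        (fun q => if q ∈ insert p E then 1 else 1 - 1 / (q : ℝ)) (insert p P0) f x =
        ∑ D ∈ P0.powerset, subsetWeight α β P0 D *
          (diffOp D f x ^ 2 + (diffOp D f x - diffOp D f (x / p)) ^ 2) := by
      rw [diffEnergy_insert hpP0]
      refine Finset.sum_congr rfl fun D _ => ?_
      rw [subsetWeight_congr (α' := α) (β' := β)]
      · simp
      · intro q hq
        have : q ≠ p := fun h => hpP0 (h ▸ hq)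
        simp [hα, this]
      · intro q hq
        have : q ≠ p := fun h => hpP0 (h ▸ hq)
        simp [hβ, this]
    have hxp : x / p ≤ x := div_le_self hx (by linarith)
    have hxp0 : 0 ≤ x / p := by positivity
    have i1 := ih x hx h
    have i2 := ih (x / p) hxp0 fun y hy hyx => h y hy (hyx.trans hxp)
    rw [e3, Finset.card_insert_of_notMem hpE]
    calc _ ≤ 3 * ∑ D ∈ P0.powerset, subsetWeight α β P0 D * diffOp D f x ^ 2 +
          2 * ∑ D ∈ P0.powerset, subsetWeight α β P0 D * diffOp D f (x / p) ^ 2 := by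
          rw [Finset.mul_sum, Finset.mul_sum, ← Finset.sum_add_distrib]
          refine Finset.sum_le_sum fun D _ => ?_
          have := mul_nonneg (hw D) (sq_nonneg (diffOp D f x + diffOp D f (x / p)))
          linarith
      _ ≤ 3 * (2 * (10 ^ E.card * B)) + 2 * (2 * (10 ^ E.card * B)) := by
          have j1 := (hlow x).trans (mul_le_mul_of_nonneg_left i1 zero_le_two)
          have j2 := (hlow (x / p)).trans (mul_le_mul_of_nonneg_left i2 zero_le_two)
          gcongr
      _ = 10 ^ (E.card + 1) * B := by ring

end Dilations

/-! ### Averaged truncated logarithms outside a finite set of primes -/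

section SingleForm

open scoped ArithmeticFunction.Moebius Topology

/-- The logarithm, cut off to be zero below `1`. -/
noncomputable def truncLog (y : ℝ) : ℝ := Real.log (max 1 y)

lemma truncLog_of_lt {y : ℝ} (hy : y < 1) : truncLog y = 0 := by
  rw [truncLog, max_eq_left hy.le, Real.log_one]

lemma truncLog_of_le {y : ℝ} (hy : 1 ≤ y) : truncLog y = Real.log y := by
  rw [truncLog, max_eq_right hy]

/-- The primes `p` with `a < p ≤ N`. -/
def primesIn (a N : ℕ) : Finset ℕ := (Finset.Ioc a N).filter Nat.Prime

lemma mem_primesIn {a N p : ℕ} : p ∈ primesIn a N ↔ (a < p ∧ p ≤ N) ∧ p.Prime := by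
  simp [primesIn]

lemma prime_of_mem_primesIn {a N p : ℕ} (h : p ∈ primesIn a N) : p.Prime := (mem_primesIn.1 h).2

lemma primesIn_eq_sdiff (a N : ℕ) : primesIn a N = primesIn 0 N \ primesIn 0 a := by
  ext p
  simp only [Finset.mem_sdiff, mem_primesIn]
  constructor
  · rintro ⟨⟨h1, h2⟩, h3⟩
    exact ⟨⟨⟨h3.pos, h2⟩, h3⟩, fun h => by omega⟩
  · rintro ⟨⟨⟨h1, h2⟩, h3⟩, h4⟩
    exact ⟨⟨by by_contra h; exact h4 ⟨⟨h1, by omega⟩, h3⟩, h2⟩, h3⟩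

lemma squarefree_prod_primes {U : Finset ℕ} (hU : ∀ p ∈ U, p.Prime) : Squarefree (∏ p ∈ U, p) :=
  Finset.squarefree_prod_of_pairwise_isCoprime
    (fun p hp q hq hpq => Nat.coprime_iff_isRelPrime.1
      ((Nat.coprime_primes (hU p hp) (hU q hq)).2 hpq))
    fun p hp => (hU p hp).squarefree

/-- Sums over sets of primes are sums over squarefree integers. -/
lemma sum_powerset_primes_eq {P : Finset ℕ} (hP : ∀ p ∈ P, p.Prime) {g : ℕ → ℝ} {N : ℕ}
    (hN : ∀ n, N < n → g n = 0) (hsq : ∀ n, ¬ Squarefree n → g n = 0)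
    (hg : ∀ n ∈ Finset.Ioc 0 N, Squarefree n → g n ≠ 0 → n.primeFactors ⊆ P) :
    ∑ U ∈ P.powerset, g (∏ p ∈ U, p) = ∑ n ∈ Finset.Ioc 0 N, g n := by
  have hU : ∀ U ∈ P.powerset, ∀ p ∈ U, p.Prime := fun U hU p hp =>
    hP p (Finset.mem_powerset.1 hU hp)
  have hinj : Set.InjOn (fun U : Finset ℕ => ∏ p ∈ U, p) (P.powerset : Set (Finset ℕ)) := by
    intro U hU1 U' hU2 h
    rw [← Nat.primeFactors_prod (hU U hU1), ← Nat.primeFactors_prod (hU U' hU2)]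
    exact congrArg _ h
  rw [← Finset.sum_image (f := g) hinj]
  refine Finset.sum_congr_of_eq_on_inter ?_ ?_ fun _ _ _ => rfl
  · intro n hn hn'
    obtain ⟨U, hU1, rfl⟩ := Finset.mem_image.1 hn
    refine hN _ ?_
    by_contra h
    exact hn' (Finset.mem_Ioc.2 ⟨Finset.prod_pos fun p hp => (hU U hU1 p hp).pos, by simpa using h⟩)
  · intro n hn hn'
    by_contra h
    have hs : Squarefree n := by by_contra h'; exact h (hsq n h')
    refine hn' (Finset.mem_image.2 ⟨n.primeFactors, Finset.mem_powerset.2 (hg n hn hs h), ?_⟩)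
    exact Nat.prod_primeFactors_of_squarefree hs

/-- The average operator `∏ (1 - T p / p)` over all primes outside `S`, applied to the truncated
logarithm; equivalently the sum of `μ(n) / n * log (y / n)` over the `n ≤ y` free of primes
in `S`. -/
noncomputable def roughLogSum (S : Finset ℕ) (y : ℝ) : ℝ :=
  dilSum (fun p => -(1 / (p : ℝ))) (primesIn 0 ⌊y⌋₊ \ S) truncLog y

/-- In the definition of `roughLogSum` the primes exceeding `y` may be kept. -/
lemma dilSum_eq_roughLogSum (S : Finset ℕ) {y : ℝ} {N : ℕ} (hy : y < N + 1) :
    dilSum (fun p => -(1 / (p : ℝ))) (primesIn 0 N \ S) truncLog y = roughLogSum S y := by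
  have hN : ⌊y⌋₊ ≤ N := by
    rcases lt_or_ge y 0 with h | h
    · rw [Nat.floor_of_nonpos h.le]; exact Nat.zero_le N
    · have := (Nat.floor_lt h).2 (by exact_mod_cast hy : y < (N + 1 : ℕ))
      omega
  refine dilSum_eq_of_subset (fun _ hy => truncLog_of_lt hy) ?_ ?_ ?_
  · refine Finset.sdiff_subset_sdiff (fun p hp => ?_) le_rfl
    rw [mem_primesIn] at *
    exact ⟨⟨hp.1.1, hp.1.2.trans hN⟩, hp.2⟩
  · intro p hp
    exact (prime_of_mem_primesIn (Finset.mem_sdiff.1 hp).1).pos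
  · intro p hp hp'
    rw [Finset.mem_sdiff, mem_primesIn] at *
    refine Nat.lt_of_floor_lt ?_
    by_contra h
    exact hp' ⟨⟨⟨hp.1.1.1, by omega⟩, hp.1.2⟩, hp.2⟩

lemma roughLogSum_of_lt {S : Finset ℕ} {y : ℝ} (hy : y < 1) : roughLogSum S y = 0 :=
  dilSum_eq_zero (fun _ hy => truncLog_of_lt hy)
    (fun _ hp => (prime_of_mem_primesIn (Finset.mem_sdiff.1 hp).1).pos) hy

lemma roughLogSum_empty {y : ℝ} (hy : 1 ≤ y) : roughLogSum ∅ y = moebiusLogSum y := by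
  have h1 : ∀ U ∈ (primesIn 0 ⌊y⌋₊).powerset, (∏ p ∈ U, -(1 / (p : ℝ))) *
      truncLog (y / ∏ p ∈ U, (p : ℝ)) =
      (fun n : ℕ => (μ n : ℝ) / n * truncLog (y / n)) (∏ p ∈ U, p) := by
    intro U hU
    have hUp : ∀ p ∈ U, p.Prime := fun p hp => prime_of_mem_primesIn (Finset.mem_powerset.1 hU hp)
    simp only
    rw [ArithmeticFunction.isMultiplicative_moebius.map_prod_of_prime U hUp]
    push_cast
    rw [← Finset.prod_div_distrib]
    congr 1
    refine Finset.prod_congr rfl fun p hp => ?_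
    rw [ArithmeticFunction.moebius_apply_prime (hUp p hp)]
    push_cast; ring
  rw [roughLogSum, Finset.sdiff_empty, dilSum, Finset.sum_congr rfl h1,
    sum_powerset_primes_eq (fun p hp => prime_of_mem_primesIn hp) (N := ⌊y⌋₊)
      (g := fun n : ℕ => (μ n : ℝ) / n * truncLog (y / n)), moebiusLogSum]
  · refine Finset.sum_congr rfl fun n hn => ?_
    rw [Finset.mem_Ioc] at hn
    rw [truncLog_of_le]
    rw [one_le_div (by exact_mod_cast hn.1)]
    exact (Nat.le_floor_iff (by linarith)).1 hn.2
  · intro n hn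
    rw [truncLog_of_lt, mul_zero]
    have hn0 : (0 : ℝ) < n := by exact_mod_cast (by omega : 0 < n)
    rw [div_lt_one hn0]
    exact Nat.lt_of_floor_lt hn
  · intro n hn
    simp [ArithmeticFunction.moebius_eq_zero_of_not_squarefree hn]
  · intro n hn _ _ p hp
    rw [Finset.mem_Ioc] at hn
    have := Nat.prime_of_mem_primeFactors hp
    exact mem_primesIn.2 ⟨⟨this.pos, (Nat.le_of_mem_primeFactors hp).trans hn.2⟩, this⟩

/-- Removing `p` from the average operator inverts `1 - T p / p`. -/
lemma roughLogSum_insert {S : Finset ℕ} {p : ℕ} (hp : p.Prime) (hpS : p ∉ S) {y : ℝ} (hy : 0 ≤ y) :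
    roughLogSum S y =
      roughLogSum (insert p S) y - 1 / (p : ℝ) * roughLogSum (insert p S) (y / p) := by
  set N := max ⌊y⌋₊ p with hN
  have hyN : y < N + 1 := by
    have h1 := Nat.lt_floor_add_one y
    have h2 : (⌊y⌋₊ : ℝ) ≤ N := by exact_mod_cast le_max_left _ _
    linarith
  have hyN' : y / p < N + 1 :=
    lt_of_le_of_lt (div_le_self hy (by exact_mod_cast hp.one_le)) hyN
  have h1 : primesIn 0 N \ S = insert p (primesIn 0 N \ insert p S) := by
    ext q
    simp only [Finset.mem_sdiff, Finset.mem_insert, mem_primesIn]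
    constructor
    · rintro ⟨h, h'⟩
      by_cases hq : q = p
      · exact Or.inl hq
      · exact Or.inr ⟨h, by tauto⟩
    · rintro (rfl | h)
      · exact ⟨⟨⟨hp.pos, le_max_right _ _⟩, hp⟩, hpS⟩
      · exact ⟨h.1, by tauto⟩
  rw [← dilSum_eq_roughLogSum S hyN, h1, dilSum_insert (by simp), dilSum_eq_roughLogSum _ hyN,
    dilSum_eq_roughLogSum _ hyN']
  ring

/-- Inverting `1 - T p / p` preserves boundedness. -/
lemma bounded_of_sub_dilation_bounded {h : ℝ → ℝ} {q B : ℝ} (hq : 2 ≤ q) (hB0 : 0 ≤ B)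
    (h0 : ∀ y < 1, h y = 0)
    (hB : ∀ y, 0 ≤ y → |h y - 1 / q * h (y / q)| ≤ B) (y : ℝ) : |h y| ≤ 2 * B := by
  have key : ∀ k : ℕ, ∀ y : ℝ, y < 2 ^ k → |h y| ≤ 2 * B := by
    intro k
    induction k with
    | zero => intro y hy; rw [h0 y (by simpa using hy), abs_zero]; linarith
    | succ k ih =>
      intro y hy
      rcases lt_or_ge y 1 with hy1 | hy1
      · rw [h0 y hy1, abs_zero]; linarith
      have hyq : y / q < 2 ^ k := by
        rw [div_lt_iff₀ (by linarith)]
        rw [pow_succ] at hy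
        have : (0 : ℝ) < 2 ^ k := by positivity
        nlinarith
      have h1 := ih _ hyq
      have h2 := hB y (by linarith)
      have h3 : |1 / q * h (y / q)| ≤ B := by
        rw [abs_mul, abs_of_nonneg (by positivity : 0 ≤ 1 / q)]
        calc _ ≤ 1 / 2 * (2 * B) := by gcongr
          _ = B := by ring
      calc |h y| = |(h y - 1 / q * h (y / q)) + 1 / q * h (y / q)| := by ring_nf
        _ ≤ _ := abs_add_le _ _
        _ ≤ 2 * B := by linarith
  obtain ⟨k, hk⟩ := pow_unbounded_of_one_lt y (one_lt_two (α := ℝ))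
  exact key k y hk

/-- Inverting `1 - T p / p` preserves convergence. -/
lemma tendsto_of_sub_dilation_tendsto {h : ℝ → ℝ} {q B L : ℝ} (hq : 2 ≤ q)
    (hB : ∀ y, |h y| ≤ B)
    (hL : Tendsto (fun y => h y - 1 / q * h (y / q)) atTop (𝓝 L)) :
    Tendsto h atTop (𝓝 (L * (q / (q - 1)))) := by
  set L' := L * (q / (q - 1)) with hL'
  have hq1 : q - 1 ≠ 0 := by linarith
  have hq0 : q ≠ 0 := by linarith
  have hLL : L = L' - 1 / q * L' := by rw [hL']; field_simp
  set A := B + |L'| + 1 with hA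
  have hA0 : 0 < A := by
    have := (abs_nonneg _).trans (hB 0)
    have := abs_nonneg L'
    linarith
  -- each application of the recursion shrinks the eventual error by `3 / 4`
  have key : ∀ k : ℕ, ∀ᶠ y in atTop, |h y - L'| ≤ (3 / 4) ^ k * A := by
    intro k
    induction k with
    | zero =>
      refine Eventually.of_forall fun y => ?_
      rw [pow_zero, one_mul]
      refine (abs_sub _ _).trans ?_
      have := hB y
      linarith
    | succ k ih =>
      have h1 : ∀ᶠ y in atTop, |h (y / q) - L'| ≤ (3 / 4) ^ k * A :=
        (tendsto_id.atTop_div_const (by linarith : 0 < q)).eventually ih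
      have h2 : ∀ᶠ y in atTop, |(h y - 1 / q * h (y / q)) - L| < (3 / 4) ^ k * A / 4 := by
        have := (Metric.tendsto_nhds.1 hL) ((3 / 4) ^ k * A / 4) (by positivity)
        simpa only [Real.dist_eq] using this
      filter_upwards [h1, h2] with y hy1 hy2
      have h3 : |1 / q * (h (y / q) - L')| ≤ 1 / 2 * ((3 / 4) ^ k * A) := by
        rw [abs_mul, abs_of_nonneg (by positivity : 0 ≤ 1 / q)]
        gcongr
      calc |h y - L'| = |((h y - 1 / q * h (y / q)) - L) + 1 / q * (h (y / q) - L')| := by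
            rw [hLL]; ring_nf
        _ ≤ _ := abs_add_le _ _
        _ ≤ (3 / 4) ^ k * A / 4 + 1 / 2 * ((3 / 4) ^ k * A) := by linarith
        _ = (3 / 4) ^ (k + 1) * A := by ring
  rw [Metric.tendsto_nhds]
  intro ε hε
  obtain ⟨k, hk⟩ := exists_pow_lt_of_lt_one (div_pos hε hA0) (by norm_num : (3 / 4 : ℝ) < 1)
  filter_upwards [key k] with y hy
  rw [Real.dist_eq]
  refine hy.trans_lt ?_
  rwa [lt_div_iff₀ hA0] at hk

/-- The case `S = ∅` is a form of the prime number theorem; the primes of `S` are then removed one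
at a time. -/
lemma exists_bound_roughLogSum_and_tendsto {S : Finset ℕ} (hS : ∀ p ∈ S, p.Prime) :
    (∃ B, 0 ≤ B ∧ ∀ y, |roughLogSum S y| ≤ B) ∧
      Tendsto (roughLogSum S) atTop (𝓝 (∏ p ∈ S, ((p : ℝ) / (p - 1)))) := by
  induction S using Finset.induction_on with
  | empty =>
    constructor
    · refine ⟨4, by norm_num, fun y => ?_⟩
      rcases lt_or_ge y 1 with hy | hy
      · rw [roughLogSum_of_lt hy]; norm_num
      · rw [roughLogSum_empty hy]; exact abs_moebiusLogSum_le hy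
    · rw [Finset.prod_empty]
      refine tendsto_moebiusLogSum.congr' ?_
      filter_upwards [eventually_ge_atTop 1] with y hy
      exact (roughLogSum_empty hy).symm
  | insert p S hpS ih =>
    have hp := hS p (Finset.mem_insert_self _ _)
    have hp2 : (2 : ℝ) ≤ p := by exact_mod_cast hp.two_le
    obtain ⟨⟨B, hB0, hB⟩, hlim⟩ := ih fun q hq => hS q (Finset.mem_insert_of_mem hq)
    have hB' : ∀ y, |roughLogSum (insert p S) y| ≤ 2 * B :=
      bounded_of_sub_dilation_bounded hp2 hB0 (fun y hy => roughLogSum_of_lt hy) fun y hy => by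
        rw [← roughLogSum_insert hp hpS hy]; exact hB y
    refine ⟨⟨2 * B, by linarith, hB'⟩, ?_⟩
    rw [Finset.prod_insert hpS, mul_comm]
    refine tendsto_of_sub_dilation_tendsto hp2 hB' (hlim.congr' ?_)
    filter_upwards [eventually_ge_atTop 0] with y hy
    exact roughLogSum_insert hp hpS hy

lemma primeFactors_primorial (w : ℕ) : (primorial w).primeFactors = primesIn 0 w := by
  have h : primorial w = ∏ p ∈ primesIn 0 w, p := by
    rw [primorial]
    refine Finset.prod_congr ?_ fun _ _ => rfl
    ext p
    simp only [Finset.mem_filter, Finset.mem_range, mem_primesIn]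
    constructor
    · rintro ⟨h1, h2⟩; exact ⟨⟨h2.pos, by omega⟩, h2⟩
    · rintro ⟨h1, h2⟩; exact ⟨by omega, h2⟩
  rw [h, Nat.primeFactors_prod fun p hp => prime_of_mem_primesIn hp]

lemma prod_primes_eq_div_totient (w : ℕ) :
    ∏ p ∈ primesIn 0 w, ((p : ℝ) / (p - 1)) = (primorial w : ℝ) / Nat.totient (primorial w) := by
  have h := Nat.totient_mul_prod_primeFactors (primorial w)
  rw [primeFactors_primorial] at h
  have h1 : (Nat.totient (primorial w) : ℝ) ≠ 0 := by
    exact_mod_cast (Nat.totient_pos.2 (primorial_pos w)).ne'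
  have h2 : ∏ p ∈ primesIn 0 w, ((p : ℝ) - 1) ≠ 0 := by
    refine Finset.prod_ne_zero_iff.2 fun p hp => ?_
    have : (1 : ℝ) < p := by exact_mod_cast (prime_of_mem_primesIn hp).one_lt
    linarith
  rw [Finset.prod_div_distrib, div_eq_div_iff h2 h1]
  have h3 : ((∏ p ∈ primesIn 0 w, (p - 1) : ℕ) : ℝ) = ∏ p ∈ primesIn 0 w, ((p : ℝ) - 1) := by
    rw [Nat.cast_prod]
    refine Finset.prod_congr rfl fun p hp => ?_
    rw [Nat.cast_sub (prime_of_mem_primesIn hp).one_le, Nat.cast_one]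
  rw [← h3]
  have h4 : ((∏ p ∈ primesIn 0 w, p : ℕ) : ℝ) = ∏ p ∈ primesIn 0 w, (p : ℝ) := Nat.cast_prod _ _
  rw [← h4, mul_comm]
  exact_mod_cast h

end SingleForm

/-! ### The mean square attached to one linear form -/

section SieveEnergyAsymptotics

open scoped Topology

/-- The sum of `1 / n` over the `n ≤ x` coprime to `W`. -/
noncomputable def coprimeHarmonic (W : ℕ) (x : ℝ) : ℝ :=
  ∑ n ∈ (Finset.Ioc 0 ⌊x⌋₊).filter (fun n => W.Coprime n), 1 / (n : ℝ)

lemma sum_coprime_Ico_le {W : ℕ} (hW : 0 < W) (K : ℕ) :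
    ∑ n ∈ (Finset.Ico 1 (W * (K + 1) + 1)).filter (fun n => W.Coprime n), 1 / (n : ℝ) ≤
      W + (Nat.totient W : ℝ) / W * harmonic K := by
  induction K with
  | zero =>
    simp only [harmonic_zero, Rat.cast_zero, mul_zero, add_zero, zero_add, mul_one]
    calc _ ≤ ∑ n ∈ Finset.Ico 1 (W + 1), 1 / (n : ℝ) :=
          Finset.sum_le_sum_of_subset_of_nonneg (Finset.filter_subset _ _)
            fun n _ _ => by positivity
      _ ≤ ∑ n ∈ Finset.Ico 1 (W + 1), (1 : ℝ) := by
          refine Finset.sum_le_sum fun n hn => ?_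
          have : (1 : ℝ) ≤ n := by exact_mod_cast (Finset.mem_Ico.1 hn).1
          exact (div_le_one (by linarith)).2 this
      _ = W := by simp
  | succ K ih =>
    have h1 : Finset.Ico 1 (W * (K + 1 + 1) + 1) =
        Finset.Ico 1 (W * (K + 1) + 1) ∪ Finset.Ico (W * (K + 1) + 1) (W * (K + 1) + 1 + W) := by
      rw [Finset.Ico_union_Ico_eq_Ico (by omega) (by omega)]
      congr 1; ring
    have hdisj : Disjoint ((Finset.Ico 1 (W * (K + 1) + 1)).filter (fun n => W.Coprime n))
        ((Finset.Ico (W * (K + 1) + 1) (W * (K + 1) + 1 + W)).filter (fun n => W.Coprime n)) :=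
      Finset.disjoint_filter_filter (Finset.Ico_disjoint_Ico_consecutive _ _ _)
    rw [h1, Finset.filter_union, Finset.sum_union hdisj, harmonic_succ]
    have h2 : ∑ n ∈ (Finset.Ico (W * (K + 1) + 1) (W * (K + 1) + 1 + W)).filter
        (fun n => W.Coprime n), 1 / (n : ℝ) ≤ (Nat.totient W : ℝ) * (1 / (W * (K + 1))) := by
      rw [← Nat.filter_coprime_Ico_eq_totient W (W * (K + 1) + 1), ← nsmul_eq_mul]
      refine Finset.sum_le_card_nsmul _ _ _ fun n hn => ?_
      have := (Finset.mem_Ico.1 (Finset.mem_filter.1 hn).1).1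
      have h3 : ((W * (K + 1) : ℕ) : ℝ) ≤ n := by exact_mod_cast (by omega)
      push_cast at h3
      exact one_div_le_one_div_of_le (by positivity) h3
    push_cast
    calc _ ≤ (W + (Nat.totient W : ℝ) / W * harmonic K) +
          (Nat.totient W : ℝ) * (1 / (W * (K + 1))) := add_le_add ih h2
      _ = _ := by field_simp; ring

/-- The residues coprime to `W` have density `φ(W) / W` in each block of `W` consecutive
integers. -/
lemma coprimeHarmonic_le {W : ℕ} (hW : 0 < W) {x : ℝ} (hx : 1 ≤ x) :
    coprimeHarmonic W x ≤ W + (Nat.totient W : ℝ) / W * (1 + Real.log x) := by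
  set K := ⌊x⌋₊ / W with hK
  refine le_trans ?_ ((sum_coprime_Ico_le hW K).trans ?_)
  · refine Finset.sum_le_sum_of_subset_of_nonneg (Finset.filter_subset_filter _ fun n hn => ?_)
      fun n _ _ => by positivity
    rw [Finset.mem_Ioc] at hn
    rw [Finset.mem_Ico]
    have := Nat.lt_mul_div_succ ⌊x⌋₊ hW
    exact ⟨hn.1, by rw [← hK] at this; omega⟩
  · gcongr
    refine (harmonic_le_one_add_log K).trans ?_
    rcases Nat.eq_zero_or_pos K with h0 | h0
    · rw [h0]; simp [Real.log_nonneg hx]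
    · gcongr
      calc (K : ℝ) ≤ ⌊x⌋₊ := by exact_mod_cast Nat.div_le_self _ _
        _ ≤ x := Nat.floor_le (by linarith)

lemma dilSum_one_div_le_coprimeHarmonic (w N : ℕ) (x : ℝ) :
    dilSum (fun p => 1 / (p : ℝ)) (primesIn w N) cutoff x ≤ coprimeHarmonic (primorial w) x := by
  set P := primesIn w N with hP
  have hPp : ∀ p ∈ P, p.Prime := fun p hp => prime_of_mem_primesIn hp
  set g : ℕ → ℝ := fun n =>
    if Squarefree n ∧ n.primeFactors ⊆ P then 1 / (n : ℝ) * cutoff (x / n) else 0 with hg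
  have h1 : dilSum (fun p => 1 / (p : ℝ)) P cutoff x = ∑ U ∈ P.powerset, g (∏ p ∈ U, p) := by
    refine Finset.sum_congr rfl fun U hU => ?_
    have hUp : ∀ p ∈ U, p.Prime := fun p hp => hPp p (Finset.mem_powerset.1 hU hp)
    rw [hg]
    simp only
    rw [if_pos ⟨squarefree_prod_primes hUp, by
      rw [Nat.primeFactors_prod hUp]; exact Finset.mem_powerset.1 hU⟩]
    push_cast
    rw [Finset.prod_div_distrib]; simp
  rw [h1, sum_powerset_primes_eq hPp (N := ⌊x⌋₊)]
  · rw [coprimeHarmonic, Finset.sum_filter]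
    refine Finset.sum_le_sum fun n hn => ?_
    rw [Finset.mem_Ioc] at hn
    rw [hg]
    simp only
    split_ifs with h2 h3 h3
    · refine mul_le_of_le_one_right (by positivity) ?_
      rw [cutoff]; split_ifs <;> norm_num
    · exfalso
      refine h3 ?_
      rw [← Nat.disjoint_primeFactors (primorial_pos w).ne' (by omega), primeFactors_primorial]
      refine Finset.disjoint_left.2 fun p hp hp' => ?_
      have := (mem_primesIn.1 (h2.2 hp')).1.1
      have := (mem_primesIn.1 hp).1.2
      omega
    · positivity
    · exact le_rfl
  · intro n hn
    rw [hg]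
    simp only
    have : cutoff (x / n) = 0 := by
      rw [cutoff, if_pos]
      rw [div_lt_one (by exact_mod_cast (by omega : 0 < n))]
      exact Nat.lt_of_floor_lt hn
    rw [this]; simp
  · intro n hn; rw [hg]; simp [hn]
  · intro n _ _ h
    rw [hg] at h
    by_contra h'
    simp [h'] at h

/-- Summation of a bounded convergent function against the logarithmic density on the integers
coprime to `W`. -/
lemma exists_sum_coprime_sq_le {G : ℝ → ℝ} {B C : ℝ} {W : ℕ} (hW : 0 < W)
    (hC : C = (W : ℝ) / Nat.totient W) (hB : ∀ y, |G y| ≤ B) (hG : Tendsto G atTop (𝓝 C))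
    {ε : ℝ} (hε : 0 < ε) :
    ∃ R₁ : ℝ, ∀ R, R₁ ≤ R → ∀ y, 1 ≤ y → y ≤ R →
      ∑ n ∈ (Finset.Ioc 0 ⌊y⌋₊).filter (fun n => W.Coprime n), 1 / (n : ℝ) * G (y / n) ^ 2 ≤
        (1 + ε) * C * Real.log R := by
  have hW' : (0 : ℝ) < W := by exact_mod_cast hW
  have hφ : (0 : ℝ) < Nat.totient W := by exact_mod_cast Nat.totient_pos.2 hW
  have hC0 : 0 < C := by rw [hC]; positivity
  have hCφ : (Nat.totient W : ℝ) / W = 1 / C := by rw [hC, one_div_div]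
  have h1 : ∀ᶠ z in atTop, G z ^ 2 < C ^ 2 + ε / 2 * C ^ 2 :=
    (hG.pow 2).eventually_lt_const (by have : 0 < ε / 2 * C ^ 2 := by positivity
                                       linarith)
  obtain ⟨Y, hY⟩ := eventually_atTop.1 (h1.and (eventually_ge_atTop (1 : ℝ)))
  have hY1 : 1 ≤ Y := (hY Y le_rfl).2
  set D := (1 + ε / 2) * C ^ 2 * (W + 1 / C) + B ^ 2 * Y with hD
  have hlog : ∀ᶠ R in atTop, D ≤ ε / 2 * C * Real.log R :=
    (Real.tendsto_log_atTop.const_mul_atTop (by positivity)).eventually_ge_atTop D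
  obtain ⟨R₁, hR₁⟩ := eventually_atTop.1 hlog
  refine ⟨R₁, fun R hR y hy hyR => ?_⟩
  have hterm : ∀ n ∈ (Finset.Ioc 0 ⌊y⌋₊).filter (fun n => W.Coprime n),
      1 / (n : ℝ) * G (y / n) ^ 2 ≤
        (1 + ε / 2) * C ^ 2 * (1 / (n : ℝ)) + B ^ 2 * (Y / y) := by
    intro n hn
    have hn0 : (0 : ℝ) < n := by
      exact_mod_cast (Finset.mem_Ioc.1 (Finset.mem_filter.1 hn).1).1
    have hB2 : G (y / n) ^ 2 ≤ B ^ 2 := sq_le_sq' (by have := (abs_le.1 (hB (y / n))).1; linarith)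
      (abs_le.1 (hB (y / n))).2
    rcases le_or_gt Y (y / n) with h | h
    · have h2 := (hY _ h).1.le
      have h3 : 1 / (n : ℝ) * G (y / n) ^ 2 ≤ 1 / (n : ℝ) * (C ^ 2 + ε / 2 * C ^ 2) := by gcongr
      have h4 : 0 ≤ B ^ 2 * (Y / y) := by positivity
      linarith
    · have h2 : 1 / (n : ℝ) ≤ Y / y := by
        rw [div_le_div_iff₀ hn0 (by linarith)]
        rw [div_lt_iff₀ hn0] at h
        linarith
      have h3 : 1 / (n : ℝ) * G (y / n) ^ 2 ≤ Y / y * B ^ 2 := by gcongr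
      have h4 : 0 ≤ (1 + ε / 2) * C ^ 2 * (1 / (n : ℝ)) := by positivity
      linarith
  have hcard : (((Finset.Ioc 0 ⌊y⌋₊).filter (fun n => W.Coprime n)).card : ℝ) ≤ y := by
    calc _ ≤ ((Finset.Ioc 0 ⌊y⌋₊).card : ℝ) := by exact_mod_cast Finset.card_filter_le _ _
      _ = ⌊y⌋₊ := by simp
      _ ≤ y := Nat.floor_le (by linarith)
  calc _ ≤ ∑ n ∈ (Finset.Ioc 0 ⌊y⌋₊).filter (fun n => W.Coprime n),
        ((1 + ε / 2) * C ^ 2 * (1 / (n : ℝ)) + B ^ 2 * (Y / y)) := Finset.sum_le_sum hterm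
    _ = (1 + ε / 2) * C ^ 2 * coprimeHarmonic W y +
        ((Finset.Ioc 0 ⌊y⌋₊).filter (fun n => W.Coprime n)).card * (B ^ 2 * (Y / y)) := by
        rw [Finset.sum_add_distrib, ← Finset.mul_sum, Finset.sum_const, nsmul_eq_mul,
          coprimeHarmonic]
    _ ≤ (1 + ε / 2) * C ^ 2 * (W + 1 / C * (1 + Real.log R)) + y * (B ^ 2 * (Y / y)) := by
        gcongr
        refine (coprimeHarmonic_le hW hy).trans ?_
        rw [hCφ]
        gcongr
    _ = (1 + ε / 2) * C * Real.log R + D := by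
        rw [hD]; field_simp; ring
    _ ≤ _ := by linarith [hR₁ R hR]

/-- Upper bound in the asymptotic formula for one linear form, uniformly over all levels
`y ≤ R`. -/
theorem exists_sieveEnergy_le (w : ℕ) {ε : ℝ} (hε : 0 < ε) :
    ∃ R₁ : ℝ, ∀ R, R₁ ≤ R → ∀ y, y ≤ R →
      sieveEnergy (primesIn w ⌊R⌋₊) truncLog y ≤
        (1 + ε) * ((primorial w : ℝ) / Nat.totient (primorial w)) * Real.log R := by
  obtain ⟨⟨B, -, hB⟩, hlim⟩ := exists_bound_roughLogSum_and_tendsto (S := primesIn 0 w)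
    fun p hp => prime_of_mem_primesIn hp
  rw [prod_primes_eq_div_totient] at hlim
  obtain ⟨R₁, hR₁⟩ := exists_sum_coprime_sq_le (primorial_pos w) rfl hB hlim hε
  refine ⟨max 1 R₁, fun R hR y hyR => ?_⟩
  have hPp : ∀ p ∈ primesIn w ⌊R⌋₊, p.Prime := fun p hp => prime_of_mem_primesIn hp
  rcases lt_or_ge y 1 with hy | hy
  · rw [sieveEnergy_eq_zero (fun y hy => truncLog_of_lt hy) (fun p hp => (hPp p hp).pos) hy]
    have := Real.log_nonneg ((le_max_left 1 R₁).trans hR)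
    positivity
  refine (sieveEnergy_le_factoredSum hPp (fun y hy => truncLog_of_lt hy) y).trans ?_
  refine le_trans ?_ (hR₁ R ((le_max_right _ _).trans hR) y hy hyR)
  rw [factoredSum]
  have h1 : ∀ n ∈ (Finset.Ioc 0 ⌊y⌋₊).filter (fun n => n.primeFactors ⊆ primesIn w ⌊R⌋₊),
      1 / (n : ℝ) * dilSum (fun p => -(1 / (p : ℝ))) (primesIn w ⌊R⌋₊) truncLog (y / n) ^ 2 =
      1 / (n : ℝ) * roughLogSum (primesIn 0 w) (y / n) ^ 2 := by
    intro n hn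
    have hn1 : (1 : ℝ) ≤ n := by exact_mod_cast (Finset.mem_Ioc.1 (Finset.mem_filter.1 hn).1).1
    rw [primesIn_eq_sdiff, dilSum_eq_roughLogSum]
    calc y / n ≤ y := div_le_self (by linarith) hn1
      _ ≤ R := hyR
      _ < _ := Nat.lt_floor_add_one R
  rw [Finset.sum_congr rfl h1]
  refine Finset.sum_le_sum_of_subset_of_nonneg (fun n hn => ?_) fun n _ _ => by positivity
  rw [Finset.mem_filter] at *
  refine ⟨hn.1, ?_⟩
  have hn0 := (Finset.mem_Ioc.1 hn.1).1
  rw [← Nat.disjoint_primeFactors (primorial_pos w).ne' (by omega), primeFactors_primorial]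
  refine Finset.disjoint_left.2 fun p hp hp' => ?_
  have := (mem_primesIn.1 (hn.2 hp')).1.1
  have := (mem_primesIn.1 hp).1.2
  omega

/-- Lower bound in the asymptotic formula for one linear form, up to a product over the primes
exceeding `w`. -/
theorem exists_le_sieveEnergy (w : ℕ) {ε : ℝ} (hε : 0 < ε) :
    ∃ R₁ : ℝ, ∀ R, R₁ ≤ R →
      ((primorial w : ℝ) / Nat.totient (primorial w)) * Real.log R ≤
        (1 + ε) * (∏ p ∈ primesIn w ⌊R⌋₊, (1 + 2 / (p : ℝ) ^ 2)) *
          sieveEnergy (primesIn w ⌊R⌋₊) truncLog R := by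
  set W := primorial w with hW
  have hW' : (0 : ℝ) < W := by exact_mod_cast primorial_pos w
  have hφ : (0 : ℝ) < Nat.totient W := by exact_mod_cast Nat.totient_pos.2 (primorial_pos w)
  set C : ℝ := (W : ℝ) / Nat.totient W with hC
  have hC0 : 0 < C := by positivity
  have hCφ : (Nat.totient W : ℝ) / W = 1 / C := by rw [hC, one_div_div]
  have hlog : ∀ᶠ R in atTop, W + 1 / C ≤ ε * (1 / C) * Real.log R :=
    (Real.tendsto_log_atTop.const_mul_atTop (by positivity)).eventually_ge_atTop _
  obtain ⟨R₁, hR₁⟩ := eventually_atTop.1 (hlog.and (eventually_gt_atTop 1))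
  refine ⟨R₁, fun R hR => ?_⟩
  obtain ⟨h1, hR1⟩ := hR₁ R hR
  have hlogR : 0 < Real.log R := Real.log_pos hR1
  have hPp : ∀ p ∈ primesIn w ⌊R⌋₊, p.Prime := fun p hp => prime_of_mem_primesIn hp
  have h2 := sq_le_dilSum_mul_sieveEnergy hPp (fun y hy => truncLog_of_lt hy) R
  rw [truncLog_of_le hR1.le] at h2
  have h3 := dilSum_totient_le hPp R (by linarith)
  have h4 := dilSum_one_div_le_coprimeHarmonic w ⌊R⌋₊ R
  have h5 := coprimeHarmonic_le (primorial_pos w) hR1.le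
  rw [← hW, hCφ] at h5
  set Q := ∏ p ∈ primesIn w ⌊R⌋₊, (1 + 2 / (p : ℝ) ^ 2) with hQ
  have hQ0 : 0 ≤ Q := Finset.prod_nonneg fun p _ => by positivity
  have hS0 : 0 ≤ sieveEnergy (primesIn w ⌊R⌋₊) truncLog R := sieveEnergy_nonneg
  set S := sieveEnergy (primesIn w ⌊R⌋₊) truncLog R
  have h6 : dilSum (fun p => 1 / ((p : ℝ) - 1)) (primesIn w ⌊R⌋₊) cutoff R ≤
      Q * ((1 + ε) * (1 / C) * Real.log R) := by
    refine h3.trans ?_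
    gcongr
    linarith
  have h7 : Real.log R ^ 2 ≤ Q * ((1 + ε) * (1 / C) * Real.log R) * S :=
    h2.trans (by gcongr)
  have h8 : Real.log R * Real.log R ≤ Real.log R * ((1 + ε) * Q * S / C) := by
    calc _ = Real.log R ^ 2 := by ring
      _ ≤ _ := h7
      _ = _ := by ring
  have h9 := le_of_mul_le_mul_left h8 hlogR
  rw [le_div_iff₀ hC0] at h9
  linarith

lemma prod_one_add_div_sq_le {K : ℝ} (hK : 0 ≤ K) {w : ℕ} (hw : 0 < w) (N : ℕ) :
    ∏ p ∈ primesIn w N, (1 + K / (p : ℝ) ^ 2) ≤ Real.exp (K / w) := by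
  rcases le_or_gt w N with hwN | hwN
  · calc _ ≤ ∏ p ∈ primesIn w N, Real.exp (K / (p : ℝ) ^ 2) := by
          refine Finset.prod_le_prod (fun p _ => by positivity) fun p _ => ?_
          rw [add_comm]; exact Real.add_one_le_exp _
      _ = Real.exp (∑ p ∈ primesIn w N, K / (p : ℝ) ^ 2) := (Real.exp_sum _ _).symm
      _ ≤ Real.exp (K / w) := by
          rw [Real.exp_le_exp]
          calc _ ≤ ∑ p ∈ Finset.Ioc w N, K / (p : ℝ) ^ 2 :=
                Finset.sum_le_sum_of_subset_of_nonneg (Finset.filter_subset _ _)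
                  fun _ _ _ => by positivity
            _ = K * ∑ p ∈ Finset.Ioc w N, ((p : ℝ) ^ 2)⁻¹ := by
                rw [Finset.mul_sum]; rfl
            _ ≤ K * ((w : ℝ)⁻¹ - (N : ℝ)⁻¹) := by
                gcongr
                exact sum_Ioc_inv_sq_le_sub hw.ne' hwN
            _ ≤ K * (w : ℝ)⁻¹ := by
                gcongr
                have : (0 : ℝ) ≤ (N : ℝ)⁻¹ := by positivity
                linarith
            _ = K / w := rfl
  · have : primesIn w N = ∅ := by
      rw [primesIn, Finset.Ioc_eq_empty (by omega), Finset.filter_empty]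
    rw [this, Finset.prod_empty]
    exact Real.one_le_exp (by positivity)

end SieveEnergyAsymptotics

/-! ### Comparison of a model with independent columns -/

section ModelComparison

variable {m : ℕ}

/-- The set of indices `i` with `p ∈ D i`. -/
def column (D : Fin m → Finset ℕ) (p : ℕ) : Finset (Fin m) := Finset.univ.filter fun i => p ∈ D i

/-- The mean of `F D` over random families `D` of subsets of `P`, where the columns of `D` at the
elements `p` of `P` are independent and distributed according to `law p`. -/
noncomputable def modelMean (P : Finset ℕ) (law : ℕ → Finset (Fin m) → ℝ)
    (F : (Fin m → Finset ℕ) → ℝ) : ℝ :=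
  ∑ D ∈ Fintype.piFinset (fun _ : Fin m => P.powerset), (∏ p ∈ P, law p (column D p)) * F D

/-- The law of a random subset of `Fin m` which contains each index independently with
probability `a`. -/
noncomputable def bernoulliLaw (a : ℝ) (A : Finset (Fin m)) : ℝ :=
  ∏ i, if i ∈ A then a else 1 - a

lemma bernoulliLaw_nonneg {a : ℝ} (h0 : 0 ≤ a) (h1 : a ≤ 1) (A : Finset (Fin m)) :
    0 ≤ bernoulliLaw a A :=
  Finset.prod_nonneg fun i _ => by split_ifs <;> linarith

/-- A random set with law `bernoulliLaw a` contains `T` with probability `a ^ T.card`. -/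
lemma sum_bernoulliLaw_superset (a : ℝ) (T : Finset (Fin m)) :
    ∑ A with T ⊆ A, bernoulliLaw a A = a ^ T.card := by
  have h1 : ∀ A : Finset (Fin m), (if T ⊆ A then bernoulliLaw a A else 0) =
      (∏ i ∈ A, a) * ∏ i ∈ Finset.univ \ A, (if i ∈ T then 0 else 1 - a) := by
    intro A
    split_ifs with h
    · rw [bernoulliLaw, Finset.prod_ite, Finset.filter_mem_eq_inter, Finset.univ_inter,
        Finset.filter_not, Finset.filter_mem_eq_inter, Finset.univ_inter]
      congr 1
      refine Finset.prod_congr rfl fun i hi => ?_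
      rw [if_neg fun hT => (Finset.mem_sdiff.1 hi).2 (h hT)]
    · obtain ⟨i, hiT, hiA⟩ := Finset.not_subset.1 h
      have hz : ∏ i ∈ Finset.univ \ A, (if i ∈ T then 0 else 1 - a) = 0 :=
        Finset.prod_eq_zero (i := i) (by simp [hiA]) (by simp [hiT])
      rw [hz, mul_zero]
  rw [Finset.sum_filter, Finset.sum_congr rfl fun A _ => h1 A, ← Finset.powerset_univ,
    ← Finset.prod_add]
  have h2 : ∀ i : Fin m, (a + if i ∈ T then 0 else 1 - a) = if i ∈ T then a else 1 := by
    intro i; split_ifs <;> ring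
  simp_rw [h2]
  rw [Finset.prod_ite_mem, Finset.univ_inter, Finset.prod_const]

/-- Two laws on subsets of `Fin m` with the same one-point marginals and small two-point marginals
are close to each other. -/
lemma abs_law_sub_law_le {l l' : Finset (Fin m) → ℝ} {δ : ℝ}
    (h0 : ∀ A, 0 ≤ l A) (h0' : ∀ A, 0 ≤ l' A) (hsum : ∑ A, l A = ∑ A, l' A)
    (h1 : ∀ i, ∑ A with i ∈ A, l A = ∑ A with i ∈ A, l' A)
    (h2 : ∀ i j, i ≠ j → ∑ A with i ∈ A ∧ j ∈ A, l A ≤ δ)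
    (h2' : ∀ i j, i ≠ j → ∑ A with i ∈ A ∧ j ∈ A, l' A ≤ δ) (hδ : 0 ≤ δ) (A : Finset (Fin m)) :
    |l A - l' A| ≤ 4 ^ m * δ := by
  have hm1 : (1 : ℝ) ≤ 2 ^ m := one_le_pow₀ (by norm_num)
  have h4 : (4 : ℝ) ^ m = 2 ^ m * 2 ^ m := by rw [← mul_pow]; norm_num
  have hcard : (Fintype.card (Finset (Fin m)) : ℝ) = 2 ^ m := by simp
  have big : ∀ A : Finset (Fin m), 1 < A.card → |l A - l' A| ≤ δ := by
    intro A hA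
    obtain ⟨i, hi, j, hj, hij⟩ := Finset.one_lt_card.1 hA
    have e1 : l A ≤ δ :=
      (Finset.single_le_sum (fun B _ => h0 B) (by simp [hi, hj])).trans (h2 i j hij)
    have e2 : l' A ≤ δ :=
      (Finset.single_le_sum (fun B _ => h0' B) (by simp [hi, hj])).trans (h2' i j hij)
    rw [abs_le]
    constructor <;> linarith [h0 A, h0' A]
  have bound : ∀ (s : Finset (Finset (Fin m))) (c : ℝ), 0 ≤ c → (∀ B ∈ s, |l B - l' B| ≤ c) →
      |∑ B ∈ s, (l B - l' B)| ≤ 2 ^ m * c := by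
    intro s c hc hs
    refine (Finset.abs_sum_le_sum_abs _ _).trans ((Finset.sum_le_card_nsmul _ _ _ hs).trans ?_)
    rw [nsmul_eq_mul, ← hcard]
    gcongr
    exact s.card_le_univ
  have single : ∀ i : Fin m, |l {i} - l' {i}| ≤ 2 ^ m * δ := by
    intro i
    have e : ∑ B ∈ (Finset.univ.filter fun A : Finset (Fin m) => i ∈ A), (l B - l' B) = 0 := by
      rw [Finset.sum_sub_distrib, h1, sub_self]
    rw [← Finset.add_sum_erase _ _ (show ({i} : Finset (Fin m)) ∈
      Finset.univ.filter fun A : Finset (Fin m) => i ∈ A by simp)] at e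
    rw [eq_neg_of_add_eq_zero_left e, abs_neg]
    refine bound _ _ hδ fun B hB => big B ?_
    simp only [Finset.mem_erase, Finset.mem_filter, Finset.mem_univ, true_and] at hB
    by_contra h
    have hpos : 0 < B.card := Finset.card_pos.2 ⟨i, hB.2⟩
    obtain ⟨j, hj⟩ := Finset.card_eq_one.1 (by omega : B.card = 1)
    have := hB.2
    rw [hj, Finset.mem_singleton] at this
    exact hB.1 (by rw [hj, this])
  have nonempty : ∀ B : Finset (Fin m), B ≠ ∅ → |l B - l' B| ≤ 2 ^ m * δ := by
    intro B hB
    have hpos : 0 < B.card := Finset.card_pos.2 (Finset.nonempty_iff_ne_empty.2 hB)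
    rcases (by omega : B.card = 1 ∨ 1 < B.card) with h | h
    · obtain ⟨j, rfl⟩ := Finset.card_eq_one.1 h
      exact single j
    · exact (big B h).trans (le_mul_of_one_le_left hδ hm1)
  rcases eq_or_ne A ∅ with rfl | hA
  · have e : ∑ B, (l B - l' B) = 0 := by rw [Finset.sum_sub_distrib, hsum, sub_self]
    rw [← Finset.add_sum_erase _ _ (Finset.mem_univ ∅)] at e
    rw [eq_neg_of_add_eq_zero_left e, abs_neg, h4, mul_assoc]
    exact bound _ _ (by positivity) fun B hB => nonempty B (Finset.ne_of_mem_erase hB)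
  · refine (nonempty A hA).trans ?_
    rw [h4, mul_assoc]
    exact le_mul_of_one_le_left (by positivity) hm1

/-- Under independent Bernoulli columns the rows are independent as well. -/
lemma sum_prod_bernoulliLaw (P Q : Finset ℕ) (g : Finset ℕ → ℝ) :
    ∑ D ∈ Fintype.piFinset (fun _ : Fin m => P.powerset),
      (∏ p ∈ Q, bernoulliLaw (1 / (p : ℝ)) (column D p)) * ∏ i, g (D i) =
    (∑ D ∈ P.powerset, (∏ p ∈ Q, if p ∈ D then 1 / (p : ℝ) else 1 - 1 / p) * g D) ^ m := by
  have h := Finset.prod_univ_sum (fun _ : Fin m => P.powerset)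
    (fun _ D => (∏ p ∈ Q, if p ∈ D then 1 / (p : ℝ) else 1 - 1 / p) * g D)
  rw [Finset.prod_const, Finset.card_univ, Fintype.card_fin] at h
  rw [h]
  refine Finset.sum_congr rfl fun D _ => ?_
  rw [Finset.prod_mul_distrib, Finset.prod_comm]
  congr 1
  refine Finset.prod_congr rfl fun p _ => ?_
  rw [bernoulliLaw]
  refine Finset.prod_congr rfl fun i _ => ?_
  simp [column]

/-- Comparison of the mean of a product of squares with the product of the means. The difference of
the laws is expanded over the set `E` of primes at which they differ. -/
theorem abs_modelMean_sub_pow_le {P : Finset ℕ} (hP : ∀ p ∈ P, p.Prime)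
    {law : ℕ → Finset (Fin m) → ℝ} {K : ℝ} (hK : 0 ≤ K)
    (hlaw : ∀ p ∈ P, ∀ A, |law p A - bernoulliLaw (1 / (p : ℝ)) A| ≤ K / (p : ℝ) ^ 2)
    {f : ℝ → ℝ} {M x : ℝ} (hx : 0 ≤ x) (hM : ∀ y, y ≤ x → sieveEnergy P f y ≤ M) :
    |modelMean P law (fun D => ∏ i, diffOp (D i) f x ^ 2) - sieveEnergy P f x ^ m| ≤
      (∏ p ∈ P, (1 + 10 ^ m * K / (p : ℝ) ^ 2) - 1) * M ^ m := by
  set Ω := Fintype.piFinset (fun _ : Fin m => P.powerset) with hΩ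
  set F : (Fin m → Finset ℕ) → ℝ := fun D => ∏ i, diffOp (D i) f x ^ 2 with hF
  have hF0 : ∀ D, 0 ≤ F D := fun D => Finset.prod_nonneg fun i _ => sq_nonneg _
  set b : ℕ → Finset (Fin m) → ℝ := fun p => bernoulliLaw (1 / (p : ℝ)) with hb
  have hb0 : ∀ p A, 0 ≤ b p A := by
    intro p A
    refine bernoulliLaw_nonneg (by positivity) ?_ A
    linarith [one_sub_one_div_nonneg p]
  -- the contribution of the differences of the laws at `E` and the independent laws elsewhere
  set T : Finset ℕ → ℝ := fun E => ∑ D ∈ Ω, (∏ p ∈ E, (law p (column D p) - b p (column D p))) *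
    (∏ p ∈ P \ E, b p (column D p)) * F D with hT
  have hexp : modelMean P law F = ∑ E ∈ P.powerset, T E := by
    rw [modelMean, hT, Finset.sum_comm]
    refine Finset.sum_congr rfl fun D _ => ?_
    rw [← Finset.sum_mul, ← Finset.prod_add]
    simp
  have hweight : ∀ E ⊆ P, ∑ D ∈ P.powerset,
      (∏ p ∈ P \ E, if p ∈ D then 1 / (p : ℝ) else 1 - 1 / p) * diffOp D f x ^ 2 =
      diffEnergy (fun p => if p ∈ E then 1 else 1 / (p : ℝ))
        (fun p => if p ∈ E then 1 else 1 - 1 / (p : ℝ)) P f x := by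
    intro E hE
    refine Finset.sum_congr rfl fun D _ => ?_
    rw [subsetWeight, ← Finset.prod_sdiff hE]
    have h1 : ∏ p ∈ E, (if p ∈ D then if p ∈ E then (1 : ℝ) else 1 / (p : ℝ)
        else if p ∈ E then 1 else 1 - 1 / (p : ℝ)) = 1 :=
      Finset.prod_eq_one fun p hp => by simp [hp]
    rw [h1, mul_one]
    congr 1
    refine Finset.prod_congr rfl fun p hp => ?_
    simp [(Finset.mem_sdiff.1 hp).2]
  have hempty : T ∅ = sieveEnergy P f x ^ m := by
    have h1 := sum_prod_bernoulliLaw (m := m) P (P \ ∅) (fun D => diffOp D f x ^ 2)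
    rw [hweight ∅ (Finset.empty_subset _)] at h1
    simp only [Finset.notMem_empty, if_false] at h1
    rw [sieveEnergy, ← h1, hT]
    simp [hb, hF, hΩ]
  have hTE : ∀ E ∈ P.powerset, |T E| ≤ (∏ p ∈ E, 10 ^ m * K / (p : ℝ) ^ 2) * M ^ m := by
    intro E hE
    rw [Finset.mem_powerset] at hE
    have hnn : 0 ≤ diffEnergy (fun p => if p ∈ E then 1 else 1 / (p : ℝ))
        (fun p => if p ∈ E then 1 else 1 - 1 / (p : ℝ)) P f x := by
      rw [← hweight E hE]
      refine Finset.sum_nonneg fun D _ =>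
        mul_nonneg (Finset.prod_nonneg fun p _ => ?_) (sq_nonneg _)
      split_ifs
      · positivity
      · exact one_sub_one_div_nonneg p
    calc |T E| ≤ ∑ D ∈ Ω, (∏ p ∈ E, K / (p : ℝ) ^ 2) * ((∏ p ∈ P \ E, b p (column D p)) * F D) := by
          refine (Finset.abs_sum_le_sum_abs _ _).trans (Finset.sum_le_sum fun D _ => ?_)
          have h1 : 0 ≤ (∏ p ∈ P \ E, b p (column D p)) * F D :=
            mul_nonneg (Finset.prod_nonneg fun p _ => hb0 _ _) (hF0 D)
          rw [mul_assoc, abs_mul, abs_of_nonneg h1, Finset.abs_prod]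
          refine mul_le_mul_of_nonneg_right ?_ h1
          exact Finset.prod_le_prod (fun p _ => abs_nonneg _) fun p hp => hlaw p (hE hp) _
      _ = (∏ p ∈ E, K / (p : ℝ) ^ 2) * diffEnergy (fun p => if p ∈ E then 1 else 1 / (p : ℝ))
            (fun p => if p ∈ E then 1 else 1 - 1 / (p : ℝ)) P f x ^ m := by
          rw [← Finset.mul_sum, ← hweight E hE, ← sum_prod_bernoulliLaw]
      _ ≤ (∏ p ∈ E, K / (p : ℝ) ^ 2) * (10 ^ E.card * M) ^ m := by
          gcongr
          exact diffEnergy_one_on_le hP hE x hx fun y _ hy => hM y hy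
      _ = _ := by
          rw [mul_pow, ← pow_mul, mul_comm E.card m, pow_mul, ← mul_assoc, ← Finset.prod_const,
            ← Finset.prod_mul_distrib]
          congr 2
          ext p; ring
  have hprod : ∏ p ∈ P, (1 + 10 ^ m * K / (p : ℝ) ^ 2) =
      ∑ E ∈ P.powerset, ∏ p ∈ E, 10 ^ m * K / (p : ℝ) ^ 2 := by
    simp_rw [add_comm (1 : ℝ)]
    rw [Finset.prod_add]
    simp
  have hmem : (∅ : Finset ℕ) ∈ P.powerset := Finset.empty_mem_powerset P
  rw [hexp, hprod, ← hempty, ← Finset.add_sum_erase _ _ hmem,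
    ← Finset.add_sum_erase _ (fun E : Finset ℕ => ∏ p ∈ E, 10 ^ m * K / (p : ℝ) ^ 2) hmem,
    Finset.prod_empty, add_sub_cancel_left, add_sub_cancel_left, Finset.sum_mul]
  exact (Finset.abs_sum_le_sum_abs _ _).trans
    (Finset.sum_le_sum fun E hE => hTE E (Finset.mem_of_mem_erase hE))

end ModelComparison

/-! ### Densities in boxes and local laws -/

lemma natCard_setOf {α : Type*} [Fintype α] (q : α → Prop) [DecidablePred q] :
    Nat.card {y : α | q y} = (Finset.univ.filter q).card :=
  Nat.subtype_card (Finset.univ.filter q) (by simp)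

section BoxDensities

variable {t : ℕ}

lemma card_Ico_residue_bounds {M : ℕ} [NeZero M] {a b : ℤ} (hab : a ≤ b) (r : ZMod M) :
    |(((Finset.Ico a b).filter (fun k : ℤ => (k : ZMod M) = r)).card : ℝ) - (b - a) / M| ≤ 1 := by
  have hM : (0 : ℝ) < M := by exact_mod_cast NeZero.pos M
  have hM' : (0 : ℤ) < M := by exact_mod_cast NeZero.pos M
  obtain ⟨v, rfl⟩ := ZMod.intCast_surjective r
  have h1 : (Finset.Ico a b).filter (fun k : ℤ => (k : ZMod M) = v) =
      (Finset.Ico a b).filter (fun k : ℤ => k ≡ v [ZMOD M]) :=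
    Finset.filter_congr fun k _ => ZMod.intCast_eq_intCast_iff k v M
  have h2 := Int.Ico_filter_modEq_card a b hM' v
  rw [h1]
  set X : ℚ := ((b : ℚ) - v) / (M : ℤ) with hX
  set Y : ℚ := ((a : ℚ) - v) / (M : ℤ) with hY
  have hMq : (0 : ℚ) < (M : ℤ) := by exact_mod_cast hM'
  have hYX : Y ≤ X := by
    rw [hX, hY]
    gcongr
  rw [max_eq_left (by have := Int.ceil_mono hYX; omega)] at h2
  have h3 : (((Finset.Ico a b).filter (fun k : ℤ => k ≡ v [ZMOD M])).card : ℚ) = ⌈X⌉ - ⌈Y⌉ := by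
    exact_mod_cast h2
  have h4 : |(((Finset.Ico a b).filter (fun k : ℤ => k ≡ v [ZMOD M])).card : ℚ) - (b - a) / M| ≤
      1 := by
    have e : ((b : ℚ) - a) / M = X - Y := by rw [hX, hY]; push_cast; ring
    rw [h3, e, abs_le]
    have := Int.le_ceil X
    have := Int.ceil_lt_add_one X
    have := Int.le_ceil Y
    have := Int.ceil_lt_add_one Y
    constructor <;> linarith
  exact_mod_cast h4

/-- The proportion of points of a box with prescribed residues modulo `M`. -/
lemma abs_box_density_sub_le {M : ℕ} [NeZero M] {a b : Fin t → ℤ} {κ : ℝ}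
    (hab : ∀ j, a j < b j) (hM : ∀ j, (M : ℝ) ≤ κ * (b j - a j)) (hκ : t * κ ≤ 1)
    (S : Finset (Fin t → ZMod M)) :
    |(((Fintype.piFinset fun j => Finset.Ico (a j) (b j)).filter
        (fun x => (fun j => (x j : ZMod M)) ∈ S)).card : ℝ) /
      (Fintype.piFinset fun j => Finset.Ico (a j) (b j)).card - S.card / (M : ℝ) ^ t| ≤
      2 * (t * κ) := by
  classical
  have hM0 : (0 : ℝ) < M := by exact_mod_cast NeZero.pos M
  set B := Fintype.piFinset fun j => Finset.Ico (a j) (b j) with hB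
  set n : Fin t → ℝ := fun j => (b j : ℝ) - a j with hn
  have hn0 : ∀ j, 0 < n j := fun j => by
    have : (a j : ℝ) < b j := by exact_mod_cast hab j
    rw [hn]; simp only; linarith
  have hκ0 : 0 ≤ t * κ := by
    rcases Nat.eq_zero_or_pos t with rfl | ht
    · simp
    · have h1 := hM ⟨0, ht⟩
      have h2 := hn0 ⟨0, ht⟩
      rw [hn] at h2
      simp only at h2
      have : 0 ≤ κ := by
        by_contra h
        nlinarith
      positivity
  have hBcard : (B.card : ℝ) = ∏ j, n j := by
    rw [hB, Fintype.card_piFinset, Nat.cast_prod]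
    refine Finset.prod_congr rfl fun j _ => ?_
    rw [Int.card_Ico, hn]
    have : (((b j - a j).toNat : ℤ) : ℝ) = ((b j - a j : ℤ) : ℝ) := by
      rw [Int.toNat_of_nonneg (by have := hab j; omega)]
    push_cast at this
    exact this
  set cnt : (j : Fin t) → ZMod M → ℕ := fun j r =>
    ((Finset.Ico (a j) (b j)).filter (fun k : ℤ => (k : ZMod M) = r)).card with hcnt
  have hcount : ((B.filter (fun x => (fun j => (x j : ZMod M)) ∈ S)).card : ℝ) =
      ∑ r ∈ S, ∏ j, (cnt j (r j) : ℝ) := by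
    have h1 : (B.filter (fun x => (fun j => (x j : ZMod M)) ∈ S)).card =
        ∑ r ∈ S, (B.filter (fun x => (fun j => (x j : ZMod M)) = r)).card := by
      rw [Finset.card_eq_sum_card_fiberwise (f := fun x j => (x j : ZMod M)) (t := S)]
      · refine Finset.sum_congr rfl fun r hr => ?_
        congr 1
        ext x
        simp only [Finset.mem_filter]
        constructor
        · rintro ⟨⟨h1, h2⟩, h3⟩; exact ⟨h1, h3⟩
        · rintro ⟨h1, h3⟩; exact ⟨⟨h1, h3 ▸ hr⟩, h3⟩
      · intro x hx
        exact (Finset.mem_filter.1 (Finset.mem_coe.1 hx)).2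
    rw [h1, Nat.cast_sum]
    refine Finset.sum_congr rfl fun r _ => ?_
    rw [← Nat.cast_prod, hcnt, ← Fintype.card_piFinset]
    congr 2
    ext x
    simp only [hB, Finset.mem_filter, Fintype.mem_piFinset, funext_iff]
    exact ⟨fun h j => ⟨h.1 j, h.2 j⟩, fun h => ⟨fun j => (h j).1, fun j => (h j).2⟩⟩
  have hterm : ∀ r ∈ S, |(∏ j, (cnt j (r j) : ℝ)) / B.card - 1 / (M : ℝ) ^ t| ≤
      1 / (M : ℝ) ^ t * (2 * (t * κ)) := by
    intro r _
    have h1 : (∏ j, (cnt j (r j) : ℝ)) / B.card - 1 / (M : ℝ) ^ t =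
        1 / (M : ℝ) ^ t * (∏ j, (1 + ((cnt j (r j) : ℝ) * M / n j - 1)) - 1) := by
      rw [hBcard, ← Finset.prod_div_distrib]
      simp_rw [add_sub_cancel]
      have : ∏ j, (cnt j (r j) : ℝ) * M / n j = (∏ j, (cnt j (r j) : ℝ) / n j) * (M : ℝ) ^ t := by
        simp_rw [mul_div_right_comm]
        rw [Finset.prod_mul_distrib, Finset.prod_const, Finset.card_univ, Fintype.card_fin]
      rw [this]
      field_simp
    have h2 : ∀ j, |(cnt j (r j) : ℝ) * M / n j - 1| ≤ κ := by
      intro j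
      have h3 := card_Ico_residue_bounds (hab j).le (r j)
      have h4 : (cnt j (r j) : ℝ) * M / n j - 1 = ((cnt j (r j) : ℝ) - n j / M) * (M / n j) := by
        have := (hn0 j).ne'
        field_simp
      rw [h4, abs_mul, abs_of_nonneg (by have := (hn0 j).le; positivity : 0 ≤ M / n j)]
      calc _ ≤ 1 * (M / n j) := by
            have := (hn0 j).le
            gcongr
        _ ≤ κ := by
            rw [one_mul, div_le_iff₀ (hn0 j)]
            exact hM j
    have h5 : |∏ j, (1 + ((cnt j (r j) : ℝ) * M / n j - 1)) - 1| ≤ 2 * (t * κ) := by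
      have h6 := Finset.norm_prod_one_add_sub_one_le Finset.univ
        (fun j => (cnt j (r j) : ℝ) * M / n j - 1)
      rw [Real.norm_eq_abs] at h6
      refine h6.trans ?_
      have h7 : ∑ j, ‖(cnt j (r j) : ℝ) * M / n j - 1‖ ≤ t * κ := by
        refine (Finset.sum_le_card_nsmul _ _ κ fun j _ => h2 j).trans (le_of_eq ?_)
        simp
      have h8 := Real.abs_exp_sub_one_le (x := t * κ) (by rwa [abs_of_nonneg hκ0])
      rw [abs_of_nonneg hκ0] at h8
      have h9 := Real.exp_le_exp.2 h7
      linarith [le_abs_self (Real.exp (t * κ) - 1)]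
    rw [h1, abs_mul, abs_of_nonneg (by positivity : 0 ≤ 1 / (M : ℝ) ^ t)]
    gcongr
  have hS : (S.card : ℝ) ≤ (M : ℝ) ^ t := by
    have h := S.card_le_univ
    rw [Fintype.card_fun, ZMod.card, Fintype.card_fin] at h
    exact_mod_cast h
  rw [hcount, Finset.sum_div]
  calc _ = |∑ r ∈ S, ((∏ j, (cnt j (r j) : ℝ)) / B.card - 1 / (M : ℝ) ^ t)| := by
        rw [Finset.sum_sub_distrib, Finset.sum_const, nsmul_eq_mul]
        congr 2; ring
    _ ≤ ∑ r ∈ S, 1 / (M : ℝ) ^ t * (2 * (t * κ)) :=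
        (Finset.abs_sum_le_sum_abs _ _).trans (Finset.sum_le_sum hterm)
    _ = S.card / (M : ℝ) ^ t * (2 * (t * κ)) := by rw [Finset.sum_const, nsmul_eq_mul]; ring
    _ ≤ 1 * (2 * (t * κ)) := by
        gcongr
        exact (div_le_one (by positivity)).2 hS
    _ = _ := one_mul _

/-- The proportion of points of a box satisfying congruence conditions modulo each prime of `U` is
close to the product of the local densities, by the Chinese remainder theorem. -/
theorem abs_box_density_sub_prod_le {U : Finset ℕ} (hU : ∀ p ∈ U, p.Prime) {a b : Fin t → ℤ}
    {κ : ℝ} (hab : ∀ j, a j < b j) (hM : ∀ j, ((∏ p ∈ U, p : ℕ) : ℝ) ≤ κ * (b j - a j))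
    (hκ : t * κ ≤ 1) (𝒜 : (p : ℕ) → Set (Fin t → ZMod p))
    [∀ p, DecidablePred (· ∈ 𝒜 p)] :
    |(((Fintype.piFinset fun j => Finset.Ico (a j) (b j)).filter
        (fun x => ∀ p ∈ U, (fun j => (x j : ZMod p)) ∈ 𝒜 p)).card : ℝ) /
      (Fintype.piFinset fun j => Finset.Ico (a j) (b j)).card -
      ∏ p ∈ U, (Nat.card (𝒜 p) : ℝ) / (p : ℝ) ^ t| ≤ 2 * (t * κ) := by
  rw [← Finset.prod_coe_sort U (fun p => p)] at hM
  set M : ℕ := ∏ p : U, (p : ℕ) with hMdef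
  have hM0 : M ≠ 0 := Finset.prod_ne_zero_iff.2 fun p _ => (hU p p.2).ne_zero
  have : NeZero M := ⟨hM0⟩
  have hcop : Pairwise (Function.onFun Nat.Coprime (fun p : U => (p : ℕ))) := fun p q hpq =>
    (Nat.coprime_primes (hU p p.2) (hU q q.2)).2 fun h => hpq (Subtype.ext h)
  let e : ZMod M ≃+* ((p : U) → ZMod p) := ZMod.prodEquivPi (fun p : U => (p : ℕ)) hcop
  set S : Finset (Fin t → ZMod M) :=
    Finset.univ.filter fun r => ∀ p : U, (fun j => e (r j) p) ∈ 𝒜 p with hS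
  have h := abs_box_density_sub_le hab hM hκ S
  have h1 : (Fintype.piFinset fun j => Finset.Ico (a j) (b j)).filter
      (fun x => ∀ p ∈ U, (fun j => (x j : ZMod p)) ∈ 𝒜 p) =
      (Fintype.piFinset fun j => Finset.Ico (a j) (b j)).filter
        (fun x => (fun j => (x j : ZMod M)) ∈ S) := by
    refine Finset.filter_congr fun x _ => ?_
    simp only [hS, Finset.mem_filter, Finset.mem_univ, true_and, map_intCast, Pi.intCast_apply,
      Subtype.forall]
  have h2 : (S.card : ℝ) / (M : ℝ) ^ t = ∏ p ∈ U, (Nat.card (𝒜 p) : ℝ) / (p : ℝ) ^ t := by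
    have h3 : S.card = ∏ p : U, Nat.card (𝒜 p) := by
      rw [← Nat.card_pi, ← natCard_setOf]
      exact Nat.card_congr
        { toFun := fun r p => ⟨fun j => e (r.1 j) p, r.2 p⟩
          invFun := fun y => ⟨fun j => e.symm fun p => (y p).1 j, fun p => by
            simp⟩
          left_inv := fun r => Subtype.ext (funext fun j => by simp)
          right_inv := fun y => funext fun p => Subtype.ext (funext fun j => by simp) }
    rw [h3, Finset.prod_div_distrib, Finset.prod_pow, hMdef,
      ← Finset.prod_coe_sort U (fun p => (Nat.card (𝒜 p) : ℝ)),
      ← Finset.prod_coe_sort U (fun p => (p : ℝ))]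
    push_cast
    rfl
  rw [h1, ← h2]
  exact h

/-- The integers in an interval of length `ℓ` form a half-open integer interval with at least
`ℓ - 1` elements. -/
lemma exists_Ico_eq_of_interval {I : Set ℝ} {lo hi : ℝ} (hI : IsIntervalWithEndpoints I lo hi) :
    ∃ a b : ℤ, (∀ k : ℤ, (k : ℝ) ∈ I ↔ k ∈ Finset.Ico a b) ∧ hi - lo - 1 ≤ (b : ℝ) - a := by
  classical
  refine ⟨if lo ∈ I then ⌈lo⌉ else ⌊lo⌋ + 1, if hi ∈ I then ⌊hi⌋ + 1 else ⌈hi⌉, ?_, ?_⟩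
  · intro k
    rw [Finset.mem_Ico]
    have hlo : (if lo ∈ I then ⌈lo⌉ else ⌊lo⌋ + 1) ≤ k ↔
        lo < k ∨ (lo = k ∧ lo ∈ I) := by
      split_ifs with h
      · rw [Int.ceil_le]; simp only [h, and_true]; exact le_iff_lt_or_eq
      · rw [Int.add_one_le_iff, Int.floor_lt]; simp [h]
    have hhi : k < (if hi ∈ I then ⌊hi⌋ + 1 else ⌈hi⌉) ↔
        (k : ℝ) < hi ∨ ((k : ℝ) = hi ∧ hi ∈ I) := by
      split_ifs with h
      · rw [Int.lt_add_one_iff, Int.le_floor]; simp only [h, and_true]; exact le_iff_lt_or_eq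
      · rw [Int.lt_ceil]; simp [h]
    rw [hlo, hhi]
    constructor
    · intro hk
      have h1 := hI.2 hk
      constructor
      · rcases h1.1.lt_or_eq with h | h
        · exact Or.inl h
        · exact Or.inr ⟨h, h ▸ hk⟩
      · rcases h1.2.lt_or_eq with h | h
        · exact Or.inl h
        · exact Or.inr ⟨h, h ▸ hk⟩
    · rintro ⟨h1 | ⟨h1, h1'⟩, h2 | ⟨h2, h2'⟩⟩
      · exact hI.1 ⟨h1, h2⟩
      · exact h2 ▸ h2'
      · exact h1 ▸ h1'
      · exact h1 ▸ h1'
  · have h1 : ((if lo ∈ I then ⌈lo⌉ else ⌊lo⌋ + 1 : ℤ) : ℝ) ≤ lo + 1 := by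
      split_ifs
      · exact (Int.ceil_lt_add_one lo).le
      · push_cast; linarith [Int.floor_le lo]
    have h2 : hi ≤ ((if hi ∈ I then ⌊hi⌋ + 1 else ⌈hi⌉ : ℤ) : ℝ) := by
      split_ifs
      · push_cast; exact (Int.lt_floor_add_one hi).le
      · exact Int.le_ceil hi
    linarith

end BoxDensities

section LocalLaw

variable {m t : ℕ}

/-- The form `W ψ_i + 1` on vectors of residues modulo `p`. -/
def residueForm (W : ℕ) (L : Fin m → Fin t → ℤ) (b : Fin m → ℤ) (p : ℕ) (i : Fin m)
    (y : Fin t → ZMod p) : ZMod p := (W : ZMod p) * (∑ j, (L i j : ZMod p) * y j + b i) + 1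

lemma residueForm_intCast (W : ℕ) (L : Fin m → Fin t → ℤ) (b : Fin m → ℤ) (p : ℕ) (i : Fin m)
    (x : Fin t → ℤ) : residueForm W L b p i (fun j => (x j : ZMod p)) =
      (((W : ℤ) * affineForm (L i) (b i) x + 1 : ℤ) : ZMod p) := by
  rw [residueForm, affineForm]; push_cast; rfl

open scoped Classical in
/-- The indices of the forms which vanish at a vector of residues. -/
noncomputable def zeroIndices (W : ℕ) (L : Fin m → Fin t → ℤ) (b : Fin m → ℤ) (p : ℕ)
    (y : Fin t → ZMod p) : Finset (Fin m) :=
  Finset.univ.filter fun i => residueForm W L b p i y = 0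

/-- The law of the set of indices of the forms divisible by `p`. -/
noncomputable def localLaw (W : ℕ) (L : Fin m → Fin t → ℤ) (b : Fin m → ℤ) (p : ℕ)
    (A : Finset (Fin m)) : ℝ :=
  (Nat.card {y : Fin t → ZMod p | zeroIndices W L b p y = A} : ℝ) / (p : ℝ) ^ t

variable {W : ℕ} {L : Fin m → Fin t → ℤ} {b : Fin m → ℤ} {p : ℕ}

lemma localLaw_nonneg (A : Finset (Fin m)) : 0 ≤ localLaw W L b p A := by
  rw [localLaw]; positivity

lemma sum_localLaw [NeZero p] (𝒮 : Finset (Finset (Fin m))) :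
    ∑ A ∈ 𝒮, localLaw W L b p A =
      (Nat.card {y : Fin t → ZMod p | zeroIndices W L b p y ∈ 𝒮} : ℝ) / (p : ℝ) ^ t := by
  classical
  simp_rw [localLaw]
  rw [← Finset.sum_div, ← Nat.cast_sum]
  congr 2
  simp_rw [natCard_setOf]
  rw [Finset.card_eq_sum_card_fiberwise (f := zeroIndices W L b p) (t := 𝒮)]
  · refine Finset.sum_congr rfl fun A hA => ?_
    congr 1
    ext y
    simp only [Finset.mem_filter, Finset.mem_univ, true_and]
    exact ⟨fun h => ⟨h ▸ hA, h⟩, fun h => h.2⟩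
  · intro y hy
    exact (Finset.mem_filter.1 (Finset.mem_coe.1 hy)).2

lemma sum_localLaw_univ [NeZero p] : ∑ A, localLaw W L b p A = 1 := by
  have hp : (0 : ℝ) < p := by exact_mod_cast NeZero.pos p
  rw [sum_localLaw]
  simp only [Finset.mem_univ, Set.ofPred_true]
  rw [Nat.card_univ, Nat.card_fun, Nat.card_zmod, Nat.card_fin, Nat.cast_pow,
    div_self (by positivity)]

/-- All fibres of a surjective homomorphism of finite groups have the same size. -/
lemma card_fiber_mul_card {G H : Type*} [AddGroup G] [AddGroup H] [Finite G] [Finite H]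
    (f : G →+ H) (hf : Function.Surjective f) (h : H) :
    Nat.card {g : G | f g = h} * Nat.card H = Nat.card G := by
  classical
  have := Fintype.ofFinite G
  have := Fintype.ofFinite H
  have h1 : Fintype.card G = ∑ h' : H, (Finset.univ.filter fun g => f g = h').card :=
    Finset.card_eq_sum_card_fiberwise (f := f) fun _ _ => Finset.mem_coe.2 (Finset.mem_univ _)
  rw [natCard_setOf, Nat.card_eq_fintype_card, Nat.card_eq_fintype_card, h1,
    Finset.sum_congr rfl fun h' _ => AddMonoidHom.card_fiber_eq_of_mem_range f (hf h') (hf h),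
    Finset.sum_const, Finset.card_univ, smul_eq_mul, mul_comm]

/-- The linear part of a form, as a homomorphism on vectors of residues. -/
def linearHom (p : ℕ) (ℓ : Fin t → ℤ) : (Fin t → ZMod p) →+ ZMod p where
  toFun y := ∑ j, (ℓ j : ZMod p) * y j
  map_zero' := by simp
  map_add' y z := by simp [mul_add, Finset.sum_add_distrib]

lemma linearHom_single (ℓ : Fin t → ℤ) (k : Fin t) (c : ZMod p) :
    linearHom p ℓ (Pi.single k c) = ℓ k * c := by
  simp only [linearHom, AddMonoidHom.coe_mk, ZeroHom.coe_mk]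
  rw [Finset.sum_eq_single k]
  · simp
  · intro j _ hj; simp [hj]
  · simp

lemma residueForm_eq_zero_iff [Fact p.Prime] (hW : (W : ZMod p) ≠ 0) (i : Fin m)
    (y : Fin t → ZMod p) :
    residueForm W L b p i y = 0 ↔ linearHom p (L i) y = -(W : ZMod p)⁻¹ - b i := by
  rw [residueForm]
  change (W : ZMod p) * (linearHom p (L i) y + b i) + 1 = 0 ↔ _
  constructor
  · intro h
    have h2 : (W : ZMod p)⁻¹ * ((W : ZMod p) * (linearHom p (L i) y + b i) + 1) = 0 := by
      rw [h, mul_zero]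
    rw [mul_add, inv_mul_cancel_left₀ hW, mul_one] at h2
    linear_combination h2
  · intro h
    rw [h]
    field_simp
    ring

/-- One-point marginals: a form is divisible by `p` with probability `1 / p`. -/
lemma sum_localLaw_one [Fact p.Prime] (hW : (W : ZMod p) ≠ 0) (i : Fin m)
    (hL : ∃ k, (L i k : ZMod p) ≠ 0) :
    ∑ A with i ∈ A, localLaw W L b p A = 1 / (p : ℝ) := by
  have hp : (p : ℝ) ≠ 0 := by exact_mod_cast (Fact.out : p.Prime).ne_zero
  rw [sum_localLaw]
  obtain ⟨k, hk⟩ := hL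
  have hsurj : Function.Surjective (linearHom p (L i)) := fun c =>
    ⟨Pi.single k ((L i k : ZMod p)⁻¹ * c), by rw [linearHom_single, mul_inv_cancel_left₀ hk]⟩
  have h := card_fiber_mul_card _ hsurj (-(W : ZMod p)⁻¹ - b i)
  have hset : {y : Fin t → ZMod p | zeroIndices W L b p y ∈
      (Finset.univ.filter fun A : Finset (Fin m) => i ∈ A)} =
      {y | linearHom p (L i) y = -(W : ZMod p)⁻¹ - b i} := by
    ext y
    simp [zeroIndices, residueForm_eq_zero_iff hW]
  rw [hset]
  rw [Nat.card_fun, Nat.card_zmod, Nat.card_fin] at h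
  have h' : (Nat.card {y | linearHom p (L i) y = -(W : ZMod p)⁻¹ - b i} : ℝ) * p = (p : ℝ) ^ t := by
    exact_mod_cast h
  rw [div_eq_div_iff (by positivity) hp, one_mul]
  exact h'

/-- Two-point marginals: two independent forms are both divisible by `p` with probability
`1 / p ^ 2`. -/
lemma sum_localLaw_two_le [Fact p.Prime] (hW : (W : ZMod p) ≠ 0) (i i' : Fin m)
    (hL : ∃ k l, (L i k : ZMod p) * L i' l - L i l * L i' k ≠ 0) :
    ∑ A with i ∈ A ∧ i' ∈ A, localLaw W L b p A ≤ 1 / (p : ℝ) ^ 2 := by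
  have hp : (p : ℝ) ≠ 0 := by exact_mod_cast (Fact.out : p.Prime).ne_zero
  rw [sum_localLaw]
  obtain ⟨k, l, hkl⟩ := hL
  -- Cramer's rule in the coordinates `k` and `l`
  set Δ := (L i k : ZMod p) * L i' l - L i l * L i' k with hΔ
  have hsurj : Function.Surjective ((linearHom p (L i)).prod (linearHom p (L i'))) := by
    rintro ⟨u, v⟩
    refine ⟨Pi.single k (Δ⁻¹ * (u * L i' l - L i l * v)) +
      Pi.single l (Δ⁻¹ * (L i k * v - L i' k * u)), ?_⟩
    rw [AddMonoidHom.prod_apply, map_add, map_add, linearHom_single, linearHom_single,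
      linearHom_single, linearHom_single]
    refine Prod.ext ?_ ?_
    · calc _ = Δ⁻¹ * Δ * u := by simp only; rw [hΔ]; ring
        _ = u := by rw [inv_mul_cancel₀ hkl, one_mul]
    · calc _ = Δ⁻¹ * Δ * v := by simp only; rw [hΔ]; ring
        _ = v := by rw [inv_mul_cancel₀ hkl, one_mul]
  have h := card_fiber_mul_card _ hsurj (-(W : ZMod p)⁻¹ - b i, -(W : ZMod p)⁻¹ - b i')
  have hset : {y : Fin t → ZMod p | zeroIndices W L b p y ∈
      (Finset.univ.filter fun A : Finset (Fin m) => i ∈ A ∧ i' ∈ A)} =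
      {y | ((linearHom p (L i)).prod (linearHom p (L i'))) y =
        (-(W : ZMod p)⁻¹ - b i, -(W : ZMod p)⁻¹ - b i')} := by
    ext y
    simp [zeroIndices, residueForm_eq_zero_iff hW]
  rw [hset]
  set c := Nat.card {y | ((linearHom p (L i)).prod (linearHom p (L i'))) y =
        (-(W : ZMod p)⁻¹ - b i, -(W : ZMod p)⁻¹ - b i')} with hc
  rw [Nat.card_fun, Nat.card_prod, Nat.card_zmod, Nat.card_fin] at h
  have h' : (c : ℝ) * (p * p) = (p : ℝ) ^ t := by exact_mod_cast h
  rw [div_le_div_iff₀ (by have : (0 : ℝ) ≤ p := Nat.cast_nonneg p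
                          positivity) (by positivity), one_mul, sq, h']

/-- The law of the indices of the forms divisible by a prime differs from the independent law by
`O(1 / p ^ 2)`. -/
theorem abs_localLaw_sub_bernoulliLaw_le [Fact p.Prime] (hW : (W : ZMod p) ≠ 0)
    (h1 : ∀ i, ∃ k, (L i k : ZMod p) ≠ 0)
    (h2 : ∀ i i', i ≠ i' → ∃ k l, (L i k : ZMod p) * L i' l - L i l * L i' k ≠ 0)
    (A : Finset (Fin m)) :
    |localLaw W L b p A - bernoulliLaw (1 / (p : ℝ)) A| ≤ 4 ^ m / (p : ℝ) ^ 2 := by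
  have hp : (1 : ℝ) ≤ p := by exact_mod_cast (Fact.out : p.Prime).one_le
  have e1 : ∀ i : Fin m, ∑ A with i ∈ A, bernoulliLaw (1 / (p : ℝ)) A = 1 / (p : ℝ) := by
    intro i
    have := sum_bernoulliLaw_superset (1 / (p : ℝ)) {i}
    simpa using this
  have e2 : ∀ i i' : Fin m, i ≠ i' →
      ∑ A with i ∈ A ∧ i' ∈ A, bernoulliLaw (1 / (p : ℝ)) A = 1 / (p : ℝ) ^ 2 := by
    intro i i' hi
    have := sum_bernoulliLaw_superset (1 / (p : ℝ)) {i, i'}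
    rw [Finset.card_pair hi] at this
    rw [div_pow, one_pow] at this
    rw [← this]
    refine Finset.sum_congr ?_ fun _ _ => rfl
    ext A
    simp [Finset.insert_subset_iff]
  have e0 : ∑ A : Finset (Fin m), bernoulliLaw (1 / (p : ℝ)) A = 1 := by
    have := sum_bernoulliLaw_superset (m := m) (1 / (p : ℝ)) ∅
    simpa using this
  have h := abs_law_sub_law_le (l := localLaw W L b p) (l' := bernoulliLaw (1 / (p : ℝ)))
    (δ := 1 / (p : ℝ) ^ 2) localLaw_nonneg
    (bernoulliLaw_nonneg (by positivity) ((div_le_one (by linarith)).2 hp))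
    (by rw [e0, sum_localLaw_univ])
    (fun i => by rw [sum_localLaw_one hW i (h1 i), e1])
    (fun i i' hi => sum_localLaw_two_le hW i i' (h2 i i' hi))
    (fun i i' hi => (e2 i i' hi).le) (by positivity) A
  rwa [mul_one_div] at h

end LocalLaw

/-! ### From boxes to the model -/

section TruncatedDivisorSum

open ArithmeticFunction.Moebius

lemma moebius_prod_primes {U : Finset ℕ} (hU : ∀ p ∈ U, p.Prime) :
    (μ (∏ p ∈ U, p) : ℝ) = ∏ _p ∈ U, (-1 : ℝ) := by
  rw [ArithmeticFunction.isMultiplicative_moebius.map_prod_of_prime U hU]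
  push_cast
  exact Finset.prod_congr rfl fun p hp => by
    rw [ArithmeticFunction.moebius_apply_prime (hU p hp)]; norm_num

/-- The truncated divisor sum of an integer without prime factors up to `w` depends only on its set
of prime factors in `(w, R]`. -/
lemma truncatedDivisorSum_eq_diffOp {w : ℕ} {R : ℝ} (hR : 0 ≤ R) {θ : ℤ}
    (hθ : ∀ p : ℕ, p.Prime → p ≤ w → ¬ (p : ℤ) ∣ θ) :
    truncatedDivisorSum R θ =
      diffOp ((primesIn w ⌊R⌋₊).filter fun p : ℕ => (p : ℤ) ∣ θ) truncLog R := by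
  set D := (primesIn w ⌊R⌋₊).filter fun p : ℕ => (p : ℤ) ∣ θ with hD
  have hDp : ∀ p ∈ D, p.Prime := fun p hp => prime_of_mem_primesIn (Finset.mem_filter.1 hp).1
  set g : ℕ → ℝ := fun n => if (n : ℤ) ∣ θ then (μ n : ℝ) * truncLog (R / n) else 0 with hg
  have h1 : diffOp D truncLog R = ∑ U ∈ D.powerset, g (∏ p ∈ U, p) := by
    rw [diffOp, dilSum]
    refine Finset.sum_congr rfl fun U hU => ?_
    have hUD := Finset.mem_powerset.1 hU
    have hUp : ∀ p ∈ U, p.Prime := fun p hp => hDp p (hUD hp)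
    have hdvd : ((∏ p ∈ U, p : ℕ) : ℤ) ∣ θ := by
      rw [Int.natCast_dvd]
      exact Finset.prod_primes_dvd _ (fun p hp => (hUp p hp).prime) fun p hp =>
        Int.natCast_dvd.1 (Finset.mem_filter.1 (hUD hp)).2
    rw [hg]
    simp only
    rw [if_pos hdvd, moebius_prod_primes hUp, Nat.cast_prod]
  have h2 := sum_powerset_primes_eq (P := D) hDp (g := g) (N := ⌊R⌋₊) ?_ ?_ ?_
  · rw [h1, h2, truncatedDivisorSum, Finset.sum_filter]
    refine Finset.sum_congr rfl fun n hn => ?_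
    have hn' := Finset.mem_Icc.1 hn
    have hn0 : (0 : ℝ) < n := by exact_mod_cast hn'.1
    rw [hg]
    simp only
    rw [truncLog_of_le ((one_le_div hn0).2 ((Nat.le_floor_iff hR).1 hn'.2))]
  · intro n hn
    have hn' := (Nat.floor_lt hR).1 hn
    have hn0 : (0 : ℝ) < n := hR.trans_lt hn'
    rw [hg]
    simp only
    rw [truncLog_of_lt ((div_lt_one hn0).2 hn')]
    simp
  · intro n hn
    rw [hg]
    simp [ArithmeticFunction.moebius_eq_zero_of_not_squarefree hn]
  · intro n hn _ hgn p hp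
    have hp' := Nat.prime_of_mem_primeFactors hp
    have hpn := Nat.dvd_of_mem_primeFactors hp
    have hnθ : (n : ℤ) ∣ θ := by
      by_contra h
      exact hgn (if_neg h)
    have hpθ : (p : ℤ) ∣ θ := (Int.natCast_dvd_natCast.2 hpn).trans hnθ
    have hn' := Finset.mem_Ioc.1 hn
    refine Finset.mem_filter.2 ⟨mem_primesIn.2 ⟨⟨?_, (Nat.le_of_dvd hn'.1 hpn).trans hn'.2⟩, hp'⟩,
      hpθ⟩
    by_contra h
    exact hθ p hp' (not_lt.1 h) hpθ

/-- The coefficients of a truncated divisor sum are small in `ℓ¹`. -/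
lemma sum_abs_truncLog_le {P : Finset ℕ} (hP : ∀ p ∈ P, p.Prime) {R : ℝ} (hR : 1 ≤ R) :
    ∑ T ∈ P.powerset, |(∏ _p ∈ T, (-1 : ℝ)) * truncLog (R / ∏ p ∈ T, (p : ℝ))| ≤ R ^ 2 := by
  set g : ℕ → ℝ := fun n =>
    if Squarefree n ∧ n.primeFactors ⊆ P then |truncLog (R / n)| else 0 with hg
  have h1 : ∀ T ∈ P.powerset, |(∏ _p ∈ T, (-1 : ℝ)) * truncLog (R / ∏ p ∈ T, (p : ℝ))| =
      g (∏ p ∈ T, p) := by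
    intro T hT
    have hTP := Finset.mem_powerset.1 hT
    have hTp : ∀ p ∈ T, p.Prime := fun p hp => hP p (hTP hp)
    rw [hg]
    simp only
    rw [if_pos ⟨squarefree_prod_primes hTp, by rwa [Nat.primeFactors_prod hTp]⟩, abs_mul,
      Finset.abs_prod]
    simp
  rw [Finset.sum_congr rfl h1, sum_powerset_primes_eq hP (N := ⌊R⌋₊)]
  · calc ∑ n ∈ Finset.Ioc 0 ⌊R⌋₊, g n ≤ ∑ n ∈ Finset.Ioc 0 ⌊R⌋₊, R := by
          refine Finset.sum_le_sum fun n hn => ?_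
          rw [Finset.mem_Ioc] at hn
          have hn0 : (1 : ℝ) ≤ n := by exact_mod_cast hn.1
          have hnR : (n : ℝ) ≤ R := (Nat.le_floor_iff (by linarith)).1 hn.2
          have h2 : 1 ≤ R / n := (one_le_div (by linarith)).2 hnR
          rw [hg]
          simp only
          split_ifs
          · rw [truncLog_of_le h2, abs_of_nonneg (Real.log_nonneg h2)]
            calc Real.log (R / n) ≤ R / n - 1 := Real.log_le_sub_one_of_pos (by linarith)
              _ ≤ R / n := by linarith
              _ ≤ R := div_le_self (by linarith) hn0
          · linarith
      _ = ⌊R⌋₊ * R := by simp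
      _ ≤ R * R := by
          gcongr
          exact Nat.floor_le (by linarith)
      _ = R ^ 2 := (sq R).symm
  · intro n hn
    have hn' := (Nat.floor_lt (by linarith)).1 hn
    have hn0 : (0 : ℝ) < n := by linarith
    rw [hg]
    simp only
    rw [truncLog_of_lt ((div_lt_one hn0).2 hn')]
    simp
  · intro n hn
    rw [hg]
    simp [hn]
  · intro n _ _ h
    rw [hg] at h
    simp only [ne_eq, ite_eq_right_iff, not_forall] at h
    exact h.1.2

end TruncatedDivisorSum

section BoxModel

variable {m t : ℕ}

lemma mem_column {D : Fin m → Finset ℕ} {p : ℕ} {i : Fin m} : i ∈ column D p ↔ p ∈ D i := by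
  simp [column]

/-- Families of subsets of `P` correspond to families of columns indexed by `P`. -/
lemma sum_prod_column (P : Finset ℕ) (h : ℕ → Finset (Fin m) → ℝ) :
    ∑ D ∈ Fintype.piFinset (fun _ : Fin m => P.powerset), ∏ p ∈ P, h p (column D p) =
      ∏ p ∈ P, ∑ A, h p A := by
  classical
  rw [← Finset.prod_coe_sort P (fun p => ∑ A, h p A),
    Finset.prod_univ_sum (fun _ => Finset.univ) fun (p : P) A => h p A]
  refine Finset.sum_nbij' (fun D p => column D p)
    (fun q i => P.filter fun p => ∃ hp : p ∈ P, i ∈ q ⟨p, hp⟩) ?_ ?_ ?_ ?_ ?_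
  · intro D _
    simp
  · intro q _
    exact Fintype.mem_piFinset.2 fun i => Finset.mem_powerset.2 (Finset.filter_subset _ _)
  · intro D hD
    ext i p
    have hDi := Finset.mem_powerset.1 (Fintype.mem_piFinset.1 hD i)
    simp only [Finset.mem_filter, mem_column]
    exact ⟨fun h => h.2.2, fun h => ⟨hDi h, hDi h, h⟩⟩
  · intro q _
    ext p i
    simp [mem_column]
  · intro D _
    exact (Finset.prod_coe_sort P fun p => h p (column D p)).symm

/-- In the model the event that each `D i` contains a given set `V i` factors over the primes. -/
lemma modelMean_indicator {P : Finset ℕ} (law : ℕ → Finset (Fin m) → ℝ) {V : Fin m → Finset ℕ}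
    (hV : ∀ i, V i ⊆ P) :
    modelMean P law (fun D => if ∀ i, V i ⊆ D i then 1 else 0) =
      ∏ p ∈ P, ∑ A with column V p ⊆ A, law p A := by
  simp_rw [Finset.sum_filter]
  rw [← sum_prod_column, modelMean]
  refine Finset.sum_congr rfl fun D _ => ?_
  rw [Finset.prod_ite_zero, mul_ite, mul_one, mul_zero]
  refine if_congr ⟨fun h p _ i hi => ?_, fun h i p hp => ?_⟩ rfl rfl
  · rw [mem_column] at hi ⊢
    exact h i hi
  · exact mem_column.1 (h p (hV i hp) (mem_column.2 hp))

/-- The relevant prime factors of the values of the forms at an integer point. -/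
def primeDivisorSets (P : Finset ℕ) (W : ℕ) (L : Fin m → Fin t → ℤ) (b : Fin m → ℤ)
    (x : Fin t → ℤ) (i : Fin m) : Finset ℕ :=
  P.filter fun p : ℕ => (p : ℤ) ∣ (W : ℤ) * affineForm (L i) (b i) x + 1

variable {P : Finset ℕ} {W : ℕ} {L : Fin m → Fin t → ℤ} {b : Fin m → ℤ} {lo hi : Fin t → ℤ} {κ : ℝ}

/-- The frequency in a box of prescribed divisors of the forms is close to its value in the
model. -/
lemma abs_frequency_sub_modelMean_le (hP : ∀ p ∈ P, p.Prime) (hab : ∀ j, lo j < hi j)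
    {V : Fin m → Finset ℕ} (hV : ∀ i, V i ⊆ P)
    (hM : ∀ j, ((∏ p ∈ Finset.univ.biUnion V, p : ℕ) : ℝ) ≤ κ * (hi j - lo j)) (hκ : t * κ ≤ 1) :
    |(((Fintype.piFinset fun j => Finset.Ico (lo j) (hi j)).filter
        (fun x => ∀ i, V i ⊆ primeDivisorSets P W L b x i)).card : ℝ) /
      (Fintype.piFinset fun j => Finset.Ico (lo j) (hi j)).card -
      modelMean P (localLaw W L b) (fun D => if ∀ i, V i ⊆ D i then 1 else 0)| ≤
      2 * (t * κ) := by
  classical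
  set U := Finset.univ.biUnion V with hU
  have hUP : U ⊆ P := Finset.biUnion_subset.2 fun i _ => hV i
  obtain ⟨𝒜, h𝒜⟩ : ∃ 𝒜 : (p : ℕ) → Set (Fin t → ZMod p), 𝒜 = fun p =>
      {y | zeroIndices W L b p y ∈ Finset.univ.filter fun A : Finset (Fin m) => column V p ⊆ A} :=
    ⟨_, rfl⟩
  have h := abs_box_density_sub_prod_le (fun p hp => hP p (hUP hp)) hab hM hκ 𝒜
  have h1 : modelMean P (localLaw W L b) (fun D => if ∀ i, V i ⊆ D i then 1 else 0) =
      ∏ p ∈ U, (Nat.card (𝒜 p) : ℝ) / (p : ℝ) ^ t := by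
    rw [modelMean_indicator _ hV, ← Finset.prod_subset hUP]
    · refine Finset.prod_congr rfl fun p hp => ?_
      have : NeZero p := ⟨(hP p (hUP hp)).ne_zero⟩
      rw [sum_localLaw, h𝒜]
    · intro p hp hpU
      have : NeZero p := ⟨(hP p hp).ne_zero⟩
      have hc : column V p = ∅ := by
        refine Finset.eq_empty_of_forall_notMem fun i hi => hpU ?_
        exact Finset.mem_biUnion.2 ⟨i, Finset.mem_univ i, mem_column.1 hi⟩
      simp only [hc, Finset.empty_subset, Finset.filter_true]
      exact sum_localLaw_univ
  have h2 : (Fintype.piFinset fun j => Finset.Ico (lo j) (hi j)).filter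
      (fun x => ∀ i, V i ⊆ primeDivisorSets P W L b x i) =
      (Fintype.piFinset fun j => Finset.Ico (lo j) (hi j)).filter
        (fun x => ∀ p ∈ U, (fun j => (x j : ZMod p)) ∈ 𝒜 p) := by
    refine Finset.filter_congr fun x _ => ?_
    simp only [h𝒜, Set.mem_ofPred_eq, Finset.mem_filter, Finset.mem_univ, true_and]
    have h3 : ∀ p i, i ∈ zeroIndices W L b p (fun j => (x j : ZMod p)) ↔
        (p : ℤ) ∣ (W : ℤ) * affineForm (L i) (b i) x + 1 := by
      intro p i
      rw [zeroIndices, Finset.mem_filter, residueForm_intCast, ZMod.intCast_zmod_eq_zero_iff_dvd]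
      simp
    constructor
    · intro h p _ i hi
      exact (h3 p i).2 (Finset.mem_filter.1 (h i (mem_column.1 hi))).2
    · intro h i p hp
      refine Finset.mem_filter.2 ⟨hV i hp, (h3 p i).1 ?_⟩
      exact h p (Finset.mem_biUnion.2 ⟨i, Finset.mem_univ i, hp⟩) (mem_column.2 hp)
  rw [h1, h2]
  exact h

/-- Expansion of a product of squares of divisor sums into indicators of divisibility. -/
lemma prod_diffOp_sq_eq (f : ℝ → ℝ) (x : ℝ) {D : Fin m → Finset ℕ} (hD : ∀ i, D i ⊆ P) :
    ∏ i, diffOp (D i) f x ^ 2 =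
      ∑ q ∈ Fintype.piFinset (fun _ : Fin m => P.powerset ×ˢ P.powerset),
        (∏ i, ((∏ _p ∈ (q i).1, (-1 : ℝ)) * f (x / ∏ p ∈ (q i).1, (p : ℝ))) *
          ((∏ _p ∈ (q i).2, (-1 : ℝ)) * f (x / ∏ p ∈ (q i).2, (p : ℝ)))) *
        if ∀ i, (q i).1 ∪ (q i).2 ⊆ D i then 1 else 0 := by
  set a : Finset ℕ → ℝ := fun T => (∏ _p ∈ T, (-1 : ℝ)) * f (x / ∏ p ∈ T, (p : ℝ)) with ha
  have h1 : ∀ i, diffOp (D i) f x = ∑ T ∈ P.powerset, if T ⊆ D i then a T else 0 := by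
    intro i
    rw [← Finset.sum_filter]
    refine Finset.sum_congr ?_ fun _ _ => rfl
    ext T
    simp only [Finset.mem_powerset, Finset.mem_filter]
    exact ⟨fun h => ⟨h.trans (hD i), h⟩, fun h => h.2⟩
  have h2 : ∀ i, diffOp (D i) f x ^ 2 = ∑ q ∈ P.powerset ×ˢ P.powerset,
      if q.1 ∪ q.2 ⊆ D i then a q.1 * a q.2 else 0 := by
    intro i
    rw [sq, h1, Finset.sum_mul_sum, ← Finset.sum_product']
    refine Finset.sum_congr rfl fun q _ => ?_
    rw [ite_zero_mul_ite_zero]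
    exact if_congr Finset.union_subset_iff.symm rfl rfl
  simp_rw [h2]
  rw [Finset.prod_univ_sum]
  refine Finset.sum_congr rfl fun q _ => ?_
  rw [Finset.prod_ite_zero, mul_ite, mul_one, mul_zero]
  by_cases h : ∀ i, (q i).1 ∪ (q i).2 ⊆ D i
  · rw [if_pos h, if_pos fun i _ => h i]
  · rw [if_neg h, if_neg fun h' => h fun i => h' i (Finset.mem_univ i)]

/-- The mean of the product of squared truncated divisor sums over a box with sides at least
`R ^ (10 * m) / 2` agrees with its value in the model up to a power of `R`. -/
theorem abs_box_mean_sub_modelMean_le (hP : ∀ p ∈ P, p.Prime) (hab : ∀ j, lo j < hi j)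
    {R : ℝ} (hR : 1 ≤ R) (hlen : ∀ j, R ^ (10 * m) / 2 ≤ (hi j : ℝ) - lo j)
    (ht : 2 * t ≤ R ^ (8 * m)) :
    |(∑ x ∈ Fintype.piFinset fun j => Finset.Ico (lo j) (hi j),
        ∏ i, diffOp (primeDivisorSets P W L b x i) truncLog R ^ 2) /
      (Fintype.piFinset fun j => Finset.Ico (lo j) (hi j)).card -
      modelMean P (localLaw W L b) (fun D => ∏ i, diffOp (D i) truncLog R ^ 2)| ≤
      4 * t / R ^ (4 * m) := by
  set B := Fintype.piFinset fun j => Finset.Ico (lo j) (hi j) with hB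
  have hR0 : 0 < R := by linarith
  set a : Finset ℕ → ℝ := fun T => (∏ _p ∈ T, (-1 : ℝ)) * truncLog (R / ∏ p ∈ T, (p : ℝ)) with ha
  set Q := Fintype.piFinset (fun _ : Fin m => P.powerset ×ˢ P.powerset) with hQ
  set c : (Fin m → Finset ℕ × Finset ℕ) → ℝ := fun q => ∏ i, (a (q i).1 * a (q i).2) with hc
  set V : (Fin m → Finset ℕ × Finset ℕ) → Fin m → Finset ℕ := fun q i => (q i).1 ∪ (q i).2 with hV
  have hbox : (∑ x ∈ B, ∏ i, diffOp (primeDivisorSets P W L b x i) truncLog R ^ 2) / B.card =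
      ∑ q ∈ Q, c q * (((B.filter fun x => ∀ i, V q i ⊆ primeDivisorSets P W L b x i).card : ℝ) /
        B.card) := by
    rw [Finset.sum_congr rfl fun x _ => prod_diffOp_sq_eq (P := P)
      (D := primeDivisorSets P W L b x) truncLog R (fun i => Finset.filter_subset _ _),
      Finset.sum_comm, Finset.sum_div]
    refine Finset.sum_congr rfl fun q _ => ?_
    rw [← Finset.mul_sum, Finset.sum_boole, mul_div_assoc]
  have hmodel : modelMean P (localLaw W L b) (fun D => ∏ i, diffOp (D i) truncLog R ^ 2) =
      ∑ q ∈ Q, c q * modelMean P (localLaw W L b) (fun D => if ∀ i, V q i ⊆ D i then 1 else 0) := by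
    simp_rw [modelMean, Finset.mul_sum]
    rw [Finset.sum_comm]
    refine Finset.sum_congr rfl fun D hD => ?_
    rw [prod_diffOp_sq_eq (P := P) truncLog R
      (fun i => Finset.mem_powerset.1 (Fintype.mem_piFinset.1 hD i)), Finset.mul_sum]
    exact Finset.sum_congr rfl fun q _ => mul_left_comm _ _ _
  have hterm : ∀ q ∈ Q,
      |c q * (((B.filter fun x => ∀ i, V q i ⊆ primeDivisorSets P W L b x i).card : ℝ) / B.card) -
        c q * modelMean P (localLaw W L b) (fun D => if ∀ i, V q i ⊆ D i then 1 else 0)| ≤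
      |c q| * (2 * (t * (2 / R ^ (8 * m)))) := by
    intro q hq
    rw [← mul_sub, abs_mul]
    rcases eq_or_ne (c q) 0 with h0 | h0
    · simp [h0]
    refine mul_le_mul_of_nonneg_left ?_ (abs_nonneg _)
    have hqP : ∀ i, (q i).1 ⊆ P ∧ (q i).2 ⊆ P := fun i => by
      simpa using Fintype.mem_piFinset.1 hq i
    have hprod : ∀ T, a T ≠ 0 → T ⊆ P → ((∏ p ∈ T, p : ℕ) : ℝ) ≤ R := by
      intro T hT hTP
      by_contra h
      rw [not_le, Nat.cast_prod] at h
      refine hT ?_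
      rw [ha]
      simp only
      rw [truncLog_of_lt ((div_lt_one (hR0.trans h)).2 h), mul_zero]
    have hle : ((∏ p ∈ Finset.univ.biUnion (V q), p : ℕ) : ℝ) ≤ R ^ (2 * m) := by
      have h1 : ∏ p ∈ Finset.univ.biUnion (V q), p ∣
          ∏ i, ((∏ p ∈ (q i).1, p) * ∏ p ∈ (q i).2, p) := by
        refine Finset.prod_primes_dvd _ (fun p hp => ?_) fun p hp => ?_
        · obtain ⟨i, -, hi⟩ := Finset.mem_biUnion.1 hp
          rcases Finset.mem_union.1 hi with h | h
          · exact (hP p ((hqP i).1 h)).prime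
          · exact (hP p ((hqP i).2 h)).prime
        · obtain ⟨i, -, hi⟩ := Finset.mem_biUnion.1 hp
          refine Dvd.dvd.trans ?_ (Finset.dvd_prod_of_mem _ (Finset.mem_univ i))
          rcases Finset.mem_union.1 hi with h | h
          · exact (Finset.dvd_prod_of_mem (fun p => p) h).mul_right _
          · exact (Finset.dvd_prod_of_mem (fun p => p) h).mul_left _
      have h2 : 0 < ∏ i, ((∏ p ∈ (q i).1, p) * ∏ p ∈ (q i).2, p) :=
        Finset.prod_pos fun i _ => Nat.mul_pos
          (Finset.prod_pos fun p hp => (hP p ((hqP i).1 hp)).pos)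
          (Finset.prod_pos fun p hp => (hP p ((hqP i).2 hp)).pos)
      calc ((∏ p ∈ Finset.univ.biUnion (V q), p : ℕ) : ℝ)
          ≤ ((∏ i, ((∏ p ∈ (q i).1, p) * ∏ p ∈ (q i).2, p) : ℕ) : ℝ) := by
            exact_mod_cast Nat.le_of_dvd h2 h1
        _ = ∏ i, (((∏ p ∈ (q i).1, p : ℕ) : ℝ) * ((∏ p ∈ (q i).2, p : ℕ) : ℝ)) := by push_cast; rfl
        _ ≤ ∏ _i : Fin m, (R * R) := by
            refine Finset.prod_le_prod (fun i _ => by positivity) fun i _ => ?_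
            have hi := Finset.prod_ne_zero_iff.1 h0 i (Finset.mem_univ i)
            have h3 := hprod _ (left_ne_zero_of_mul hi) (hqP i).1
            have h4 := hprod _ (right_ne_zero_of_mul hi) (hqP i).2
            gcongr
        _ = R ^ (2 * m) := by
            rw [Finset.prod_const, Finset.card_univ, Fintype.card_fin, ← sq, pow_mul]
    refine abs_frequency_sub_modelMean_le hP hab
      (fun i => Finset.union_subset (hqP i).1 (hqP i).2) (fun j => hle.trans ?_) ?_
    · calc R ^ (2 * m) = 2 / R ^ (8 * m) * (R ^ (10 * m) / 2) := by
            rw [show 10 * m = 2 * m + 8 * m by ring, pow_add]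
            field_simp
        _ ≤ _ := by
            gcongr
            exact hlen j
    · rw [mul_div_assoc', div_le_one (by positivity)]
      linarith
  have hsum : ∑ q ∈ Q, |c q| ≤ R ^ (4 * m) := by
    calc ∑ q ∈ Q, |c q| = ∏ _i : Fin m, ∑ q ∈ P.powerset ×ˢ P.powerset, |a q.1 * a q.2| := by
          rw [Finset.prod_univ_sum]
          exact Finset.sum_congr rfl fun q _ => Finset.abs_prod _ _
      _ = ((∑ T ∈ P.powerset, |a T|) * ∑ T ∈ P.powerset, |a T|) ^ m := by
          rw [Finset.prod_const, Finset.card_univ, Fintype.card_fin, Finset.sum_mul_sum,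
            ← Finset.sum_product']
          simp_rw [abs_mul]
      _ ≤ (R ^ 2 * R ^ 2) ^ m := by
          have h := sum_abs_truncLog_le hP hR
          have h0 : 0 ≤ ∑ T ∈ P.powerset, |a T| := Finset.sum_nonneg fun _ _ => abs_nonneg _
          gcongr
      _ = R ^ (4 * m) := by rw [← pow_add, ← pow_mul]
  rw [hbox, hmodel, ← Finset.sum_sub_distrib]
  calc _ ≤ ∑ q ∈ Q, |c q| * (2 * (t * (2 / R ^ (8 * m)))) :=
        (Finset.abs_sum_le_sum_abs _ _).trans (Finset.sum_le_sum hterm)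
    _ = (∑ q ∈ Q, |c q|) * (2 * (t * (2 / R ^ (8 * m)))) := by rw [Finset.sum_mul]
    _ ≤ R ^ (4 * m) * (2 * (t * (2 / R ^ (8 * m)))) := by gcongr
    _ = 4 * t / R ^ (4 * m) := by
        rw [show 8 * m = 4 * m + 4 * m by ring, pow_add]
        field_simp
        ring

end BoxModel

/-! ### The asymptotic formula -/

section Nondegeneracy

variable {m t : ℕ} {w : ℝ} {p : ℕ} {L : Fin m → Fin t → ℤ}

lemma intCast_zmod_ne_zero {a : ℤ} (ha : a ≠ 0) (hp : |(a : ℝ)| < p) : (a : ZMod p) ≠ 0 := by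
  intro h
  rw [ZMod.intCast_zmod_eq_zero_iff_dvd] at h
  refine ha (Int.eq_zero_of_abs_lt_dvd h ?_)
  exact_mod_cast hp

lemma exists_coeff_ne_zero (hw : 1 ≤ w) (hp : w < p) {ℓ : Fin t → ℤ}
    (hℓ : ∀ j, |(ℓ j : ℝ)| ≤ Real.sqrt w / 2) (h : ℓ ≠ 0) : ∃ k, (ℓ k : ZMod p) ≠ 0 := by
  obtain ⟨k, hk⟩ := Function.ne_iff.1 h
  refine ⟨k, intCast_zmod_ne_zero hk ?_⟩
  have h1 : Real.sqrt w ≤ w := Real.sqrt_le_iff.2 ⟨by linarith, by nlinarith⟩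
  linarith [hℓ k, Real.sqrt_nonneg w]

/-- The `2 × 2` minors are at most `w / 2` in absolute value, so that a nonzero minor remains
nonzero modulo the primes exceeding `w`. -/
lemma exists_minor_ne_zero (hw : 1 ≤ w) (hp : w < p) {ℓ ℓ' : Fin t → ℤ}
    (hℓ : ∀ j, |(ℓ j : ℝ)| ≤ Real.sqrt w / 2) (hℓ' : ∀ j, |(ℓ' j : ℝ)| ≤ Real.sqrt w / 2)
    (h0 : ℓ' ≠ 0) (h : ¬ ∃ q : ℚ, ∀ j, (ℓ j : ℚ) = q * (ℓ' j : ℚ)) :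
    ∃ k l, (ℓ k : ZMod p) * ℓ' l - ℓ l * ℓ' k ≠ 0 := by
  obtain ⟨k, hk⟩ := Function.ne_iff.1 h0
  have hk' : (ℓ' k : ℚ) ≠ 0 := by exact_mod_cast hk
  obtain ⟨l, hl⟩ := not_forall.1 (not_exists.1 h ((ℓ k : ℚ) / ℓ' k))
  refine ⟨k, l, ?_⟩
  have h1 : ((ℓ k * ℓ' l - ℓ l * ℓ' k : ℤ) : ZMod p) ≠ 0 := by
    refine intCast_zmod_ne_zero (fun h2 => hl ?_) ?_
    · have h3 : (ℓ k : ℚ) * ℓ' l - ℓ l * ℓ' k = 0 := by exact_mod_cast h2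
      field_simp
      linarith
    · have hs : Real.sqrt w / 2 * (Real.sqrt w / 2) = w / 4 := by
        have := Real.mul_self_sqrt (by linarith : 0 ≤ w)
        linarith
      have h4 : ∀ i j, |(ℓ i : ℝ) * ℓ' j| ≤ w / 4 := fun i j => by
        rw [abs_mul, ← hs]
        exact mul_le_mul (hℓ i) (hℓ' j) (abs_nonneg _) (by positivity)
      push_cast
      linarith [abs_sub (ℓ k * ℓ' l : ℝ) (ℓ l * ℓ' k), h4 k l, h4 l k]
  simpa using h1

lemma primorial_cast_ne_zero {w : ℕ} (hp : p.Prime) (hwp : w < p) :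
    (primorial w : ZMod p) ≠ 0 := by
  intro h
  rw [ZMod.natCast_eq_zero_iff] at h
  have h1 : p ∈ (primorial w).primeFactors :=
    Nat.mem_primeFactors.2 ⟨hp, h, (primorial_pos w).ne'⟩
  rw [primeFactors_primorial, mem_primesIn] at h1
  omega

lemma not_dvd_primorial_mul_add_one {w : ℕ} (hp : p.Prime) (hpw : p ≤ w) (a : ℤ) :
    ¬ (p : ℤ) ∣ (primorial w : ℤ) * a + 1 := by
  intro h
  have h1 : p ∈ (primorial w).primeFactors := by
    rw [primeFactors_primorial, mem_primesIn]
    exact ⟨⟨hp.pos, hpw⟩, hp⟩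
  have h2 : (p : ℤ) ∣ (primorial w : ℤ) * a :=
    (Int.natCast_dvd_natCast.2 (Nat.dvd_of_mem_primeFactors h1)).mul_right a
  have h3 : (p : ℤ) ∣ 1 := (dvd_add_right h2).1 h
  exact hp.one_lt.ne' (Nat.dvd_one.1 (by exact_mod_cast h3))

end Nondegeneracy

section Asymptotic

/-- The asymptotic formula with relative error `ε`, for the sieve level `R` and the primes up to
`w`, uniformly over all systems of forms and all boxes. -/
def UniformAsymptotic (m t : ℕ) (ε w R : ℝ) : Prop :=
  ∀ (L : Fin m → Fin t → ℤ) (b : Fin m → ℤ),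
    (∀ i j, |(L i j : ℝ)| ≤ Real.sqrt w / 2) →
    (∀ i, L i ≠ 0) →
    (∀ i i', i ≠ i' → ¬ ∃ q : ℚ, ∀ j, (L i j : ℚ) = q * (L i' j : ℚ)) →
    ∀ (I : Fin t → Set ℝ) (lo hi : Fin t → ℝ),
      (∀ j, IsIntervalWithEndpoints (I j) (lo j) (hi j)) →
      (∀ j, R ^ (10 * m) ≤ hi j - lo j) →
      |average (boxPoints I) (fun x => ∏ i, truncatedDivisorSum R
          ((primorial ⌊w⌋₊ : ℤ) * affineForm (L i) (b i) x + 1) ^ 2)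
        - ((primorial ⌊w⌋₊ : ℝ) * Real.log R / (Nat.totient (primorial ⌊w⌋₊) : ℝ)) ^ m|
      ≤ ε * ((primorial ⌊w⌋₊ : ℝ) * Real.log R / (Nat.totient (primorial ⌊w⌋₊) : ℝ)) ^ m

lemma average_boxPoints_eq {t : ℕ} {I : Fin t → Set ℝ} {lo hi : Fin t → ℤ}
    (hI : ∀ j, ∀ k : ℤ, (k : ℝ) ∈ I j ↔ k ∈ Finset.Ico (lo j) (hi j)) (f : (Fin t → ℤ) → ℝ) :
    average (boxPoints I) f = (∑ x ∈ Fintype.piFinset fun j => Finset.Ico (lo j) (hi j), f x) /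
      (Fintype.piFinset fun j => Finset.Ico (lo j) (hi j)).card := by
  have h : boxPoints I =
      ((Fintype.piFinset fun j => Finset.Ico (lo j) (hi j) : Finset (Fin t → ℤ)) : Set _) := by
    ext x
    rw [Finset.mem_coe, Fintype.mem_piFinset]
    exact forall_congr' fun j => hI j (x j)
  rw [average, h, finsum_mem_coe_finset, Set.ncard_coe_finset]

/-- A box average of the product of squared truncated divisor sums, compared with a power of the
mean square over a random set of primes. -/
theorem abs_average_sub_sieveEnergy_pow_le {m t : ℕ} {w R M : ℝ} (hm : 0 < m) (ht : 0 < t)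
    (hw : 1 ≤ w) (hR : 2 * t + 2 ≤ R)
    (hM : ∀ y, y ≤ R → sieveEnergy (primesIn ⌊w⌋₊ ⌊R⌋₊) truncLog y ≤ M)
    {L : Fin m → Fin t → ℤ} {b : Fin m → ℤ}
    (hL : ∀ i j, |(L i j : ℝ)| ≤ Real.sqrt w / 2) (hL0 : ∀ i, L i ≠ 0)
    (hind : ∀ i i', i ≠ i' → ¬ ∃ q : ℚ, ∀ j, (L i j : ℚ) = q * (L i' j : ℚ))
    {I : Fin t → Set ℝ} {lo hi : Fin t → ℝ}
    (hI : ∀ j, IsIntervalWithEndpoints (I j) (lo j) (hi j))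
    (hlen : ∀ j, R ^ (10 * m) ≤ hi j - lo j) :
    |average (boxPoints I) (fun x => ∏ i, truncatedDivisorSum R
        ((primorial ⌊w⌋₊ : ℤ) * affineForm (L i) (b i) x + 1) ^ 2) -
      sieveEnergy (primesIn ⌊w⌋₊ ⌊R⌋₊) truncLog R ^ m| ≤
      4 * t / R + (Real.exp (10 ^ m * 4 ^ m / (⌊w⌋₊ : ℝ)) - 1) * M ^ m := by
  set P := primesIn ⌊w⌋₊ ⌊R⌋₊ with hP
  have hPp : ∀ p ∈ P, p.Prime := fun p hp => prime_of_mem_primesIn hp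
  have ht' : (1 : ℝ) ≤ t := by exact_mod_cast ht
  have hR1 : 1 ≤ R := by linarith
  have hpow : ∀ n, 0 < n → R ≤ R ^ n := fun n hn => le_self_pow₀ hR1 hn.ne'
  have hw0 : 0 < ⌊w⌋₊ := Nat.floor_pos.2 hw
  choose a c hac hlen' using fun j => exists_Ico_eq_of_interval (hI j)
  have hlen2 : ∀ j, R ^ (10 * m) / 2 ≤ (c j : ℝ) - a j := fun j => by
    linarith [hlen' j, hlen j, hpow (10 * m) (by omega)]
  have hac0 : ∀ j, a j < c j := fun j => by
    have : (a j : ℝ) < c j := by linarith [hlen2 j, hpow (10 * m) (by omega)]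
    exact_mod_cast this
  have hbox := abs_box_mean_sub_modelMean_le (W := primorial ⌊w⌋₊) (L := L) (b := b) hPp hac0 hR1
    hlen2 (by linarith [hpow (8 * m) (by omega)])
  have hmodel := abs_modelMean_sub_pow_le (law := localLaw (primorial ⌊w⌋₊) L b)
    (K := 4 ^ m) (f := truncLog) hPp (by positivity) (fun p hp A => by
      have hp' := mem_primesIn.1 hp
      have : Fact p.Prime := ⟨hp'.2⟩
      have hwp : w < p := Nat.lt_of_floor_lt hp'.1.1
      exact abs_localLaw_sub_bernoulliLaw_le (primorial_cast_ne_zero hp'.2 hp'.1.1)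
        (fun i => exists_coeff_ne_zero hw hwp (hL i) (hL0 i))
        (fun i i' hi => exists_minor_ne_zero hw hwp (hL i) (hL i') (hL0 i') (hind i i' hi)) A)
    (by linarith : 0 ≤ R) hM
  have hM0 : 0 ≤ M := sieveEnergy_nonneg.trans (hM R le_rfl)
  have hprod := prod_one_add_div_sq_le (K := 10 ^ m * 4 ^ m) (by positivity) hw0 ⌊R⌋₊
  have havg : average (boxPoints I) (fun x => ∏ i, truncatedDivisorSum R
      ((primorial ⌊w⌋₊ : ℤ) * affineForm (L i) (b i) x + 1) ^ 2) =
      (∑ x ∈ Fintype.piFinset fun j => Finset.Ico (a j) (c j),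
        ∏ i, diffOp (primeDivisorSets P (primorial ⌊w⌋₊) L b x i) truncLog R ^ 2) /
      (Fintype.piFinset fun j => Finset.Ico (a j) (c j)).card := by
    rw [average_boxPoints_eq hac]
    congr 1
    refine Finset.sum_congr rfl fun x _ => Finset.prod_congr rfl fun i _ => ?_
    rw [truncatedDivisorSum_eq_diffOp (by linarith)
      fun p hp hpw => not_dvd_primorial_mul_add_one hp hpw _]
    rfl
  rw [havg]
  refine (abs_sub_le _ _ _).trans (add_le_add (hbox.trans ?_) (hmodel.trans ?_))
  · gcongr
    exact hpow (4 * m) (by omega)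
  · gcongr

/-- For a fixed large number of small primes the asymptotic formula holds for all large `R`. -/
theorem eventually_uniformAsymptotic {m t : ℕ} (hm : 0 < m) (ht : 0 < t) {ε : ℝ} (hε : 0 < ε) :
    ∀ᶠ w₀ : ℕ in atTop, ∀ᶠ R : ℝ in atTop, ∀ w : ℝ, ⌊w⌋₊ = w₀ → UniformAsymptotic m t ε w R := by
  -- a small `η` absorbs all the constants into the relative error
  obtain ⟨η, hη0, hη⟩ : ∃ η : ℝ, 0 < η ∧ (1 + η) ^ m ≤ 1 + min (ε / 3) 1 := by
    have h : Tendsto (fun η : ℝ => (1 + η) ^ m) (nhds 0) (nhds ((1 + 0) ^ m)) :=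
      Continuous.tendsto (by fun_prop) 0
    rw [add_zero, one_pow] at h
    have h1 : (1 : ℝ) < 1 + min (ε / 3) 1 := by
      have : 0 < min (ε / 3) 1 := lt_min (by linarith) one_pos
      linarith
    obtain ⟨δ, hδ, hδ'⟩ := Metric.eventually_nhds_iff.1 (h.eventually_lt_const h1)
    refine ⟨δ / 2, by linarith, (hδ' ?_).le⟩
    rw [Real.dist_eq, sub_zero, abs_of_pos (by linarith)]
    linarith
  have hη1 : (1 + η) ^ m - 1 ≤ ε / 3 := by linarith [min_le_left (ε / 3) 1]
  have hη2 : (1 + η) ^ m ≤ 2 := by linarith [min_le_right (ε / 3) 1]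
  have hlim : ∀ K : ℝ, Tendsto (fun w₀ : ℕ => Real.exp (K / w₀)) atTop (nhds 1) := fun K => by
    have := (Real.continuous_exp.tendsto 0).comp (tendsto_const_div_atTop_nhds_zero_nat K)
    rwa [Real.exp_zero] at this
  have hE1 : ∀ᶠ w₀ : ℕ in atTop, (1 + η / 2) * Real.exp (2 / w₀) < 1 + η := by
    have := (hlim 2).const_mul (1 + η / 2)
    rw [mul_one] at this
    exact this.eventually_lt_const (by linarith)
  have hE2 : ∀ᶠ w₀ : ℕ in atTop, Real.exp (10 ^ m * 4 ^ m / w₀) < 1 + ε / 6 :=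
    (hlim _).eventually_lt_const (by linarith)
  filter_upwards [hE1, hE2, eventually_ge_atTop 1] with w₀ h1 h2 hw₀
  obtain ⟨R₁, hup⟩ := exists_sieveEnergy_le w₀ (ε := η / 2) (by linarith)
  obtain ⟨R₂, hlow⟩ := exists_le_sieveEnergy w₀ (ε := η / 2) (by linarith)
  filter_upwards [eventually_ge_atTop R₁, eventually_ge_atTop R₂,
    eventually_ge_atTop (2 * t + 2 : ℝ), eventually_ge_atTop (Real.exp 1),
    eventually_ge_atTop (12 * t / ε)] with R hR₁ hR₂ hR₃ hR₄ hR₅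
  rintro w rfl L b hL hL0 hind I lo hi hI hlen
  have hw : 1 ≤ w := (Nat.le_floor_iff' one_ne_zero).1 hw₀ |>.trans' (by norm_num)
  have hR0 : 0 < R := (Real.exp_pos 1).trans_le hR₄
  set S := sieveEnergy (primesIn ⌊w⌋₊ ⌊R⌋₊) truncLog R with hS
  have hS0 : 0 ≤ S := sieveEnergy_nonneg
  have hφ : (0 : ℝ) < Nat.totient (primorial ⌊w⌋₊) := by
    exact_mod_cast Nat.totient_pos.2 (primorial_pos _)
  set C : ℝ := (primorial ⌊w⌋₊ : ℝ) / Nat.totient (primorial ⌊w⌋₊) with hC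
  have hC1 : 1 ≤ C := by
    rw [hC, one_le_div hφ]
    exact_mod_cast Nat.totient_le _
  have hlog : 1 ≤ Real.log R := by rwa [Real.le_log_iff_exp_le hR0]
  have hX : (primorial ⌊w⌋₊ : ℝ) * Real.log R / (Nat.totient (primorial ⌊w⌋₊) : ℝ) =
      C * Real.log R := by rw [hC]; ring
  rw [hX]
  set X := C * Real.log R with hXdef
  have hX1 : 1 ≤ X := one_le_mul_of_one_le_of_one_le hC1 hlog
  have hX0 : 0 ≤ X := by linarith
  have hXm : 1 ≤ X ^ m := one_le_pow₀ hX1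
  have hM : ∀ y, y ≤ R → sieveEnergy (primesIn ⌊w⌋₊ ⌊R⌋₊) truncLog y ≤ (1 + η) * X := by
    intro y hy
    refine (hup R hR₁ y hy).trans ?_
    rw [mul_assoc]
    gcongr
    linarith
  have hmain := abs_average_sub_sieveEnergy_pow_le (b := b) hm ht hw hR₃ hM hL hL0 hind hI hlen
  have hSup : S ^ m ≤ (1 + η) ^ m * X ^ m := by
    rw [← mul_pow]
    exact pow_le_pow_left₀ hS0 (hM R le_rfl) m
  have hSlow : X ^ m ≤ (1 + η) ^ m * S ^ m := by
    rw [← mul_pow]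
    refine pow_le_pow_left₀ hX0 ((hlow R hR₂).trans ?_) m
    refine mul_le_mul_of_nonneg_right ?_ hS0
    refine le_trans ?_ h1.le
    gcongr
    exact prod_one_add_div_sq_le (by norm_num) (by omega) _
  have hdiff : |S ^ m - X ^ m| ≤ ε / 3 * X ^ m := by
    have hSm : 0 ≤ S ^ m := pow_nonneg hS0 m
    have hone : 1 ≤ (1 + η) ^ m := one_le_pow₀ (by linarith)
    rw [abs_le]
    constructor
    · rcases le_total (X ^ m) (S ^ m) with h | h
      · nlinarith
      · nlinarith
    · nlinarith
  have herr1 : 4 * t / R ≤ ε / 3 * X ^ m := by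
    have h3 : 4 * t / R ≤ ε / 3 := by
      rw [div_le_iff₀ hR0]
      rw [div_le_iff₀ hε] at hR₅
      linarith
    nlinarith
  have herr2 : (Real.exp (10 ^ m * 4 ^ m / (⌊w⌋₊ : ℝ)) - 1) * ((1 + η) * X) ^ m ≤
      ε / 3 * X ^ m := by
    rw [mul_pow, ← mul_assoc]
    refine mul_le_mul_of_nonneg_right ?_ (by linarith)
    calc _ ≤ ε / 6 * 2 := by
          refine mul_le_mul (by linarith) hη2 (by positivity) (by linarith)
      _ = ε / 3 := by ring
  calc _ ≤ _ := abs_sub_le _ (S ^ m) _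
    _ ≤ ε / 3 * X ^ m + ε / 3 * X ^ m + ε / 3 * X ^ m := by linarith
    _ = ε * X ^ m := by ring

end Asymptotic

section Diagonal

/-- Diagonal argument: countably many properties, each of which holds for large `N` as soon as the
parameter `v` is large and fixed, hold along every sufficiently slowly growing parameter. -/
lemma exists_slow_growth {Q : ℕ → ℕ → ℕ → Prop}
    (hQ : ∀ k, ∀ᶠ v in atTop, ∀ᶠ N in atTop, Q k v N) :
    ∃ g : ℕ → ℕ, Tendsto g atTop atTop ∧ ∀ v : ℕ → ℕ, Tendsto v atTop atTop →
      (∀ᶠ N in atTop, v N ≤ g N) → ∀ k, ∀ᶠ N in atTop, Q k (v N) N := by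
  have hr : ∀ k v, ∃ r, (∀ᶠ N in atTop, Q k v N) → ∀ N, r ≤ N → Q k v N := by
    intro k v
    by_cases h : ∀ᶠ N in atTop, Q k v N
    · obtain ⟨r, hr⟩ := eventually_atTop.1 h
      exact ⟨r, fun _ => hr⟩
    · exact ⟨0, fun h' => absurd h' h⟩
  choose r hr using hr
  -- beyond `T j` all the properties with indices and parameters at most `j` hold
  set T : ℕ → ℕ := fun j => ∑ k ∈ Finset.range (j + 1), ∑ v ∈ Finset.range (j + 1), r k v with hT
  have hrT : ∀ j k v, k ≤ j → v ≤ j → r k v ≤ T j := by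
    intro j k v hk hv
    calc r k v ≤ ∑ v ∈ Finset.range (j + 1), r k v :=
          Finset.single_le_sum (f := fun v => r k v) (fun _ _ => Nat.zero_le _)
            (Finset.mem_range.2 (by omega))
      _ ≤ T j := Finset.single_le_sum
            (f := fun k => ∑ v ∈ Finset.range (j + 1), r k v) (fun _ _ => Nat.zero_le _)
            (Finset.mem_range.2 (by omega))
  refine ⟨fun N => Nat.findGreatest (fun j => T j ≤ N) N, ?_, ?_⟩
  · refine tendsto_atTop.2 fun J => ?_
    filter_upwards [eventually_ge_atTop (max J (T J))] with N hN
    exact Nat.le_findGreatest (le_of_max_le_left hN) (le_of_max_le_right hN)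
  · intro v hv hvg k
    filter_upwards [hvg, hv.eventually (hQ k), hv.eventually_ge_atTop (k + 1)] with N h1 h2 h3
    refine hr k (v N) h2 N ((hrT _ k (v N) (by omega) h1).trans ?_)
    exact Nat.findGreatest_of_ne_zero (P := fun j => T j ≤ N) (n := N) rfl (by omega)

end Diagonal

end GoldstonYildirim

theorem proposition9p5 (c : ℝ) (hc : 0 < c) :
    -- `g` expresses that `w` is sufficiently slowly growing
    ∃ g : ℕ → ℝ, Tendsto g atTop atTop ∧
      ∀ w : ℕ → ℝ, Tendsto w atTop atTop → (∀ᶠ N in atTop, w N ≤ g N) →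
        ∀ m t : ℕ, 0 < m → 0 < t → ∀ ε : ℝ, 0 < ε →
          ∀ᶠ N : ℕ in atTop, ∀ (R : ℝ) (W : ℕ),
            R = (N : ℝ) ^ c → W = primorial ⌊w N⌋₊ →
            ∀ (L : Fin m → Fin t → ℤ) (b : Fin m → ℤ),
              (∀ i j, |(L i j : ℝ)| ≤ Real.sqrt (w N) / 2) →
              (∀ i, L i ≠ 0) →
              (∀ i i', i ≠ i' → ¬ ∃ q : ℚ, ∀ j, (L i j : ℚ) = q * (L i' j : ℚ)) →
              ∀ (I : Fin t → Set ℝ) (lo hi : Fin t → ℝ),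
                (∀ j, GoldstonYildirim.IsIntervalWithEndpoints (I j) (lo j) (hi j)) →
                (∀ j, R ^ (10 * m) ≤ hi j - lo j) →
                |GoldstonYildirim.average (GoldstonYildirim.boxPoints I)
                      (fun x => ∏ i, GoldstonYildirim.truncatedDivisorSum R
                        ((W : ℤ) * GoldstonYildirim.affineForm (L i) (b i) x + 1) ^ 2)
                    - ((W : ℝ) * Real.log R / (Nat.totient W : ℝ)) ^ m|
                  ≤ ε * ((W : ℝ) * Real.log R / (Nat.totient W : ℝ)) ^ m := by
  have hlim : Tendsto (fun N : ℕ => (N : ℝ) ^ c) atTop atTop :=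
    (tendsto_rpow_atTop hc).comp tendsto_natCast_atTop_atTop
  -- the index `k` encodes `m`, `t` and a precision `1 / (n + 1)`
  obtain ⟨g, hg, hgQ⟩ := GoldstonYildirim.exists_slow_growth
    (Q := fun k v N => 0 < k.unpair.1.unpair.1 → 0 < k.unpair.1.unpair.2 → ∀ w : ℝ, ⌊w⌋₊ = v →
      GoldstonYildirim.UniformAsymptotic k.unpair.1.unpair.1 k.unpair.1.unpair.2
        (1 / ((k.unpair.2 : ℝ) + 1)) w ((N : ℝ) ^ c)) (by
      intro k
      by_cases h : 0 < k.unpair.1.unpair.1 ∧ 0 < k.unpair.1.unpair.2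
      · filter_upwards [GoldstonYildirim.eventually_uniformAsymptotic h.1 h.2
          (Nat.one_div_pos_of_nat (α := ℝ) (n := k.unpair.2))] with v hv
        filter_upwards [hlim.eventually hv] with N hN _ _ using hN
      · exact Eventually.of_forall fun v => Eventually.of_forall fun N h1 h2 => absurd ⟨h1, h2⟩ h)
  refine ⟨fun N => g N, tendsto_natCast_atTop_atTop.comp hg, ?_⟩
  intro w hw hwg m t hm ht ε hε
  obtain ⟨n, hn⟩ := exists_nat_one_div_lt hε
  have h := hgQ (fun N => ⌊w N⌋₊) (tendsto_nat_floor_atTop.comp hw)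
    (hwg.mono fun N hN => Nat.floor_le_of_le hN) (Nat.pair (Nat.pair m t) n)
  filter_upwards [h, hlim.eventually_ge_atTop 1] with N hN hR1
  rintro R W rfl rfl L b hL hL0 hind I lo hi hI hlen
  simp only [Nat.unpair_pair] at hN
  refine (hN hm ht (w N) rfl L b hL hL0 hind I lo hi hI hlen).trans ?_
  have := Real.log_nonneg hR1
  gcongr
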